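/- Let $V$ be a $\mathbb Q$-vector space of finite dimension $d\ge 1$, let $v$ be the real place of $\mathbb Q$, and put $V_v=\mathbb R\otimes_{\mathbb Q}V$. A norm on a $d'$-dimensional real vector space is a map of the form $\sum_i a_ie_i\mapsto (\sum_i r_i^2|a_i|^2)^{1/2}$ with $(e_i)_{1\le i\le d'}$ a basis and $r_i>0$; two norms are equivalent if they are positive multiples of each other. A parabolic subgroup $P$ of $\mathrm{PGL}_V$ over $\mathbb Q$ corresponds to a flag $0=V_{-1}\subsetneq V_0\subsetneq\dots\subsetneq V_m=V$ of $\mathbb Q$-subspaces; write $\mathrm{gr}_i=(V_i/V_{i-1})_v$. **The spaces $\bar X_{\mathbb Q,v}$ and $\bar X^\sharp_{\mathbb Q,v}$.** Let $\bar X_{\mathbb Q,v}$ be the set of pairs $(P,\mu)$ with $P$ a parabolic subgroup of $\mathrm{PGL}_V$ over $\mathbb Q$ and $\mu=(\mu_i)_{0\le i\le m}$ a family of equivalence classes of norms on the $\mathrm{gr}_i$, and let $\bar X^\sharp_{\mathbb Q,v}$ be the set of triples $(P,\mu,s)$ with $(P,\mu)\in\bar X_{\mathbb Q,v}$ and $s\colon\bigoplus_i\mathrm{gr}_i\xrightarrow{\sim}V_v$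 a splitting over $\mathbb R$ of the filtration. For a basis $e=(e_j)_{1\le j\le d}$ of $V$ and $t\in\mathbb R_{\ge0}^{d-1}$, let $x_{e,t}\in\bar X^\sharp_{\mathbb Q,v}$ be the triple whose flag consists of $0$, $V$ and the $\langle e_1,\dots,e_k\rangle$ with $t_k=0$, whose $\mu_i$ is the class of the norm given by the classes of the $e_j$, $\dim V_{i-1}<j\le \dim V_i$, and by $r_j=\prod_{\dim V_{i-1}<k<j}t_k^{-1}$, and whose splitting is given by $e$. If each member of the flag of $P$ is spanned by an initial segment of $e$, let $\mathbb R_{\ge0}^{d-1}(P)$ be the set of $t\in\mathbb R_{\ge0}^{d-1}$ with $t_k>0$ for all $k\notin\{\dim V_0,\dots,\dim V_{m-1}\}$, and let $\bar\pi^\sharp_{P,e}\colon P(\mathbb R)\times\mathbb R_{\ge 0}^{d-1}(P)\to\bar X^\sharp_{\mathbb Q,v}$ be the map $(g,t)\mapsto g\,x_{e,t}$, where $g(Q,\mu,s)=(Q,g\mu,g s g^{-1})$. Its image is $\bar X^\sharp_{\mathbb Q,v}(P)=\{(Q,\mu,s)\mid Q\supset P\}$. The Borel–Serre topology on $\bar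 X^\sharp_{\mathbb Q,v}$ is the one in which every $\bar X^\sharp_{\mathbb Q,v}(P)$ is open and has the quotient topology for $\bar\pi^\sharp_{P,e}$; that is, a set is open if and only if its inverse images under all $\bar\pi^\sharp_{P,e}$ are open. The Borel–Serre topology on $\bar X_{\mathbb Q,v}$ is defined in the same way through the maps $\bar\pi_{P,e}$ obtained by forgetting $s$. **The Borel–Serre space of $G=\mathrm{PGL}_V$.** Let $\mathcal Y$ be the space of maximal compact subgroups of $G(\mathbb R)$, topologized as a homogeneous space of $G(\mathbb R)$, and for $K\in\mathcal Y$ let $\theta_K$ be the Cartan involution of $G(\mathbb R)$ with fixed group $K$. For a parabolic subgroup $P$ over $\mathbb Q$ with unipotent radical $P_u$, let $S_P=(\prod_{i=0}^m\mathbb G_m)/\mathbb G_m$ be the largest $\mathbb Q$-split torus in the center of $P/P_u$ (the $i$-th factor acts by scalars on $V_i/V_{i-1}$) and $A_P=(\prod_i\mathbb R_{>0})/\mathbb R_{>0}$ the identity component of $S_P(\mathbb R)$. It acts on $\mathcal Y$ by $(a,K)\mapsto a_KKa_K^{-1}$, where $a_K\in P(\mathbb R)$ is the lift of $a$ with $\theta_K(a_K)=a_K^{-1}$.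 The Borel–Serre space is the set of pairs $(P,Z)$ with $P$ a parabolic subgroup of $G$ over $\mathbb Q$ and $Z$ an $A_P$-orbit in $\mathcal Y$. Let $\bar A_P=[0,\infty)^m\supset(0,\infty)^m\cong A_P$, through the coordinates $a\mapsto(a_{i+1}/a_i)_{0\le i<m}$ (the inverses of the simple roots). The space is topologized by gluing the corners $\bar A_P\times^{A_P}\mathcal Y$, which are identified with the sets $\{(Q,Z)\mid Q\supset P\}$: a set is open if and only if its inverse image is open under each map $\bar A_P\times\mathcal Y\to\{(Q,Z)\mid Q\supset P\}$, $(\tau,K)\mapsto(Q,A_Q\cdot aK)$, where the flag of $Q$ consists of $0$, $V$ and the $V_i$ with $\tau_i=0$, and where $a\in A_P$ has the same nonzero coordinates as $\tau$ and coordinate $1$ elsewhere. The reductive Borel–Serre space is the quotient of the Borel–Serre space (with the quotient topology) by the relation $(P,Z)\sim(P,gZg^{-1})$ for $g\in P_u(\mathbb R)$. **Proposition.** The canonical map $(P,\mu,s)\mapsto(P,Z)$, where $Z$ is the set of the isotropy groups in $\mathrm{PGL}_V(\mathbb R)$ of the classes of the norms $$x\mapsto\Big(\sum_{i=0}^m\tilde\mu_i(s^{-1}(x)_i)^2\Big)^{1/2}$$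 on $V_v$, for all families of norms $\tilde\mu_i$ on $\mathrm{gr}_i$ with class $\mu_i$, is a well-defined homeomorphism from $\bar X^\sharp_{\mathbb Q,v}$ with its Borel–Serre topology onto the Borel–Serre space of $\mathrm{PGL}_V$. It induces a homeomorphism from $\bar X_{\mathbb Q,v}$ with its Borel–Serre topology onto the reductive Borel–Serre space of $\mathrm{PGL}_V$. -/

import Mathlib

open scoped TensorProduct

noncomputable section

namespace BSpace

/-! ### Norms on real vector spaces -/

section Norms

variable {W : Type*} [AddCommGroup W] [Module ℝ W]

/-- `μ` is a norm on the finite-dimensional real vector space `W`: for some basis `(e_i)` and some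
positive `(r_i)`, `μ (∑ a_i e_i) = (∑ r_i ^ 2 |a_i| ^ 2) ^ (1/2)`. -/
def IsNorm (μ : W → ℝ) : Prop :=
  ∃ (e : Module.Basis (Fin (Module.finrank ℝ W)) ℝ W) (r : Fin (Module.finrank ℝ W) → ℝ),
    (∀ i, 0 < r i) ∧ ∀ x, μ x = √(∑ i, r i ^ 2 * |e.repr x i| ^ 2)

theorem IsNorm.of_basis {ι : Type*} [Fintype ι] (e : Module.Basis ι ℝ W) (r : ι → ℝ)
    (hr : ∀ i, 0 < r i) : IsNorm (fun x : W => √(∑ i, r i ^ 2 * |e.repr x i| ^ 2)) := by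
  classical
  have hc : Fintype.card ι = Module.finrank ℝ W := (Module.finrank_eq_card_basis e).symm
  let f : ι ≃ Fin (Module.finrank ℝ W) := Fintype.equivFinOfCardEq hc
  refine ⟨e.reindex f, fun i => r (f.symm i), fun i => hr _, fun x => ?_⟩
  refine congrArg Real.sqrt (Fintype.sum_equiv f _ _ fun i => ?_)
  simp

theorem IsNorm.comp_equiv {μ : W → ℝ} (hμ : IsNorm μ) (g : W ≃ₗ[ℝ] W) :
    IsNorm (fun x : W => μ (g x)) := by
  obtain ⟨e, r, hr, h⟩ := hμ
  exact ⟨e.map g.symm, r, hr, fun x => by simp [h]⟩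

variable (W) in
/-- The set of norms on `W`. -/
def NormOn : Type _ := {μ : W → ℝ // IsNorm μ}

variable (W) in
/-- Two norms are equivalent if one is a positive multiple of the other. -/
def normSetoid : Setoid (NormOn W) where
  r μ μ' := ∃ c : ℝ, 0 < c ∧ ∀ x, μ'.1 x = c * μ.1 x
  iseqv :=
    { refl := fun _ => ⟨1, one_pos, by simp⟩
      symm := by
        rintro μ μ' ⟨c, hc, h⟩
        exact ⟨c⁻¹, inv_pos.2 hc, fun x => by rw [h, ← mul_assoc, inv_mul_cancel₀ hc.ne', one_mul]⟩
      trans := by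
        rintro μ μ' μ'' ⟨c, hc, h⟩ ⟨c', hc', h'⟩
        exact ⟨c' * c, mul_pos hc' hc, fun x => by rw [h', h, mul_assoc]⟩ }

variable (W) in
/-- The set `X_W` of equivalence classes of norms on `W`. -/
def NormClass : Type _ := Quotient (normSetoid W)

/-- The class of a norm. -/
def NormOn.cls (μ : NormOn W) : NormClass W := Quotient.mk (normSetoid W) μ

/-- The action `g μ = μ ∘ g⁻¹` of linear automorphisms on classes of norms. -/
def NormClass.act (g : W ≃ₗ[ℝ] W) : NormClass W → NormClass W :=
  Quotient.map' (s₁ := normSetoid W) (s₂ := normSetoid W)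
    (fun μ => (⟨fun x => μ.1 (g.symm x), μ.2.comp_equiv g.symm⟩ : NormOn W)) (by
      rintro μ μ' ⟨c, hc, h⟩
      exact ⟨c, hc, fun x => h _⟩)

end Norms

/-! ### Graded pieces of coordinate subspaces -/

section CoordinateBlocks

variable {M ι : Type*} [AddCommGroup M] [Module ℝ M] [Fintype ι]

/-- For a basis `B` of `M`, and `p = ⟨B_j, j ∈ S⟩`, `q = ⟨B_j, j ∈ T⟩`, the classes of the `B_j` for
`j ∈ T \ S` form a basis of `q / (p ∩ q)`. -/
def blockBasis (B : Module.Basis ι ℝ M) (S T : Set ι) (p q : Submodule ℝ M)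
    (hp : p = Submodule.span ℝ (B '' S)) (hq : q = Submodule.span ℝ (B '' T)) :
    Module.Basis {j : ι // j ∈ T ∧ j ∉ S} ℝ (q ⧸ p.submoduleOf q) :=
  Module.Basis.mk
    (v := fun j => Submodule.Quotient.mk
      (⟨B j.1, by rw [hq]; exact Submodule.subset_span ⟨j.1, j.2.1, rfl⟩⟩ : q))
    (by
      classical
      rw [Fintype.linearIndependent_iff]
      intro a ha j
      have h1 : (Submodule.Quotient.mk (∑ i : {j : ι // j ∈ T ∧ j ∉ S}, a i •
          (⟨B i.1, by rw [hq]; exact Submodule.subset_span ⟨i.1, i.2.1, rfl⟩⟩ : q)) :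
            q ⧸ p.submoduleOf q) = 0 := by
        rw [← ha, ← Submodule.mkQ_apply, map_sum]
        rfl
      rw [Submodule.Quotient.mk_eq_zero, Submodule.submoduleOf, Submodule.mem_comap, Submodule.subtype_apply, hp,
        Module.Basis.mem_span_image] at h1
      by_contra hne
      have h2 : j.1 ∈ S := by
        apply h1
        simp only [Finset.mem_coe, Finsupp.mem_support_iff]
        have : B.repr ((∑ i : {j : ι // j ∈ T ∧ j ∉ S}, a i •
          (⟨B i.1, by rw [hq]; exact Submodule.subset_span ⟨i.1, i.2.1, rfl⟩⟩ : q) : q) : M) j.1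
            = a j := by
          rw [Submodule.coe_sum, map_sum, Finsupp.coe_finsetSum, Finset.sum_apply,
            Finset.sum_eq_single j]
          · simp
          · intro b _ hb
            simp [Subtype.ext_iff.not.1 hb]
          · simp
        rw [this]
        exact hne
      exact j.2.2 h2)
    (by
      rintro x -
      obtain ⟨y, rfl⟩ := Submodule.Quotient.mk_surjective _ x
      obtain ⟨y, hy⟩ := y
      have hy' := hy
      rw [hq] at hy'
      revert hy
      refine Submodule.span_induction (p := fun y _ => ∀ hy : y ∈ q,
        (Submodule.Quotient.mk (⟨y, hy⟩ : q) : q ⧸ p.submoduleOf q) ∈ Submodule.span ℝ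
          (Set.range fun j : {j : ι // j ∈ T ∧ j ∉ S} => (Submodule.Quotient.mk
            (⟨B j.1, by rw [hq]; exact Submodule.subset_span ⟨j.1, j.2.1, rfl⟩⟩ : q) :
              q ⧸ p.submoduleOf q))) ?_ ?_ ?_ ?_ hy'
      · rintro _ ⟨j, hj, rfl⟩ hjq
        by_cases hS : j ∈ S
        · have : (Submodule.Quotient.mk (⟨B j, hjq⟩ : q) : q ⧸ p.submoduleOf q) = 0 := by
            rw [Submodule.Quotient.mk_eq_zero, Submodule.submoduleOf, Submodule.mem_comap, Submodule.subtype_apply, hp]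
            exact Submodule.subset_span ⟨j, hS, rfl⟩
          rw [this]
          exact Submodule.zero_mem _
        · exact Submodule.subset_span ⟨⟨j, hj, hS⟩, rfl⟩
      · intro h0
        have : (⟨0, h0⟩ : q) = 0 := rfl
        rw [this, Submodule.Quotient.mk_zero]
        exact Submodule.zero_mem _
      · intro x y hx hy ihx ihy hxy
        have hx' : x ∈ q := by rw [hq]; exact hx
        have hy' : y ∈ q := by rw [hq]; exact hy
        have : (⟨x + y, hxy⟩ : q) = ⟨x, hx'⟩ + ⟨y, hy'⟩ := rfl
        rw [this, Submodule.Quotient.mk_add]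
        exact Submodule.add_mem _ (ihx hx') (ihy hy')
      · intro a x hx ih hax
        have hx' : x ∈ q := by rw [hq]; exact hx
        have : (⟨a • x, hax⟩ : q) = a • ⟨x, hx'⟩ := rfl
        rw [this, Submodule.Quotient.mk_smul]
        exact Submodule.smul_mem _ _ (ih hx'))

end CoordinateBlocks

variable (V : Type*) [AddCommGroup V] [Module ℚ V] [FiniteDimensional ℚ V]

/-! ### The group `PGL_V(ℝ)` -/

/-- `V_v = F_v ⊗_F V` for `F = ℚ` and `v` the real place. -/
abbrev VR : Type _ := ℝ ⊗[ℚ] V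

/-- The usual topology of the finite-dimensional real vector space `End(V_v)`. -/
instance : TopologicalSpace (Module.End ℝ (VR V)) := moduleTopology ℝ _

instance : IsModuleTopology ℝ (Module.End ℝ (VR V)) := ⟨rfl⟩

instance : IsTopologicalRing (Module.End ℝ (VR V)) := IsModuleTopology.isTopologicalRing ℝ _

/-- `GL_V(ℝ)`, a topological group. -/
abbrev GLR : Type _ := (Module.End ℝ (VR V))ˣ

/-- `PGL_V(ℝ)`, the quotient of `GL_V(ℝ)` by its center (the scalars), a topological group. -/
abbrev PGLR : Type _ := GLR V ⧸ Subgroup.center (GLR V)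

variable {V}

/-- The image in `PGL_V(ℝ)` of an element of `GL_V(ℝ)`. -/
def toPGL : GLR V →* PGLR V := QuotientGroup.mk' _

/-! ### Parabolic subgroups, as flags -/

variable (V) in
/-- A parabolic subgroup `P` of `PGL_V` over `ℚ`, given by the corresponding flag of `ℚ`-subspaces
of `V`: a set of subspaces containing `0` and `V` and totally ordered under inclusion. (`P` is the
isotropy group of its flag, and the flag is the set of all `P`-stable subspaces.) -/
@[ext] structure Parabolic where
  carrier : Set (Submodule ℚ V)
  chain : IsChain (· ≤ ·) carrier
  bot_mem : ⊥ ∈ carrier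
  top_mem : ⊤ ∈ carrier

namespace Parabolic

variable (P : Parabolic V)

/-- The nonzero members `V_i`, `0 ≤ i ≤ m`, of the flag `0 = V_{-1} ⊊ V_0 ⊊ ⋯ ⊊ V_m = V`. -/
def Index : Type _ := {W : Submodule ℚ V // W ∈ P.carrier ∧ W ≠ ⊥}

/-- The members `V_i`, `0 ≤ i ≤ m - 1`, of the flag `0 = V_{-1} ⊊ V_0 ⊊ ⋯ ⊊ V_m = V`. -/
def Proper : Type _ := {W : Submodule ℚ V // W ∈ P.carrier ∧ W ≠ ⊥ ∧ W ≠ ⊤}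

theorem finite_carrier : P.carrier.Finite := by
  refine Set.Finite.of_finite_image
    (f := fun W : Submodule ℚ V => Module.finrank ℚ W) ?_ ?_
  · refine (Set.finite_Iic (Module.finrank ℚ V)).subset ?_
    rintro _ ⟨W, -, rfl⟩
    exact Submodule.finrank_le W
  · intro W hW W' hW' h
    rcases P.chain.total hW hW' with h' | h'
    · exact Submodule.eq_of_le_of_finrank_eq h' h
    · exact (Submodule.eq_of_le_of_finrank_eq h' h.symm).symm

instance : Finite P.Index :=
  Set.Finite.subset P.finite_carrier (s := P.carrier)
    (t := {W | W ∈ P.carrier ∧ W ≠ ⊥}) fun _ h => h.1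

instance : Finite P.Proper :=
  Set.Finite.subset P.finite_carrier (s := P.carrier)
    (t := {W | W ∈ P.carrier ∧ W ≠ ⊥ ∧ W ≠ ⊤}) fun _ h => h.1

instance : Fintype P.Index := Fintype.ofFinite _

instance : Fintype P.Proper := Fintype.ofFinite _

/-- The predecessor `V_{i-1}` of `V_i` in the flag: its largest member strictly inside `V_i`. -/
def pred (W : P.Index) : Submodule ℚ V := sSup {U | U ∈ P.carrier ∧ U < W.1}

theorem pred_isGreatest (W : P.Index) :
    IsGreatest {U | U ∈ P.carrier ∧ U < W.1} (P.pred W) := by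
  have hne : {U | U ∈ P.carrier ∧ U < W.1}.Nonempty :=
    ⟨⊥, P.bot_mem, bot_lt_iff_ne_bot.2 W.2.2⟩
  obtain ⟨m, hm, hmax⟩ := WellFounded.has_min
    (wellFounded_gt : WellFounded ((· > ·) : Submodule ℚ V → Submodule ℚ V → Prop)) _ hne
  have hg : IsGreatest {U | U ∈ P.carrier ∧ U < W.1} m := by
    refine ⟨hm, fun U hU => ?_⟩
    rcases P.chain.total hU.1 hm.1 with h | h
    · exact h
    · rcases h.lt_or_eq with h' | h'
      · exact absurd h' (hmax U hU)
      · exact h'.ge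
  have : P.pred W = m := hg.isLUB.sSup_eq
  rw [this]
  exact hg

theorem pred_mem (W : P.Index) : P.pred W ∈ P.carrier := (P.pred_isGreatest W).1.1

/-- The real subspace `(V_i)_v` of `V_v`. -/
def real (W : P.Index) : Submodule ℝ (VR V) := W.1.baseChange ℝ

/-- The real subspace `(V_{i-1})_v` of `V_v`. -/
def realPred (W : P.Index) : Submodule ℝ (VR V) := (P.pred W).baseChange ℝ

/-- The graded piece `(V_i)_v / (V_{i-1})_v = (V_i / V_{i-1})_v`. -/
abbrev gr (W : P.Index) : Type _ := P.real W ⧸ (P.realPred W).submoduleOf (P.real W)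

/-- The inverse image in `GL_V(ℝ)` of `P(ℝ)`. -/
def stabGL : Subgroup (GLR V) where
  carrier := {h | ∀ W ∈ P.carrier, ∀ x ∈ W.baseChange ℝ,
    h.1 x ∈ W.baseChange ℝ ∧ (h⁻¹).1 x ∈ W.baseChange ℝ}
  one_mem' := fun W _ x hx => by simpa using hx
  mul_mem' := by
    intro g h hg hh W hW x hx
    refine ⟨(hg W hW _ (hh W hW x hx).1).1, ?_⟩
    rw [mul_inv_rev]
    exact (hh W hW _ (hg W hW x hx).2).2
  inv_mem' := by
    intro g hg W hW x hx
    rw [inv_inv]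
    exact ⟨(hg W hW x hx).2, (hg W hW x hx).1⟩

/-- `P(ℝ)`, a subgroup of `PGL_V(ℝ)`. -/
def realPoints : Subgroup (PGLR V) := P.stabGL.map toPGL

/-- A lift to `GL_V(ℝ)` of an element of `P(ℝ)`. -/
def lift (g : P.realPoints) : P.stabGL :=
  ⟨Classical.choose g.2, (Classical.choose_spec g.2).1⟩

theorem toPGL_lift (g : P.realPoints) : toPGL (P.lift g).1 = g.1 :=
  (Classical.choose_spec g.2).2

/-- The restriction to `(V_i)_v` of an element of `GL_V(ℝ)` which respects the flag. -/
def resMap (h : P.stabGL) (W : P.Index) : P.real W →ₗ[ℝ] P.real W :=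
  h.1.1.restrict fun x hx => (h.2 W.1 W.2.1 x hx).1

/-- The map induced on the graded piece by an element of `GL_V(ℝ)` which respects the flag. -/
def grMap (h : P.stabGL) (W : P.Index) : P.gr W →ₗ[ℝ] P.gr W :=
  Submodule.mapQ _ _ (P.resMap h W) fun x hx => (h.2 (P.pred W) (P.pred_mem W) x.1 hx).1

theorem grMap_comp_inv (h : P.stabGL) (W : P.Index) :
    P.grMap h W ∘ₗ P.grMap h⁻¹ W = LinearMap.id := by
  refine Submodule.linearMap_qext _ (LinearMap.ext fun x => ?_)
  have : P.resMap h W (P.resMap h⁻¹ W x) = x := by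
    apply Subtype.ext
    change (h.1.1 * (h.1⁻¹).1) x.1 = x.1
    rw [Units.mul_inv]
    rfl
  change Submodule.Quotient.mk (P.resMap h W (P.resMap h⁻¹ W x)) = Submodule.Quotient.mk x
  rw [this]

/-- The automorphism induced on the graded piece by an element of `GL_V(ℝ)` which respects the
flag. -/
def grEquiv (h : P.stabGL) (W : P.Index) : P.gr W ≃ₗ[ℝ] P.gr W :=
  LinearEquiv.ofLinearMap (P.grMap h W) (P.grMap h⁻¹ W) (P.grMap_comp_inv h W)
    (by simpa using P.grMap_comp_inv h⁻¹ W)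

/-- `g ∈ P_u(ℝ)`, where `P_u` is the unipotent radical of `P`: up to scalars, `g` induces the
identity on all graded pieces of the flag. -/
def IsUnipotentRadical (g : PGLR V) : Prop :=
  ∃ h : P.stabGL, toPGL h.1 = g ∧ ∀ W, P.grMap h W = LinearMap.id

end Parabolic

/-! ### The spaces `X̄_{ℚ,v}` and `X̄^♯_{ℚ,v}` -/

variable (V) in
/-- The set `X̄_{ℚ,v}` of pairs `(P, μ)`, with `P` a parabolic subgroup of `PGL_V` over `ℚ` and
`μ = (μ_i)` a family of equivalence classes of norms on the `(V_i / V_{i-1})_v`. -/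
structure XBar where
  P : Parabolic V
  μ : ∀ W : P.Index, NormClass (P.gr W)

/-- A splitting over `ℝ` of the filtration `((V_i)_v)`, given by its components: linear sections
`(V_i / V_{i-1})_v → (V_i)_v` of the projections. (Their sum `⨁ (V_i / V_{i-1})_v → V_v` is
automatically an isomorphism.) -/
structure Splitting (P : Parabolic V) where
  map : ∀ W : P.Index, P.gr W →ₗ[ℝ] P.real W
  section_map : ∀ (W : P.Index) (y : P.gr W), Submodule.Quotient.mk (map W y) = y

/-- The map `⨁ (V_i / V_{i-1})_v → V_v` of a splitting. -/
def Splitting.total {P : Parabolic V} (s : Splitting P) (y : ∀ W : P.Index, P.gr W) : VR V :=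
  ∑ W, (s.map W (y W) : VR V)

variable (V) in
/-- The set `X̄^♯_{ℚ,v}` of triples `(P, μ, s)`, with `(P, μ)` in `X̄_{ℚ,v}` and `s` a splitting of
the filtration over `ℝ`. -/
structure XSharp extends XBar V where
  s : Splitting P

/-- The action of `h` on `(P, μ, s)`, for `h` which respects the flag of `P`:
`h (P, μ, s) = (P, h μ, h ∘ s ∘ h⁻¹)`. -/
def XSharp.act (x : XSharp V) (h : x.P.stabGL) : XSharp V where
  P := x.P
  μ := fun W => (x.μ W).act (x.P.grEquiv h W)
  s :=
    { map := fun W => x.P.resMap h W ∘ₗ x.s.map W ∘ₗ x.P.grMap h⁻¹ W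
      section_map := fun W y => by
        have h1 := x.s.section_map W (x.P.grMap h⁻¹ W y)
        have h2 : (Submodule.Quotient.mk (x.P.resMap h W (x.s.map W (x.P.grMap h⁻¹ W y))) :
            x.P.gr W) = x.P.grMap h W (Submodule.Quotient.mk (x.s.map W (x.P.grMap h⁻¹ W y))) :=
          rfl
        have h3 := LinearMap.congr_fun (x.P.grMap_comp_inv h W) y
        simp only [LinearMap.comp_apply, LinearMap.id_apply] at h3 ⊢
        rw [h2, h1, h3] }

/-! ### The Borel–Serre topology on `X̄^♯_{ℚ,v}` and `X̄_{ℚ,v}` -/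

section Charts

variable {n : ℕ} (e : Module.Basis (Fin (n + 1)) ℚ V)

/-- The span of the first `c` vectors of the basis. -/
def coordSub (c : ℕ) : Submodule ℚ V := Submodule.span ℚ (e '' {j | (j : ℕ) < c})

theorem coordSub_mono {c c' : ℕ} (h : c ≤ c') : coordSub e c ≤ coordSub e c' :=
  Submodule.span_mono (Set.image_mono fun _ hj => lt_of_lt_of_le hj h)

/-- The parabolic subgroup attached to a basis `e_1, …, e_d` of `V` and `t ∈ ℝ_{≥0}^{d-1}`: its flag
consists of `0`, `V` and the `⟨e_1, …, e_k⟩` with `t_k = 0`. Here `d = n + 1`, and `t_{k+1}` is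
written `t k`. -/
def stdParabolic (t : Fin n → ℝ) : Parabolic V where
  carrier := {W | W = ⊥ ∨ W = ⊤ ∨ ∃ k : Fin n, t k = 0 ∧ W = coordSub e (k + 1)}
  chain := by
    rintro W hW W' hW' -
    rcases hW with rfl | rfl | ⟨k, -, rfl⟩
    · exact Or.inl bot_le
    · exact Or.inr le_top
    · rcases hW' with rfl | rfl | ⟨k', -, rfl⟩
      · exact Or.inr bot_le
      · exact Or.inl le_top
      · rcases le_total (k : ℕ) k' with h | h
        · exact Or.inl (coordSub_mono e (by omega))
        · exact Or.inr (coordSub_mono e (by omega))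
  bot_mem := Or.inl rfl
  top_mem := Or.inr (Or.inl rfl)

theorem stdParabolic_coord (t : Fin n → ℝ) {W : Submodule ℚ V}
    (hW : W ∈ (stdParabolic e t).carrier) : W = Submodule.span ℚ (e '' {j | e j ∈ W}) := by
  refine le_antisymm ?_ (Submodule.span_le.2 ?_)
  · rcases hW with rfl | rfl | ⟨k, -, rfl⟩
    · exact bot_le
    · rw [← e.span_eq]
      exact Submodule.span_mono (by rintro _ ⟨j, rfl⟩; exact ⟨j, Submodule.subset_span ⟨j, rfl⟩, rfl⟩)
    · exact Submodule.span_mono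
        (Set.image_mono fun j hj => Submodule.subset_span ⟨j, hj, rfl⟩)
  · rintro _ ⟨j, hj, rfl⟩
    exact hj

theorem stdParabolic_real (t : Fin n → ℝ) {W : Submodule ℚ V}
    (hW : W ∈ (stdParabolic e t).carrier) :
    W.baseChange ℝ = Submodule.span ℝ (e.baseChange ℝ '' {j | e j ∈ W}) := by
  conv_lhs => rw [stdParabolic_coord e t hW, Submodule.baseChange_span]
  congr 1
  ext x
  simp [Set.mem_image]

/-- The basis of `(V_i / V_{i-1})_v` formed by the classes of the `e_j` with
`dim V_{i-1} < j ≤ dim V_i`. -/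
def stdBasis (t : Fin n → ℝ) (W : (stdParabolic e t).Index) :
    Module.Basis {j : Fin (n + 1) // e j ∈ W.1 ∧ e j ∉ (stdParabolic e t).pred W} ℝ
      ((stdParabolic e t).gr W) :=
  blockBasis (e.baseChange ℝ) {j | e j ∈ (stdParabolic e t).pred W} {j | e j ∈ W.1}
    ((stdParabolic e t).realPred W) ((stdParabolic e t).real W)
    (stdParabolic_real e t ((stdParabolic e t).pred_mem W)) (stdParabolic_real e t W.2.1)

open Classical in
/-- The coefficients `r_j = ∏ t_k⁻¹`, the product over the `k < j` with `t_k ≠ 0`. For `j` in a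
given block `dim V_{i-1} < j ≤ dim V_i`, this is the product of the `t_k⁻¹` with
`dim V_{i-1} < k < j` up to a positive factor which depends only on the block, so it gives the same
class of norms on `(V_i / V_{i-1})_v`. -/
def stdCoeff (t : Fin n → ℝ) (j : Fin (n + 1)) : ℝ :=
  ∏ k : Fin n with k.val < j.val ∧ t k ≠ 0, (t k)⁻¹

theorem stdCoeff_pos {t : Fin n → ℝ} (ht : ∀ k, 0 ≤ t k) (j : Fin (n + 1)) :
    0 < stdCoeff t j := by
  classical
  refine Finset.prod_pos fun k hk => inv_pos.2 ?_
  exact lt_of_le_of_ne (ht k) (Ne.symm (Finset.mem_filter.1 hk).2.2)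

/-- The point `(P, μ, s)` of `X̄^♯_{ℚ,v}` attached to a basis `e` and `t ∈ ℝ_{≥0}^{d-1}`: `μ_i` is the
class of the norm on `(V_i / V_{i-1})_v` given by the basis `(e_j)` and the `r_j`, and `s` is the
splitting given by `e`. -/
def stdPoint (t : Fin n → ℝ) (ht : ∀ k, 0 ≤ t k) : XSharp V where
  P := stdParabolic e t
  μ := fun W => NormOn.cls ⟨_, open Classical in
    IsNorm.of_basis (stdBasis e t W) (fun j => stdCoeff t j.1) fun j => stdCoeff_pos ht j.1⟩
  s :=
    { map := fun W => (stdBasis e t W).constr ℝ fun j =>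
        (⟨e.baseChange ℝ j.1, by
          rw [Parabolic.real, stdParabolic_real e t W.2.1]
          exact Submodule.subset_span ⟨j.1, j.2.1, rfl⟩⟩ : (stdParabolic e t).real W)
      section_map := fun W y => by
        have : Submodule.mkQ _ ∘ₗ ((stdBasis e t W).constr ℝ fun j =>
          (⟨e.baseChange ℝ j.1, by
            rw [Parabolic.real, stdParabolic_real e t W.2.1]
            exact Submodule.subset_span ⟨j.1, j.2.1, rfl⟩⟩ : (stdParabolic e t).real W)) =
            LinearMap.id := by
          refine (stdBasis e t W).ext fun j => ?_
          rw [LinearMap.comp_apply, Module.Basis.constr_basis]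
          simp [stdBasis, blockBasis]
        exact LinearMap.congr_fun this y }

/-- `P` contains the Borel subgroup of upper triangular matrices for the basis `e`: each member `W`
of its flag is generated by the `e_j` with `1 ≤ j ≤ dim W`. -/
def Adapted (P : Parabolic V) : Prop :=
  ∀ W ∈ P.carrier, W = coordSub e (Module.finrank ℚ W)

/-- `ℝ_{≥0}^{d-1}(P)`, the set of `t ∈ ℝ_{≥0}^{d-1}` with `t_k > 0` for all `k` outside
`Δ(P) = {dim V_i | 0 ≤ i ≤ m - 1}`. -/
def orthant (n : ℕ) (P : Parabolic V) : Set (Fin n → ℝ) :=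
  {t | (∀ k, 0 ≤ t k) ∧ ∀ k : Fin n, (∀ W : P.Proper, Module.finrank ℚ W.1 ≠ (k : ℕ) + 1) → 0 < t k}

theorem stdParabolic_subset {P : Parabolic V} (hP : Adapted e P) {t : Fin n → ℝ}
    (ht : t ∈ orthant n P) : (stdParabolic e t).carrier ⊆ P.carrier := by
  rintro W (rfl | rfl | ⟨k, hk, rfl⟩)
  · exact P.bot_mem
  · exact P.top_mem
  · by_contra hW
    refine (ht.2 k fun U hU => hW ?_).ne' hk
    rw [← hU, ← hP U.1 U.2.1]
    exact U.2.1

/-- The map `π̄^♯_{P,v} : P(ℝ) × ℝ_{≥0}^{d-1}(P) → X̄^♯_{ℚ,v}(P) ⊆ X̄^♯_{ℚ,v}`,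
`(g, t) ↦ g (Q, μ, s)`, where `(Q, μ, s)` is the point attached to `e` and `t`. -/
def chartSharp (P : Parabolic V) (hP : Adapted e P) (x : P.realPoints × orthant n P) : XSharp V :=
  (stdPoint e x.2.1 x.2.2.1).act
    ⟨(P.lift x.1).1, fun W hW => (P.lift x.1).2 W (stdParabolic_subset e hP x.2.2 hW)⟩

/-- The map `π̄_{P,v} : P(ℝ) × ℝ_{≥0}^{d-1}(P) → X̄_{ℚ,v}(P) ⊆ X̄_{ℚ,v}`. -/
def chartBar (P : Parabolic V) (hP : Adapted e P) (x : P.realPoints × orthant n P) : XBar V :=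
  (chartSharp e P hP x).toXBar

end Charts

/-- The Borel–Serre topology on `X̄^♯_{ℚ,v}`, glued from the quotient topologies of the images
`X̄^♯_{ℚ,v}(P)` of all the maps `π̄^♯_{P,v}`: a set is open if and only if its inverse images under
all of them, for all `P` and all bases `e` adapted to `P`, are open. -/
instance : TopologicalSpace (XSharp V) :=
  ⨆ (n : ℕ) (e : Module.Basis (Fin (n + 1)) ℚ V) (P : Parabolic V) (hP : Adapted e P),
    TopologicalSpace.coinduced (chartSharp e P hP) inferInstance

/-- The Borel–Serre topology on `X̄_{ℚ,v}`, glued in the same way from the maps `π̄_{P,v}`. -/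
instance : TopologicalSpace (XBar V) :=
  ⨆ (n : ℕ) (e : Module.Basis (Fin (n + 1)) ℚ V) (P : Parabolic V) (hP : Adapted e P),
    TopologicalSpace.coinduced (chartBar e P hP) inferInstance

/-! ### The Borel–Serre space of `PGL_V` -/

variable (V) in
/-- The space of maximal compact subgroups of `PGL_V(ℝ)`. -/
def MaxCompact : Type _ :=
  {K : Subgroup (PGLR V) // IsCompact (K : Set (PGLR V)) ∧
    ∀ K' : Subgroup (PGLR V), IsCompact (K' : Set (PGLR V)) → K ≤ K' → K' = K}

/-- The conjugate `g K g⁻¹`. -/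
def MaxCompact.conj (g : PGLR V) (K : MaxCompact V) : MaxCompact V :=
  ⟨K.1.map (MulAut.conj g).toMonoidHom, by
    have hcont : ∀ a : PGLR V, Continuous (MulAut.conj a).toMonoidHom := fun a => by
      change Continuous fun x => a * x * a⁻¹
      fun_prop
    refine ⟨by simpa using K.2.1.image (hcont g), fun K' hK' hle => ?_⟩
    have h1 : K'.map (MulAut.conj g⁻¹).toMonoidHom = K.1 := by
      refine K.2.2 _ (by simpa using hK'.image (hcont g⁻¹)) fun x hx => ?_
      exact ⟨g * x * g⁻¹, hle ⟨x, hx, rfl⟩, by simp [mul_assoc]⟩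
    rw [← h1]
    ext x
    constructor
    · intro hx
      exact ⟨g⁻¹ * x * g, ⟨x, hx, by simp⟩, by simp [mul_assoc]⟩
    · rintro ⟨_, ⟨y, hy, rfl⟩, rfl⟩
      simpa [mul_assoc] using hy⟩

/-- The topology of the space of maximal compact subgroups as a homogeneous space of `PGL_V(ℝ)`:
the quotient topology for the maps `g ↦ g K g⁻¹`. -/
instance : TopologicalSpace (MaxCompact V) :=
  ⨆ K : MaxCompact V,
    TopologicalSpace.coinduced (fun g : PGLR V => MaxCompact.conj g K) inferInstance

/-- `θ` is the Cartan involution of `PGL_V(ℝ)` corresponding to `K`. -/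
structure IsCartanInvolution (K : MaxCompact V) (θ : PGLR V →* PGLR V) : Prop where
  continuous : Continuous θ
  involutive : ∀ g, θ (θ g) = g
  mem_iff : ∀ g, g ∈ K.1 ↔ θ g = g

namespace Parabolic

variable (P : Parabolic V)

/-- The largest `ℚ`-split torus `S_P` in the center of `P / P_u` is `(∏_i 𝔾_m) / 𝔾_m`, the `i`-th
factor acting by scalars on `V_i / V_{i-1}`, and `A_P`, the identity component of `S_P(ℝ)`, is the
quotient by the diagonal of `∏_i ℝ_{>0}`, the set of families `(a_i)` that is defined here. Such a
family acts on maximal compact subgroups through `A_P`. -/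
def Torus : Set (P.Index → ℝ) := {a | ∀ W, 0 < a W}

/-- `g` is the lift `a_K ∈ S_{P,K}(ℝ) ⊆ P(ℝ)` of the element of `A_P` given by `a`: modulo `P_u` it
is given by the scalars `a_i` on the `V_i / V_{i-1}`, and the Cartan involution of `K` sends it to
its inverse. -/
def IsGeodesicLift (a : P.Index → ℝ) (K : MaxCompact V) (g : PGLR V) : Prop :=
  (∃ h : P.stabGL, toPGL h.1 = g ∧ ∀ W, P.grMap h W = a W • LinearMap.id) ∧
    ∃ θ, IsCartanInvolution K θ ∧ θ g = g⁻¹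

/-- The action of `A_P` on maximal compact subgroups: `(a, K) ↦ a_K K a_K⁻¹`. -/
def geodesicAct (a : P.Index → ℝ) (K : MaxCompact V) : MaxCompact V :=
  MaxCompact.conj (Classical.epsilon (P.IsGeodesicLift a K)) K

/-- The `A_P`-orbit of `K`. -/
def geodesicOrbit (K : MaxCompact V) : Set (MaxCompact V) :=
  {K' | ∃ a ∈ P.Torus, K' = P.geodesicAct a K}

end Parabolic

variable (V) in
/-- The Borel–Serre space of `PGL_V`: the set of pairs `(P, Z)`, with `P` a parabolic subgroup of
`PGL_V` over `ℚ` and `Z` an `A_P`-orbit in the space of maximal compact subgroups of `PGL_V(ℝ)`. -/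
structure BorelSerre where
  P : Parabolic V
  Z : Set (MaxCompact V)
  isOrbit : ∃ K, Z = P.geodesicOrbit K

/-! The topology is glued from the corners `X(P) = Ā_P ×^{A_P} 𝒴`, with `𝒴` the space of maximal
compact subgroups. -/

namespace Parabolic

variable (P : Parabolic V)

/-- The partial compactification `Ā_P = [0, ∞)^Δ` of `A_P = (0, ∞)^Δ`, with `Δ` the set of simple
roots of `A_P` acting on `P_u`. There is one such root `α` for each `V_i`, `0 ≤ i ≤ m - 1`, with
`α(a) = a_i / a_{i+1}`, and the coordinate of `a` used here is `α(a)⁻¹ = a_{i+1} / a_i`. -/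
def TorusBar : Set (P.Proper → ℝ) := {τ | ∀ U, 0 ≤ τ U}

open Classical in
/-- An element of `A_P` with the same nonzero coordinates as `τ ∈ Ā_P`, and with coordinate `1`
where that of `τ` is `0`: the family `(a_i)` with `a_0 = 1` and `a_{i+1} / a_i` the coordinate. -/
def torusOf (τ : P.Proper → ℝ) (W : P.Index) : ℝ :=
  ∏ U : P.Proper with U.1 < W.1 ∧ τ U ≠ 0, τ U

/-- The parabolic subgroup `Q ⊇ P` whose flag consists of `0`, `V` and the `V_i` for which the
corresponding coordinate of `τ` vanishes. -/
def faceOf (τ : P.Proper → ℝ) : Parabolic V where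
  carrier := {W | W = ⊥ ∨ W = ⊤ ∨ ∃ U : P.Proper, τ U = 0 ∧ W = U.1}
  chain := by
    refine P.chain.mono ?_
    rintro W (rfl | rfl | ⟨U, -, rfl⟩)
    exacts [P.bot_mem, P.top_mem, U.2.1]
  bot_mem := Or.inl rfl
  top_mem := Or.inr (Or.inl rfl)

/-- The map `Ā_P × 𝒴 → X(P) = Ā_P ×^{A_P} 𝒴 ⊆ {(Q, Z) | Q ⊇ P}`: an element of the face of `Ā_P`
corresponding to `Q ⊇ P` is represented by an element `a` of `A_P`, well defined modulo `A_Q`, and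
`(a, K)` is sent to `(Q, Z)` with `Z` the `A_Q`-orbit of `a · K`. -/
def corner (x : P.TorusBar × MaxCompact V) : BorelSerre V where
  P := P.faceOf x.1.1
  Z := (P.faceOf x.1.1).geodesicOrbit (P.geodesicAct (P.torusOf x.1.1) x.2)
  isOrbit := ⟨_, rfl⟩

end Parabolic

/-- The topology of the Borel–Serre space, glued from the corners `X(P)`, which are quotients of the
`Ā_P × 𝒴`: a set is open if and only if its inverse images in all the `Ā_P × 𝒴` are open. -/
instance : TopologicalSpace (BorelSerre V) :=
  ⨆ P : Parabolic V, TopologicalSpace.coinduced P.corner inferInstance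

/-- The relation `(P', Z') = g (P, Z)` for some `g ∈ P_u(ℝ)`; this means `P' = P` and
`Z' = g Z g⁻¹`. -/
def BorelSerre.Rel (x y : BorelSerre V) : Prop :=
  y.P = x.P ∧ ∃ g, x.P.IsUnipotentRadical g ∧ y.Z = MaxCompact.conj g '' x.Z

variable (V) in
/-- The reductive Borel–Serre space of `PGL_V`, with the quotient topology. -/
def ReductiveBorelSerre : Type _ := Quot (BorelSerre.Rel (V := V))

instance : TopologicalSpace (ReductiveBorelSerre V) :=
  inferInstanceAs (TopologicalSpace (Quot (BorelSerre.Rel (V := V))))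

/-- The projection from the Borel–Serre space to the reductive one. -/
def BorelSerre.toReductive (x : BorelSerre V) : ReductiveBorelSerre V := Quot.mk _ x

/-! ### The canonical map -/

/-- `K` is the isotropy group in `PGL_V(ℝ)` of the class of the norm `ν` on `V_v`. -/
def IsIsotropy (K : MaxCompact V) (ν : NormOn (VR V)) : Prop :=
  ∀ h : GLR V, toPGL h ∈ K.1 ↔ ∃ c : ℝ, 0 < c ∧ ∀ x, ν.1 ((h⁻¹).1 x) = c * ν.1 x

/-- For a point `(P, μ, s)` of `X̄^♯_{ℚ,v}`, the set of isotropy groups of the classes of the norms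
`x ↦ (∑_i μ̃_i (s⁻¹(x)_i) ^ 2) ^ (1/2)` on `V_v`, for all families of norms `μ̃_i` on the
`(V_i / V_{i-1})_v` with class `μ_i`. -/
def XSharp.isotropySet (x : XSharp V) : Set (MaxCompact V) :=
  {K | ∃ (m : ∀ W : x.P.Index, NormOn (x.P.gr W)) (ν : NormOn (VR V)),
    (∀ W, (m W).cls = x.μ W) ∧
    (∀ y : ∀ W : x.P.Index, x.P.gr W, ν.1 (x.s.total y) = √(∑ W, (m W).1 (y W) ^ 2)) ∧
    IsIsotropy K ν}

end BSpace

end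

/-! Everything is translated into Euclidean norms on `VR V`. Sending a norm to the isotropy group of
its class identifies classes of norms with maximal compact subgroups (`exists_maxK`, `maxK_eq_iff`):
averaging over a compact subgroup by Haar measure shows that it fixes some class, and reflections
show that the isotropy group determines the class. The Cartan involution of such a group is forced
to be the inverse transpose in an orthonormal basis (`IsCartanInvolution.eq_cartan`). Hence, when
the orthonormal basis is compatible with the flag of P, the geodesic lift of (a_i) is the diagonal
matrix with entries a_i, and A_P acts by rescaling the basis block by block
(`Compatible.geodesicAct`).

Consequently the independent rescalings of the norms on the graded pieces sweep out exactly one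
A_P-orbit (`XSharp.Rep.isotropySet_eq`), and the map is well defined. It is injective because P and
a single norm recover the triple: the splitting identifies gr_i with the orthogonal complement of
(V_{i-1})_v in (V_i)_v, and μ_i is the class of the restriction to it (`XSharp.Rep.eq`). It is
surjective because P(ℝ) already acts transitively on maximal compact subgroups, by the Iwasawa
decomposition (`conj_iwasawa`).

For the topologies, the chart coordinates t_k with k = dim V_i are the corner coordinates τ, while g
and the other, positive, coordinates only move K continuously (`corner_eq`); this gives continuity.
Conversely Gram–Schmidt provides a continuous lift from Ā_P × GL_V(ℝ) to a chart
(`toBorelSerre_chartLift`), and Ā_P × GL_V(ℝ) → Ā_P × 𝒴 is an open quotient map, so the inverse is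
continuous.

Finally, two splittings of one filtration differ by an element of P_u(ℝ), so forgetting the
splitting is the same as dividing by P_u(ℝ) (`rel_toBorelSerre_iff`), and the homeomorphism
descends. -/

noncomputable section

namespace BSpace

set_option linter.unusedSectionVars false

/-! ### Norms as Euclidean norms of orthonormal bases -/

section BasisNorm

variable {W : Type*} [AddCommGroup W] [Module ℝ W] {ι : Type*} [Fintype ι]

/-- The Euclidean norm for which the basis `f` is orthonormal. -/
def basisNorm (f : Module.Basis ι ℝ W) : NormOn W :=
  ⟨fun x => √(∑ i, f.repr x i ^ 2), by
    simpa using IsNorm.of_basis f (fun _ => 1) fun _ => one_pos⟩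

theorem basisNorm_apply (f : Module.Basis ι ℝ W) (x : W) :
    (basisNorm f).1 x = √(∑ i, f.repr x i ^ 2) := rfl

theorem basisNorm_sq (f : Module.Basis ι ℝ W) (x : W) :
    (basisNorm f).1 x ^ 2 = ∑ i, f.repr x i ^ 2 := by
  rw [basisNorm_apply, Real.sq_sqrt (Finset.sum_nonneg fun i _ => sq_nonneg _)]

theorem NormOn.ext {μ ν : NormOn W} (h : ∀ x, μ.1 x = ν.1 x) : μ = ν :=
  Subtype.ext (funext h)

/-- The rescaling of a basis by nonzero factors. -/
def scaleBasis (f : Module.Basis ι ℝ W) (r : ι → ℝ) (hr : ∀ i, r i ≠ 0) : Module.Basis ι ℝ W :=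
  f.isUnitSMul fun i => (hr i).isUnit

theorem scaleBasis_apply (f : Module.Basis ι ℝ W) (r : ι → ℝ) (hr : ∀ i, r i ≠ 0) (i : ι) :
    scaleBasis f r hr i = r i • f i := by
  simp [scaleBasis, Module.Basis.isUnitSMul_apply]

theorem scaleBasis_repr (f : Module.Basis ι ℝ W) (r : ι → ℝ) (hr : ∀ i, r i ≠ 0) (x : W) (i : ι) :
    (scaleBasis f r hr).repr x i = (r i)⁻¹ * f.repr x i := by
  classical
  have h : x = ∑ j, ((r j)⁻¹ * f.repr x j) • scaleBasis f r hr j := by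
    conv_lhs => rw [← f.sum_repr x]
    refine Finset.sum_congr rfl fun j _ => ?_
    rw [scaleBasis_apply, smul_smul]
    congr 1
    field_simp [hr j]
  conv_lhs => rw [h]
  rw [Module.Basis.repr_sum_self]

/-- The vectors r_i⁻¹ e_i are orthonormal, so the coefficients can be absorbed into the basis. -/
theorem NormOn.exists_basis (μ : NormOn W) :
    ∃ f : Module.Basis (Fin (Module.finrank ℝ W)) ℝ W, μ = basisNorm f := by
  obtain ⟨e, r, hr, h⟩ := μ.2
  refine ⟨scaleBasis e (fun i => (r i)⁻¹) fun i => (inv_pos.2 (hr i)).ne', NormOn.ext fun x => ?_⟩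
  rw [h, basisNorm_apply]
  congr 1
  refine Finset.sum_congr rfl fun i _ => ?_
  rw [scaleBasis_repr, inv_inv, mul_pow, sq_abs]

theorem NormOn.nonneg (μ : NormOn W) (x : W) : 0 ≤ μ.1 x := by
  obtain ⟨f, rfl⟩ := μ.exists_basis
  exact Real.sqrt_nonneg _

theorem NormOn.eq_zero {μ : NormOn W} {x : W} (h : μ.1 x = 0) : x = 0 := by
  obtain ⟨f, rfl⟩ := μ.exists_basis
  have h2 := basisNorm_sq f x
  rw [h, zero_pow two_ne_zero] at h2
  have := (Finset.sum_eq_zero_iff_of_nonneg fun i _ => sq_nonneg (f.repr x i)).1 h2.symm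
  refine f.repr.map_eq_zero_iff.1 (Finsupp.ext fun i => ?_)
  exact pow_eq_zero_iff two_ne_zero |>.1 (this i (Finset.mem_univ i))

theorem NormOn.pos (μ : NormOn W) {x : W} (h : x ≠ 0) : 0 < μ.1 x :=
  lt_of_le_of_ne (μ.nonneg x) fun h' => h (NormOn.eq_zero h'.symm)

theorem NormOn.smul (μ : NormOn W) (a : ℝ) (x : W) : μ.1 (a • x) = |a| * μ.1 x := by
  obtain ⟨f, rfl⟩ := μ.exists_basis
  rw [basisNorm_apply, basisNorm_apply, ← Real.sqrt_sq_eq_abs, ← Real.sqrt_mul (sq_nonneg a),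
    Finset.mul_sum]
  simp [mul_pow]

theorem NormOn.zero (μ : NormOn W) : μ.1 0 = 0 := by
  simpa using μ.smul 0 0

/-- A positive multiple of a norm. -/
def NormOn.scale (μ : NormOn W) (c : ℝ) (hc : 0 < c) : NormOn W :=
  ⟨fun x => c * μ.1 x, by
    obtain ⟨e, r, hr, h⟩ := μ.2
    refine ⟨e, fun i => c * r i, fun i => mul_pos hc (hr i), fun x => ?_⟩
    change c * μ.1 x = _
    rw [h]
    conv_lhs => rw [← Real.sqrt_sq hc.le, ← Real.sqrt_mul (sq_nonneg c), Finset.mul_sum]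
    simp only [mul_pow, mul_assoc]⟩

/-- The norm `μ ∘ g⁻¹`. -/
def NormOn.push (μ : NormOn W) (g : W ≃ₗ[ℝ] W) : NormOn W :=
  ⟨fun x => μ.1 (g.symm x), μ.2.comp_equiv g.symm⟩

theorem NormOn.cls_eq_iff {μ ν : NormOn W} :
    μ.cls = ν.cls ↔ ∃ c : ℝ, 0 < c ∧ ∀ x, ν.1 x = c * μ.1 x :=
  Quotient.eq (r := normSetoid W)

theorem NormClass.exists_rep (μ : NormClass W) : ∃ ν : NormOn W, ν.cls = μ :=
  Quotient.exists_rep μ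

theorem NormClass.act_refl (μ : NormClass W) :
    NormClass.act (LinearEquiv.refl ℝ W) μ = μ := by
  obtain ⟨ν, rfl⟩ := μ.exists_rep
  rfl

theorem basisNorm_map (f : Module.Basis ι ℝ W) (g : W ≃ₗ[ℝ] W) :
    basisNorm (f.map g) = (basisNorm f).push g :=
  NormOn.ext fun x => by simp [basisNorm_apply, NormOn.push]

theorem basisNorm_reindex {κ : Type*} [Fintype κ] (f : Module.Basis ι ℝ W) (e : ι ≃ κ) :
    basisNorm (f.reindex e) = basisNorm f :=
  NormOn.ext fun x => by
    rw [basisNorm_apply, basisNorm_apply]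
    refine congrArg Real.sqrt (Fintype.sum_equiv e.symm _ _ fun i => ?_)
    simp

/-- A norm which is invariant up to scalars under the isometries of a Euclidean norm is
proportional to it. -/
theorem NormOn.eq_mul_of_invariant {ν μ : NormOn W}
    (h : ∀ g : W ≃ₗ[ℝ] W, (∀ x, ν.1 (g x) = ν.1 x) → ∃ c : ℝ, 0 < c ∧ ∀ x, μ.1 (g x) = c * μ.1 x) :
    ∃ c : ℝ, 0 < c ∧ ∀ x, μ.1 x = c * ν.1 x := by
  obtain ⟨f, rfl⟩ := ν.exists_basis
  let φ : W ≃ₗ[ℝ] EuclideanSpace ℝ (Fin (Module.finrank ℝ W)) :=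
    f.equivFun.trans (WithLp.linearEquiv 2 ℝ _).symm
  have hφ : ∀ x, (basisNorm f).1 x = ‖φ x‖ := fun x => by
    rw [basisNorm_apply, EuclideanSpace.norm_eq]
    simp [φ]
  have key : ∀ x y, (basisNorm f).1 x = (basisNorm f).1 y → μ.1 x = μ.1 y := by
    intro x y hxy
    -- Vectors of equal Euclidean length are exchanged by a reflection. As it is an involution, its
    -- scaling factor for μ satisfies c² = 1, hence c = 1, and μ is constant on the spheres of the
    -- Euclidean norm.
    let R := (ℝ ∙ (φ x - φ y))ᗮ.reflection
    let g : W ≃ₗ[ℝ] W := (φ.trans R.toLinearEquiv).trans φ.symm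
    have hg : ∀ z, φ (g z) = R (φ z) := fun z => by simp [g]
    obtain ⟨c, hc, hcx⟩ := h g fun z => by
      rw [hφ, hφ, hg, LinearIsometryEquiv.norm_map]
    have hgg : ∀ z, g (g z) = z := fun z => φ.injective (by
      rw [hg, hg]
      exact Submodule.reflection_reflection _ _)
    have hgx : g x = y := φ.injective (by
      rw [hg]
      exact Submodule.reflection_sub (by rw [← hφ, ← hφ, hxy]))
    by_cases hx : x = 0
    · subst hx
      have : y = 0 := by rw [← hgx, map_zero]
      rw [this]
    have h1 : μ.1 x = c * (c * μ.1 x) := by rw [← hcx, ← hcx, hgg]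
    have h2 : c * c = 1 := by
      have := μ.pos hx
      have h3 : (c * c - 1) * μ.1 x = 0 := by linarith
      rcases mul_eq_zero.1 h3 with h4 | h4
      · linarith
      · exact absurd h4 this.ne'
    have h5 : c = 1 := by nlinarith
    rw [← hgx, hcx, h5, one_mul]
  by_cases hW : ∃ x : W, x ≠ 0
  · obtain ⟨x, hx⟩ := hW
    have hνx := (basisNorm f).pos hx
    -- The ratio at one nonzero x works everywhere: y is compared with the multiple of x on the same
    -- sphere.
    refine ⟨μ.1 x / (basisNorm f).1 x, div_pos (μ.pos hx) hνx, fun y => ?_⟩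
    have := key y (((basisNorm f).1 y / (basisNorm f).1 x) • x) (by
      rw [NormOn.smul, abs_of_nonneg (div_nonneg (NormOn.nonneg _ _) hνx.le)]
      field_simp)
    rw [this, NormOn.smul, abs_of_nonneg (div_nonneg (NormOn.nonneg _ _) hνx.le)]
    ring
  · push Not at hW
    exact ⟨1, one_pos, fun x => by rw [hW x, NormOn.zero, NormOn.zero, mul_zero]⟩

end BasisNorm

variable {V : Type*} [AddCommGroup V] [Module ℚ V] [FiniteDimensional ℚ V]

/-! ### Matrices, scalars, and isotropy groups of classes of norms -/

section Matrices

variable {ι : Type*} [Fintype ι] [DecidableEq ι]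

/-- The matrices, in a basis, of the elements of `GL_V(ℝ)`. -/
def matEquiv (f : Module.Basis ι ℝ (VR V)) : GLR V ≃* GL ι ℝ :=
  Units.mapEquiv (LinearMap.toMatrixAlgEquiv f).toMulEquiv

theorem matEquiv_val (f : Module.Basis ι ℝ (VR V)) (h : GLR V) :
    (matEquiv f h).1 = LinearMap.toMatrixAlgEquiv f h.1 := rfl

theorem matEquiv_apply (f : Module.Basis ι ℝ (VR V)) (h : GLR V) (i j : ι) :
    (matEquiv f h).1 i j = f.repr (h.1 (f j)) i := by
  rw [matEquiv_val, LinearMap.toMatrixAlgEquiv_apply]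

theorem repr_apply (f : Module.Basis ι ℝ (VR V)) (h : GLR V) (x : VR V) :
    ⇑(f.repr (h.1 x)) = (matEquiv f h).1.mulVec (f.repr x) := by
  rw [matEquiv_val]
  exact (LinearMap.toMatrix_mulVec_repr f f h.1 x).symm

end Matrices

theorem mem_center_iff_scalar {h : GLR V} :
    h ∈ Subgroup.center (GLR V) ↔ ∃ c : ℝ, h.1 = c • (1 : Module.End ℝ (VR V)) := by
  constructor
  · intro hh
    let f := Module.finBasis ℝ (VR V)
    have h1 : matEquiv f h ∈ Subgroup.center (GL _ ℝ) := by
      rw [Subgroup.mem_center_iff] at hh ⊢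
      intro g
      obtain ⟨g, rfl⟩ := (matEquiv f).surjective g
      rw [← map_mul, ← map_mul, hh]
    rw [Matrix.GeneralLinearGroup.mem_center_iff_val_mem_range_scalar] at h1
    obtain ⟨c, hc⟩ := h1
    refine ⟨c, (LinearMap.toMatrixAlgEquiv f).injective ?_⟩
    rw [map_smul, map_one, ← matEquiv_val, ← hc]
    simp [Matrix.smul_one_eq_diagonal]
  · rintro ⟨c, hc⟩
    rw [Subgroup.mem_center_iff]
    intro g
    ext1
    rw [Units.val_mul, Units.val_mul, hc]
    simp

theorem toPGL_eq_iff {h k : GLR V} : toPGL h = toPGL k ↔ ∃ c : ℝ, k.1 = c • h.1 := by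
  change (QuotientGroup.mk h : PGLR V) = QuotientGroup.mk k ↔ _
  rw [QuotientGroup.eq, mem_center_iff_scalar]
  refine exists_congr fun c => ⟨fun hc => ?_, fun hc => ?_⟩
  · calc k.1 = h.1 * (h⁻¹ * k).1 := by simp
      _ = _ := by rw [hc]; simp
  · rw [Units.val_mul, hc]
    simp

theorem toPGL_surjective : Function.Surjective (toPGL : GLR V → PGLR V) :=
  QuotientGroup.mk'_surjective _

/-- An element of `GL_V(ℝ)` as a linear automorphism. -/
def toEquiv (h : GLR V) : VR V ≃ₗ[ℝ] VR V := LinearMap.GeneralLinearGroup.toLinearEquiv h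

@[simp] theorem toEquiv_apply (h : GLR V) (x : VR V) : toEquiv h x = h.1 x := rfl

@[simp] theorem toEquiv_symm_apply (h : GLR V) (x : VR V) : (toEquiv h).symm x = (h⁻¹).1 x := rfl

/-- A linear automorphism as an element of `GL_V(ℝ)`. -/
def ofEquiv (g : VR V ≃ₗ[ℝ] VR V) : GLR V := LinearMap.GeneralLinearGroup.ofLinearEquiv g

@[simp] theorem ofEquiv_apply (g : VR V ≃ₗ[ℝ] VR V) (x : VR V) : (ofEquiv g).1 x = g x := rfl

@[simp] theorem ofEquiv_inv_apply (g : VR V ≃ₗ[ℝ] VR V) (x : VR V) :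
    ((ofEquiv g)⁻¹).1 x = g.symm x := rfl

/-- The isotropy group of the class of a norm. -/
def isotropySubgroup (ν : NormOn (VR V)) : Subgroup (PGLR V) :=
  Subgroup.map toPGL
    { carrier := {h : GLR V | ∃ c : ℝ, 0 < c ∧ ∀ x, ν.1 ((h⁻¹).1 x) = c * ν.1 x}
      one_mem' := ⟨1, one_pos, fun x => by simp⟩
      mul_mem' := by
        rintro g h ⟨c, hc, hg⟩ ⟨c', hc', hh⟩
        refine ⟨c' * c, mul_pos hc' hc, fun x => ?_⟩
        rw [mul_inv_rev, Units.val_mul, Module.End.mul_apply, hh, hg, mul_assoc]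
      inv_mem' := by
        rintro g ⟨c, hc, hg⟩
        refine ⟨c⁻¹, inv_pos.2 hc, fun x => ?_⟩
        have := hg (g.1 x)
        rw [← Module.End.mul_apply, Units.inv_mul, Module.End.one_apply] at this
        rw [inv_inv, this, ← mul_assoc, inv_mul_cancel₀ hc.ne', one_mul] }

/-- Being a similitude depends only on the image in PGL. The factor a can vanish only when the space
is zero, whence the case distinction. -/
theorem exists_scaling_of_smul {ν : NormOn (VR V)} {h k : GLR V} {a : ℝ}
    (hk : k.1 = a • h.1) (hh : ∃ c : ℝ, 0 < c ∧ ∀ x, ν.1 ((h⁻¹).1 x) = c * ν.1 x) :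
    ∃ c : ℝ, 0 < c ∧ ∀ x, ν.1 ((k⁻¹).1 x) = c * ν.1 x := by
  obtain ⟨c, hc, hh⟩ := hh
  by_cases hV : ∀ x : VR V, x = 0
  · exact ⟨1, one_pos, fun x => by rw [hV x, map_zero, NormOn.zero, mul_zero]⟩
  push Not at hV
  obtain ⟨x₀, hx₀⟩ := hV
  have ha : a ≠ 0 := by
    rintro rfl
    apply hx₀
    have : (k⁻¹).1 (k.1 x₀) = x₀ := by
      rw [← Module.End.mul_apply, Units.inv_mul, Module.End.one_apply]
    rw [← this, hk]
    simp
  refine ⟨|a⁻¹| * c, mul_pos (abs_pos.2 (inv_ne_zero ha)) hc, fun x => ?_⟩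
  have : (k⁻¹).1 x = a⁻¹ • (h⁻¹).1 x := by
    have h1 : k.1 (a⁻¹ • (h⁻¹).1 x) = x := by
      rw [hk, LinearMap.smul_apply, map_smul, smul_smul, mul_inv_cancel₀ ha, one_smul,
        ← Module.End.mul_apply, Units.mul_inv, Module.End.one_apply]
    conv_lhs => rw [← h1]
    rw [← Module.End.mul_apply, Units.inv_mul, Module.End.one_apply]
  rw [this, NormOn.smul, hh, mul_assoc]

theorem toPGL_mem_isotropySubgroup {ν : NormOn (VR V)} {h : GLR V} :
    toPGL h ∈ isotropySubgroup ν ↔ ∃ c : ℝ, 0 < c ∧ ∀ x, ν.1 ((h⁻¹).1 x) = c * ν.1 x := by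
  refine ⟨?_, fun hh => ⟨h, hh, rfl⟩⟩
  rintro ⟨k, hk, hkh⟩
  obtain ⟨a, ha⟩ := toPGL_eq_iff.1 hkh
  exact exists_scaling_of_smul ha hk

/-- The isotropy group of the class of a norm determines the class. -/
theorem isotropySubgroup_le_iff {ν μ : NormOn (VR V)} :
    isotropySubgroup ν ≤ isotropySubgroup μ ↔ ∃ c : ℝ, 0 < c ∧ ∀ x, μ.1 x = c * ν.1 x := by
  constructor
  · intro h
    refine NormOn.eq_mul_of_invariant fun g hg => ?_
    -- The isotropy condition involves h⁻¹, so the isometry g is tested through its inverse.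
    have h1 : toPGL (ofEquiv g.symm) ∈ isotropySubgroup μ :=
      h (toPGL_mem_isotropySubgroup.2 ⟨1, one_pos, fun x => by simpa using hg x⟩)
    exact toPGL_mem_isotropySubgroup.1 h1
  · rintro ⟨c, hc, h⟩ x hx
    obtain ⟨k, rfl⟩ := toPGL_surjective x
    rw [toPGL_mem_isotropySubgroup] at hx ⊢
    obtain ⟨a, ha, hk⟩ := hx
    exact ⟨a, ha, fun x => by rw [h, h, hk]; ring⟩

theorem isotropySubgroup_push (ν : NormOn (VR V)) (h : GLR V) :
    isotropySubgroup (ν.push (toEquiv h)) =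
      (isotropySubgroup ν).map (MulAut.conj (toPGL h)).toMonoidHom := by
  ext x
  obtain ⟨k, rfl⟩ := toPGL_surjective x
  have h2 : toPGL k ∈ (isotropySubgroup ν).map (MulAut.conj (toPGL h)).toMonoidHom ↔
      toPGL (h⁻¹ * k * h) ∈ isotropySubgroup ν := by
    constructor
    · rintro ⟨y, hy, hyk⟩
      have : y = toPGL (h⁻¹ * k * h) := by
        rw [map_mul, map_mul, map_inv, ← hyk]
        simp [mul_assoc]
      rwa [← this]
    · intro hk
      exact ⟨_, hk, by simp [mul_assoc]⟩
  rw [h2, toPGL_mem_isotropySubgroup, toPGL_mem_isotropySubgroup]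
  refine exists_congr fun c => and_congr_right fun _ => ⟨fun H x => ?_, fun H x => ?_⟩
  · have := H (h.1 x)
    simp only [NormOn.push, toEquiv_symm_apply] at this
    rw [← Module.End.mul_apply, ← Module.End.mul_apply, ← Module.End.mul_apply, Units.inv_mul,
      Module.End.one_apply, ← Units.val_mul, ← Units.val_mul] at this
    have h3 : (h⁻¹ * k * h)⁻¹ = h⁻¹ * k⁻¹ * h := by group
    rw [← this, h3]
  · have := H ((h⁻¹).1 x)
    simp only [NormOn.push, toEquiv_symm_apply]
    have h3 : (h⁻¹ * k * h)⁻¹ * h⁻¹ = h⁻¹ * k⁻¹ := by group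
    rw [← this, ← Module.End.mul_apply, ← Module.End.mul_apply, ← Units.val_mul, ← Units.val_mul, h3]

/-! ### Topology of the groups and compactness of isotropy groups -/

section Continuity

variable {ι : Type*} [Fintype ι] [DecidableEq ι]

theorem continuous_toMatrix (f : Module.Basis ι ℝ (VR V)) :
    Continuous (LinearMap.toMatrixAlgEquiv f) :=
  IsModuleTopology.continuous_of_linearMap (LinearMap.toMatrixAlgEquiv f).toLinearMap

theorem continuous_toMatrix_symm (f : Module.Basis ι ℝ (VR V)) :
    Continuous (LinearMap.toMatrixAlgEquiv f).symm :=
  LinearMap.continuous_of_finiteDimensional (LinearMap.toMatrixAlgEquiv f).symm.toLinearMap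

theorem continuous_matEquiv (f : Module.Basis ι ℝ (VR V)) : Continuous (matEquiv f) :=
  Continuous.units_map (LinearMap.toMatrixAlgEquiv f).toMulEquiv.toMonoidHom (continuous_toMatrix f)

theorem continuous_matEquiv_symm (f : Module.Basis ι ℝ (VR V)) : Continuous (matEquiv f).symm :=
  Continuous.units_map (LinearMap.toMatrixAlgEquiv f).symm.toMulEquiv.toMonoidHom
    (continuous_toMatrix_symm f)

theorem isOpenQuotientMap_toPGL : IsOpenQuotientMap (toPGL : GLR V → PGLR V) :=
  QuotientGroup.isOpenQuotientMap_mk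

theorem continuous_toPGL : Continuous (toPGL : GLR V → PGLR V) :=
  isOpenQuotientMap_toPGL.continuous

theorem continuous_repr_apply (f : Module.Basis ι ℝ (VR V)) (x : VR V) (i : ι) :
    Continuous fun h : Module.End ℝ (VR V) => f.repr (h x) i :=
  IsModuleTopology.continuous_of_linearMap
    ((f.coord i).comp (LinearMap.applyₗ x) : Module.End ℝ (VR V) →ₗ[ℝ] ℝ)

theorem continuous_det : Continuous fun h : GLR V => LinearMap.det h.1 := by
  have : (fun h : GLR V => LinearMap.det h.1) = fun h =>
      (LinearMap.toMatrixAlgEquiv (Module.finBasis ℝ (VR V)) h.1).det := by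
    funext h
    exact (LinearMap.det_toMatrix (Module.finBasis ℝ (VR V)) h.1).symm
  rw [this]
  exact ((continuous_toMatrix _).comp Units.continuous_val).matrix_det

theorem isCompact_orthogonalGroup :
    IsCompact (Matrix.orthogonalGroup ι ℝ : Set (Matrix ι ι ℝ)) := by
  have hc : IsCompact {A : Matrix ι ι ℝ | ∀ i j, A i j ∈ Set.Icc (-1 : ℝ) 1} := by
    have : {A : Matrix ι ι ℝ | ∀ i j, A i j ∈ Set.Icc (-1 : ℝ) 1} =
        Set.univ.pi fun _ => Set.univ.pi fun _ => Set.Icc (-1 : ℝ) 1 := by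
      ext A
      exact ⟨fun h i _ j _ => h i j, fun h i j => h i trivial j trivial⟩
    rw [this]
    exact isCompact_univ_pi fun _ => isCompact_univ_pi fun _ => isCompact_Icc
  refine hc.of_isClosed_subset ?_ fun A hA i j => ?_
  · have : (Matrix.orthogonalGroup ι ℝ : Set (Matrix ι ι ℝ)) = {A | A * A.transpose = 1} := by
      ext A
      exact Matrix.mem_orthogonalGroup_iff ι ℝ
    rw [this]
    exact isClosed_eq (continuous_id.mul continuous_id.matrix_transpose) continuous_const
  · have := entry_norm_bound_of_unitary hA i j
    rwa [Real.norm_eq_abs, abs_le] at this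

end Continuity

/-- Polarization: AᵀA is symmetric and has the quadratic form of the identity. -/
theorem orthogonal_of_isometry {ι : Type*} [Fintype ι] [DecidableEq ι] {A : Matrix ι ι ℝ}
    (h : ∀ v : ι → ℝ, ∑ i, A.mulVec v i ^ 2 = ∑ i, v i ^ 2) : A.transpose * A = 1 := by
  have hs : ∀ v : ι → ℝ, dotProduct v ((A.transpose * A).mulVec v) = dotProduct v v := by
    intro v
    have := h v
    rw [← Matrix.mulVec_mulVec, Matrix.dotProduct_mulVec, Matrix.vecMul_transpose]
    simpa [dotProduct, sq] using this
  have hb : ∀ v w : ι → ℝ, dotProduct v ((A.transpose * A).mulVec w) = dotProduct v w := by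
    intro v w
    have h1 := hs (v + w)
    have h2 : dotProduct w ((A.transpose * A).mulVec v) =
        dotProduct v ((A.transpose * A).mulVec w) := by
      rw [← Matrix.mulVec_mulVec, ← Matrix.mulVec_mulVec, Matrix.dotProduct_mulVec w,
        Matrix.dotProduct_mulVec v, Matrix.vecMul_transpose, Matrix.vecMul_transpose,
        dotProduct_comm]
    have h3 := dotProduct_comm w v
    rw [Matrix.mulVec_add, add_dotProduct, dotProduct_add, dotProduct_add, add_dotProduct,
      dotProduct_add, dotProduct_add, hs v, hs w] at h1
    linarith
  ext i j
  have := hb (Pi.single i 1) (Pi.single j 1)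
  simpa [Matrix.one_apply, Pi.single_apply, eq_comm] using this

/-- A similitude is a scalar times an isometry, so in PGL the isotropy group is the continuous image
of the compact orthogonal group. -/
theorem isCompact_isotropySubgroup (ν : NormOn (VR V)) :
    IsCompact (isotropySubgroup ν : Set (PGLR V)) := by
  obtain ⟨f, rfl⟩ := ν.exists_basis
  let S := Matrix.orthogonalGroup (Fin (Module.finrank ℝ (VR V))) ℝ
  have : CompactSpace S := isCompact_iff_compactSpace.1 isCompact_orthogonalGroup
  let φ : S → PGLR V := fun A => toPGL ((matEquiv f).symm (Unitary.toUnits A))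
  have hφ : Continuous φ := by
    refine continuous_toPGL.comp ((continuous_matEquiv_symm f).comp ?_)
    refine Units.continuous_iff.2 ⟨continuous_subtype_val, ?_⟩
    exact continuous_subtype_val.matrix_transpose
  have : (isotropySubgroup (basisNorm f) : Set (PGLR V)) = Set.range φ := by
    ext x
    constructor
    · intro hx
      obtain ⟨h, rfl⟩ := toPGL_surjective x
      obtain ⟨c, hc, hh⟩ := toPGL_mem_isotropySubgroup.1 hx
      have h1 : ∀ x, (basisNorm f).1 ((c⁻¹ • (h⁻¹).1) x) = (basisNorm f).1 x := by
        intro x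
        rw [LinearMap.smul_apply, NormOn.smul, hh, abs_of_pos (inv_pos.2 hc), ← mul_assoc,
          inv_mul_cancel₀ hc.ne', one_mul]
      -- Dividing h⁻¹ by its factor gives an orthogonal A, so Aᵀ = A⁻¹ is a scalar multiple of the
      -- matrix of h.
      set A : Matrix _ _ ℝ := LinearMap.toMatrixAlgEquiv f (c⁻¹ • (h⁻¹).1) with hA
      have h2 : A.transpose * A = 1 := by
        refine orthogonal_of_isometry fun v => ?_
        have h3 := congrArg (· ^ 2) (h1 (f.equivFun.symm v))
        simp only [basisNorm_sq] at h3
        have h4 : ⇑(f.repr (f.equivFun.symm v)) = v := f.equivFun.apply_symm_apply v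
        have h5 : ⇑(f.repr ((c⁻¹ • (h⁻¹).1) (f.equivFun.symm v))) = A.mulVec v := by
          conv_rhs => rw [← h4]
          exact (LinearMap.toMatrix_mulVec_repr f f (c⁻¹ • (h⁻¹).1) (f.equivFun.symm v)).symm
        rw [h4, h5] at h3
        exact h3
      have h6 : A.transpose ∈ S := (Matrix.mem_orthogonalGroup_iff _ ℝ).2 (by
        rw [Matrix.transpose_transpose]
        exact h2)
      refine ⟨⟨A.transpose, h6⟩, ?_⟩
      refine toPGL_eq_iff.2 ⟨c⁻¹, (LinearMap.toMatrixAlgEquiv f).injective ?_⟩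
      have h7 : A * LinearMap.toMatrixAlgEquiv f h.1 = c⁻¹ • 1 := by
        rw [hA, ← map_mul, smul_mul_assoc, Units.inv_mul, map_smul, map_one]
      have h8 : LinearMap.toMatrixAlgEquiv f
          ((matEquiv f).symm (Unitary.toUnits (⟨A.transpose, h6⟩ : S))).1 = A.transpose :=
        (LinearMap.toMatrixAlgEquiv f).apply_symm_apply _
      rw [map_smul, h8, ← Matrix.one_mul (LinearMap.toMatrixAlgEquiv f h.1), ← h2, Matrix.mul_assoc,
        h7]
      simp
    · rintro ⟨A, rfl⟩
      refine toPGL_mem_isotropySubgroup.2 ⟨1, one_pos, fun x => ?_⟩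
      have h1 : (matEquiv f ((matEquiv f).symm (Unitary.toUnits A))⁻¹).1 = A.1.transpose := by
        rw [← map_inv, MulEquiv.apply_symm_apply]
        rfl
      have h2 : A.1 * A.1.transpose = 1 := (Matrix.mem_orthogonalGroup_iff _ ℝ).1 A.2
      have h3 : ∀ v : Fin (Module.finrank ℝ (VR V)) → ℝ, dotProduct (A.1.transpose.mulVec v)
          (A.1.transpose.mulVec v) = dotProduct v v := fun v => by
        rw [Matrix.dotProduct_mulVec, Matrix.vecMul_transpose, Matrix.mulVec_mulVec, h2,
          Matrix.one_mulVec]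
      have h4 := h3 (f.repr x)
      rw [one_mul, basisNorm_apply, basisNorm_apply, repr_apply, h1]
      simp only [dotProduct, ← sq] at h4
      rw [h4]
  rw [this]
  exact isCompact_range hφ

/-- An orthogonal basis diagonalizes the form, and the square roots of the diagonal values serve as
the r_i. -/
theorem isNorm_of_posDef {B : LinearMap.BilinForm ℝ (VR V)} (hB : LinearMap.IsSymm B)
    (hpos : ∀ x, x ≠ 0 → 0 < B x x) : IsNorm fun x => √(B x x) := by
  have : Invertible (2 : ℝ) := invertibleOfNonzero two_ne_zero
  obtain ⟨v, hv⟩ := LinearMap.BilinForm.exists_orthogonal_basis hB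
  refine ⟨v, fun i => √(B (v i) (v i)), fun i => Real.sqrt_pos.2 (hpos _ (v.ne_zero i)),
    fun x => congrArg Real.sqrt ?_⟩
  conv_lhs => rw [← v.sum_repr x]
  rw [map_sum B, LinearMap.sum_apply]
  refine Finset.sum_congr rfl fun i _ => ?_
  rw [map_sum, Finset.sum_eq_single i]
  · rw [map_smul, map_smul, LinearMap.smul_apply, smul_eq_mul, smul_eq_mul, sq_abs,
      Real.sq_sqrt (hpos _ (v.ne_zero i)).le]
    ring
  · intro j _ hj
    have : B (v i) (v j) = 0 := hv hj.symm
    rw [map_smul, map_smul, LinearMap.smul_apply, this]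
    simp
  · simp

/-! ### Haar averaging: maximal compact subgroups are isotropy groups of norms -/

section Averaging

variable [Nontrivial V]

/-- The function `g ↦ |det g| ^ (2 / d) ⟨g⁻¹ x, g⁻¹ y⟩` on `GL_V(ℝ)`, which is invariant under
scalars. -/
def twistedForm (f : Module.Basis (Fin (Module.finrank ℝ (VR V))) ℝ (VR V)) (x y : VR V)
    (h : GLR V) : ℝ :=
  |LinearMap.det h.1| ^ (2 / (Module.finrank ℝ (VR V) : ℝ)) *
    ∑ i, f.repr ((h⁻¹).1 x) i * f.repr ((h⁻¹).1 y) i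

variable (f : Module.Basis (Fin (Module.finrank ℝ (VR V))) ℝ (VR V))

theorem continuous_twistedForm (x y : VR V) : Continuous (twistedForm f x y) := by
  refine Continuous.mul ?_ ?_
  · refine (continuous_det.abs).rpow_const fun h => Or.inl ?_
    exact abs_ne_zero.2 (LinearEquiv.isUnit_det' (toEquiv h)).ne_zero
  · refine continuous_finsetSum _ fun i _ => Continuous.mul ?_ ?_
    · exact (continuous_repr_apply f x i).comp (Units.continuous_val.comp continuous_inv)
    · exact (continuous_repr_apply f y i).comp (Units.continuous_val.comp continuous_inv)

theorem det_ne_zero (h : GLR V) : LinearMap.det h.1 ≠ 0 :=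
  (LinearEquiv.isUnit_det' (toEquiv h)).ne_zero

/-- This equivariance turns left invariance of Haar measure into the statement that the averaged
form is only rescaled by the group. -/
theorem twistedForm_mul (g h : GLR V) (x y : VR V) :
    twistedForm f (g.1 x) (g.1 y) h =
      |LinearMap.det g.1| ^ (2 / (Module.finrank ℝ (VR V) : ℝ)) * twistedForm f x y (g⁻¹ * h) := by
  have h1 : ∀ z, ((g⁻¹ * h)⁻¹).1 z = (h⁻¹).1 (g.1 z) := fun z => by
    rw [mul_inv_rev, inv_inv, Units.val_mul, Module.End.mul_apply]
  rw [twistedForm, twistedForm, h1, h1, ← mul_assoc, ← Real.mul_rpow (abs_nonneg _) (abs_nonneg _),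
    ← abs_mul, ← map_mul, ← Units.val_mul, mul_inv_cancel_left]

/-- Replacing h by c h multiplies the determinant by c^d, hence the first factor by c², which
cancels the c⁻² coming from the inner product. This is the purpose of the exponent 2 / d. -/
theorem twistedForm_congr {h k : GLR V} (hk : toPGL h = toPGL k) (x y : VR V) :
    twistedForm f x y h = twistedForm f x y k := by
  obtain ⟨c, hc⟩ := toPGL_eq_iff.1 hk
  have hd : (Module.finrank ℝ (VR V) : ℝ) ≠ 0 := by
    have : 0 < Module.finrank ℝ (VR V) := by
      rw [Module.finrank_baseChange]
      exact Module.finrank_pos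
    exact_mod_cast this.ne'
  have hc0 : c ≠ 0 := by
    rintro rfl
    apply det_ne_zero k
    rw [hc, LinearMap.det_smul, zero_pow (by exact_mod_cast hd), zero_mul]
  have h1 : ∀ z, (h⁻¹).1 z = c • (k⁻¹).1 z := fun z => by
    have h2 : k.1 ((k⁻¹).1 z) = z := by
      rw [← Module.End.mul_apply, Units.mul_inv, Module.End.one_apply]
    conv_lhs => rw [← h2, hc, LinearMap.smul_apply, map_smul]
    rw [← Module.End.mul_apply, Units.inv_mul, Module.End.one_apply]
  have h3 : |LinearMap.det k.1| ^ (2 / (Module.finrank ℝ (VR V) : ℝ)) =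
      c ^ 2 * |LinearMap.det h.1| ^ (2 / (Module.finrank ℝ (VR V) : ℝ)) := by
    rw [hc, LinearMap.det_smul, abs_mul, Real.mul_rpow (abs_nonneg _) (abs_nonneg _), abs_pow,
      ← Real.rpow_natCast, ← Real.rpow_mul (abs_nonneg _), mul_div_cancel₀ _ hd]
    norm_num
  rw [twistedForm, twistedForm, h3, mul_assoc, mul_left_comm, Finset.mul_sum _ _ (c ^ 2)]
  congr 1
  refine Finset.sum_congr rfl fun i _ => ?_
  rw [h1 x, h1 y, map_smul, map_smul, Finsupp.smul_apply, Finsupp.smul_apply, smul_eq_mul, smul_eq_mul]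
  ring

/-- The function on `PGL_V(ℝ)` induced by `twistedForm`. -/
def twistedFormPGL (x y : VR V) (g : PGLR V) : ℝ :=
  twistedForm f x y (Function.surjInv toPGL_surjective g)

theorem twistedFormPGL_toPGL (x y : VR V) (h : GLR V) :
    twistedFormPGL f x y (toPGL h) = twistedForm f x y h :=
  twistedForm_congr f (Function.surjInv_eq toPGL_surjective _) x y

theorem continuous_twistedFormPGL (x y : VR V) : Continuous (twistedFormPGL f x y) := by
  refine isOpenQuotientMap_toPGL.isQuotientMap.continuous_iff.2 ?_
  have : twistedFormPGL f x y ∘ toPGL = twistedForm f x y :=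
    funext fun h => twistedFormPGL_toPGL f x y h
  rw [this]
  exact continuous_twistedForm f x y

theorem twistedFormPGL_comm (x y : VR V) (g : PGLR V) :
    twistedFormPGL f x y g = twistedFormPGL f y x g := by
  rw [twistedFormPGL, twistedFormPGL, twistedForm, twistedForm]
  congr 1
  exact Finset.sum_congr rfl fun i _ => mul_comm _ _

theorem twistedFormPGL_add (x x' y : VR V) (g : PGLR V) :
    twistedFormPGL f (x + x') y g = twistedFormPGL f x y g + twistedFormPGL f x' y g := by
  simp only [twistedFormPGL, twistedForm, map_add, Finsupp.add_apply, add_mul,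
    Finset.sum_add_distrib, mul_add]

theorem twistedFormPGL_smul (c : ℝ) (x y : VR V) (g : PGLR V) :
    twistedFormPGL f (c • x) y g = c * twistedFormPGL f x y g := by
  rw [twistedFormPGL, twistedFormPGL, twistedForm, twistedForm, mul_left_comm, Finset.mul_sum _ _ c]
  congr 1
  refine Finset.sum_congr rfl fun i _ => ?_
  rw [map_smul, map_smul, Finsupp.smul_apply, smul_eq_mul, mul_assoc]

theorem twistedFormPGL_pos {x : VR V} (hx : x ≠ 0) (g : PGLR V) : 0 < twistedFormPGL f x x g := by
  obtain ⟨h, rfl⟩ := toPGL_surjective g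
  rw [twistedFormPGL_toPGL, twistedForm]
  refine mul_pos (Real.rpow_pos_of_pos (abs_pos.2 (det_ne_zero h)) _) ?_
  have h1 : (h⁻¹).1 x ≠ 0 := fun h0 => hx ((toEquiv h).symm.map_eq_zero_iff.1 h0)
  have h2 := pow_pos ((basisNorm f).pos h1) 2
  rw [basisNorm_sq] at h2
  simpa [sq] using h2

/-- The usual averaging of an inner product, with the determinant twist making the integrand a
function on PGL. The average is positive definite and is multiplied by a power of |det| under K, so
the class of its norm is fixed. -/
theorem exists_le_isotropySubgroup {K : Subgroup (PGLR V)} (hK : IsCompact (K : Set (PGLR V))) :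
    ∃ ν : NormOn (VR V), K ≤ isotropySubgroup ν := by
  have : CompactSpace K := isCompact_iff_compactSpace.1 hK
  let _ : MeasurableSpace K := borel K
  have : BorelSpace K := ⟨rfl⟩
  let μ : MeasureTheory.Measure K := MeasureTheory.Measure.haar
  let f := Module.finBasis ℝ (VR V)
  have hcont : ∀ x y, Continuous fun g : K => twistedFormPGL f x y g.1 := fun x y =>
    (continuous_twistedFormPGL f x y).comp continuous_subtype_val
  have hint : ∀ x y, MeasureTheory.Integrable (fun g : K => twistedFormPGL f x y g.1) μ :=
    fun x y => (hcont x y).integrable_of_hasCompactSupport (HasCompactSupport.of_compactSpace _)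
  have hsymm := twistedFormPGL_comm f
  have hadd := twistedFormPGL_add f
  have hsmul := twistedFormPGL_smul f
  let B : LinearMap.BilinForm ℝ (VR V) := LinearMap.mk₂ ℝ
    (fun x y => ∫ g : K, twistedFormPGL f x y g.1 ∂μ)
    (fun x x' y => by
      rw [← MeasureTheory.integral_add (hint _ _) (hint _ _)]
      simp only [hadd])
    (fun c x y => by
      rw [smul_eq_mul, ← MeasureTheory.integral_const_mul]
      simp only [hsmul])
    (fun x y y' => by
      rw [← MeasureTheory.integral_add (hint _ _) (hint _ _)]
      simp only [hsymm x, hadd])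
    (fun c x y => by
      rw [smul_eq_mul, ← MeasureTheory.integral_const_mul]
      simp only [hsymm x, hsmul])
  have hB : ∀ x y, B x y = ∫ g : K, twistedFormPGL f x y g.1 ∂μ := fun x y => rfl
  have hpt := fun (x : VR V) (hx : x ≠ 0) => twistedFormPGL_pos f hx
  have hpos : ∀ x, x ≠ 0 → 0 < B x x := fun x hx => by
    rw [hB]
    exact (hcont x x).integral_pos_of_hasCompactSupport_nonneg_nonzero
      (HasCompactSupport.of_compactSpace _) (fun g => (hpt x hx g.1).le) (x := 1)
      (hpt x hx _).ne'
  have hinv : ∀ h : GLR V, toPGL h ∈ K → ∀ x, B (h.1 x) (h.1 x) =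
      |LinearMap.det h.1| ^ (2 / (Module.finrank ℝ (VR V) : ℝ)) * B x x := by
    intro h hh x
    rw [hB, hB, ← MeasureTheory.integral_const_mul,
      ← MeasureTheory.integral_mul_left_eq_self _ (⟨toPGL h, hh⟩ : K)]
    refine MeasureTheory.integral_congr_ae (Filter.Eventually.of_forall fun g => ?_)
    obtain ⟨k, hk⟩ := toPGL_surjective g.1
    have h1 : ((⟨toPGL h, hh⟩ : K) * g).1 = toPGL (h * k) := by
      rw [map_mul, hk]
      rfl
    simp only [h1]
    rw [twistedFormPGL_toPGL, twistedForm_mul, inv_mul_cancel_left, ← hk, twistedFormPGL_toPGL]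
  refine ⟨⟨_, isNorm_of_posDef (B := B) ⟨fun x y => ?_⟩ hpos⟩, fun g hg => ?_⟩
  · simp only [hB, RingHom.id_apply, hsymm x y]
  · obtain ⟨h, rfl⟩ := toPGL_surjective g
    refine toPGL_mem_isotropySubgroup.2
      ⟨√(|LinearMap.det (h⁻¹).1| ^ (2 / (Module.finrank ℝ (VR V) : ℝ))),
        Real.sqrt_pos.2 (Real.rpow_pos_of_pos (abs_pos.2 (det_ne_zero _)) _), fun x => ?_⟩
    change √(B _ _) = _ * √(B _ _)
    rw [← Real.sqrt_mul (Real.rpow_nonneg (abs_nonneg _) _), hinv h⁻¹ (by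
      rw [map_inv]; exact K.inv_mem hg)]

/-- The isotropy group of the class of a norm, a maximal compact subgroup. -/
def maxK (ν : NormOn (VR V)) : MaxCompact V :=
  ⟨isotropySubgroup ν, isCompact_isotropySubgroup ν, fun K' hK' hle => by
    obtain ⟨μ, hμ⟩ := exists_le_isotropySubgroup hK'
    obtain ⟨c, hc, h⟩ := isotropySubgroup_le_iff.1 (hle.trans hμ)
    refine le_antisymm (hμ.trans (isotropySubgroup_le_iff.2 ⟨c⁻¹, inv_pos.2 hc, fun x => ?_⟩)) hle
    rw [h, ← mul_assoc, inv_mul_cancel₀ hc.ne', one_mul]⟩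

/-- Maximality turns the inclusion obtained by averaging into an equality. -/
theorem exists_maxK (K : MaxCompact V) : ∃ ν, K = maxK ν := by
  obtain ⟨ν, hν⟩ := exists_le_isotropySubgroup K.2.1
  exact ⟨ν, Subtype.ext (K.2.2 _ (isCompact_isotropySubgroup ν) hν).symm⟩

theorem maxK_eq_iff {ν μ : NormOn (VR V)} :
    maxK ν = maxK μ ↔ ∃ c : ℝ, 0 < c ∧ ∀ x, μ.1 x = c * ν.1 x := by
  rw [← isotropySubgroup_le_iff]
  refine ⟨fun h => (congrArg Subtype.val h).le, fun h => ?_⟩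
  exact Subtype.ext ((maxK ν).2.2 _ (isCompact_isotropySubgroup μ) h).symm

theorem isIsotropy_iff {K : MaxCompact V} {ν : NormOn (VR V)} : IsIsotropy K ν ↔ K = maxK ν := by
  constructor
  · intro h
    refine Subtype.ext (Subgroup.ext fun x => ?_)
    obtain ⟨k, rfl⟩ := toPGL_surjective x
    exact (h k).trans toPGL_mem_isotropySubgroup.symm
  · rintro rfl h
    exact toPGL_mem_isotropySubgroup

theorem conj_maxK (h : GLR V) (ν : NormOn (VR V)) :
    MaxCompact.conj (toPGL h) (maxK ν) = maxK (ν.push (toEquiv h)) :=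
  Subtype.ext (isotropySubgroup_push ν h).symm

end Averaging

/-! ### Existence and uniqueness of the Cartan involution -/

section Cartan

variable {ι : Type*} [Fintype ι] [DecidableEq ι]

/-- The inverse transpose. -/
def inverseTranspose : GL ι ℝ →* GL ι ℝ where
  toFun M := ⟨(M⁻¹).1.transpose, M.1.transpose, by
    rw [← Matrix.transpose_mul, Units.mul_inv, Matrix.transpose_one], by
    rw [← Matrix.transpose_mul, Units.inv_mul, Matrix.transpose_one]⟩
  map_one' := Units.ext (by simp)
  map_mul' M N := Units.ext (by simp [mul_inv_rev, Matrix.transpose_mul])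

theorem inverseTranspose_val (M : GL ι ℝ) :
    (inverseTranspose M).1 = (M⁻¹).1.transpose := rfl

theorem inverseTranspose_inv_val (M : GL ι ℝ) :
    ((inverseTranspose M)⁻¹).1 = M.1.transpose := rfl

theorem inverseTranspose_inverseTranspose (M : GL ι ℝ) :
    inverseTranspose (inverseTranspose M) = M := by
  ext1
  rw [inverseTranspose_val, inverseTranspose_inv_val, Matrix.transpose_transpose]

/-- The element of `GL_ι(ℝ)` given by a diagonal matrix. -/
def diagGL (d : ι → ℝ) (hd : ∀ i, d i ≠ 0) : GL ι ℝ :=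
  ⟨Matrix.diagonal d, Matrix.diagonal fun i => (d i)⁻¹, by
    rw [Matrix.diagonal_mul_diagonal, ← Matrix.diagonal_one]
    exact congrArg _ (funext fun i => mul_inv_cancel₀ (hd i)), by
    rw [Matrix.diagonal_mul_diagonal, ← Matrix.diagonal_one]
    exact congrArg _ (funext fun i => inv_mul_cancel₀ (hd i))⟩

theorem diagGL_val (d : ι → ℝ) (hd : ∀ i, d i ≠ 0) : (diagGL d hd).1 = Matrix.diagonal d := rfl

theorem diagGL_mul (d e : ι → ℝ) (hd : ∀ i, d i ≠ 0) (he : ∀ i, e i ≠ 0) :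
    diagGL d hd * diagGL e he = diagGL (fun i => d i * e i) fun i => mul_ne_zero (hd i) (he i) :=
  Units.ext (Matrix.diagonal_mul_diagonal _ _)

theorem diagGL_inv_val (d : ι → ℝ) (hd : ∀ i, d i ≠ 0) :
    ((diagGL d hd)⁻¹).1 = Matrix.diagonal fun i => (d i)⁻¹ := rfl

variable (f : Module.Basis ι ℝ (VR V))

/-- The element of `PGL_V(ℝ)` with a given matrix in the basis `f`. -/
def matPGL : GL ι ℝ →* PGLR V := toPGL.comp (matEquiv f).symm.toMonoidHom

theorem matPGL_matEquiv (h : GLR V) : matPGL f (matEquiv f h) = toPGL h := by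
  simp [matPGL]

theorem matPGL_surjective : Function.Surjective (matPGL f) := fun g => by
  obtain ⟨h, rfl⟩ := toPGL_surjective g
  exact ⟨_, matPGL_matEquiv f h⟩

theorem matPGL_eq_iff {A B : GL ι ℝ} : matPGL f A = matPGL f B ↔ ∃ c : ℝ, B.1 = c • A.1 := by
  obtain ⟨h, rfl⟩ := (matEquiv f).surjective A
  obtain ⟨k, rfl⟩ := (matEquiv f).surjective B
  rw [matPGL_matEquiv, matPGL_matEquiv, toPGL_eq_iff]
  refine exists_congr fun c => ?_
  rw [matEquiv_val, matEquiv_val, ← map_smul]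
  exact (LinearMap.toMatrixAlgEquiv f).injective.eq_iff.symm

/-- Similitudes are the matrices with AᵀA scalar. The scalar need not be assumed positive: it is a
ratio of squared lengths of nonzero vectors. -/
theorem matPGL_mem_isotropySubgroup [Nontrivial V] {A : GL ι ℝ} :
    matPGL f A ∈ isotropySubgroup (basisNorm f) ↔ ∃ c : ℝ, A.1.transpose * A.1 = c • 1 := by
  obtain ⟨h, rfl⟩ := (matEquiv f).surjective A
  rw [matPGL_matEquiv, ← Subgroup.inv_mem_iff, ← map_inv, toPGL_mem_isotropySubgroup, inv_inv]
  have hr : ∀ v, f.repr (f.equivFun.symm v) = v := fun v => f.equivFun.apply_symm_apply v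
  constructor
  · rintro ⟨c, hc, hh⟩
    have h1 := orthogonal_of_isometry (A := c⁻¹ • (matEquiv f h).1) fun v => by
      have := congrArg (· ^ 2) (hh (f.equivFun.symm v))
      simp only [mul_pow, basisNorm_sq, repr_apply, hr] at this
      simp only [Matrix.smul_mulVec, Pi.smul_apply, smul_eq_mul, mul_pow, ← Finset.mul_sum, this]
      rw [← mul_assoc, ← mul_pow, inv_mul_cancel₀ hc.ne', one_pow, one_mul]
    refine ⟨c ^ 2, ?_⟩
    rw [← h1, Matrix.transpose_smul, smul_mul_smul_comm, smul_smul]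
    rw [show c ^ 2 * (c⁻¹ * c⁻¹) = 1 by field_simp, one_smul]
  · rintro ⟨c, hc⟩
    have h1 : ∀ x, (basisNorm f).1 (h.1 x) ^ 2 = c * (basisNorm f).1 x ^ 2 := fun x => by
      have h2 : dotProduct ((matEquiv f h).1.mulVec (f.repr x))
          ((matEquiv f h).1.mulVec (f.repr x)) = c * dotProduct (f.repr x) (f.repr x) := by
        rw [Matrix.dotProduct_mulVec, ← Matrix.mulVec_transpose, Matrix.mulVec_mulVec, hc,
          Matrix.smul_mulVec, Matrix.one_mulVec, smul_dotProduct, smul_eq_mul]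
      rw [basisNorm_sq, basisNorm_sq, repr_apply]
      simpa only [dotProduct, ← sq] using h2
    obtain ⟨x, hx⟩ : ∃ x : VR V, x ≠ 0 := by
      have : Nontrivial (VR V) := Module.nontrivial_of_finrank_pos (R := ℝ) (by
        rw [Module.finrank_baseChange]
        exact Module.finrank_pos)
      exact exists_ne 0
    have hc0 : 0 < c := by
      have h2 := pow_pos ((basisNorm f).pos hx) 2
      have h3 := pow_pos ((basisNorm f).pos fun h0 => hx ((toEquiv h).map_eq_zero_iff.1 h0)) 2
      rw [toEquiv_apply, h1] at h3
      exact pos_of_mul_pos_left h3 h2.le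
    refine ⟨√c, Real.sqrt_pos.2 hc0, fun x => ?_⟩
    rw [← Real.sqrt_sq (NormOn.nonneg _ (h.1 x)), h1, Real.sqrt_mul hc0.le,
      Real.sqrt_sq (NormOn.nonneg _ _)]

/-- The inverse transpose in the basis `f`, as an automorphism of `GL_V(ℝ)`. -/
def cartanGL : GLR V →* GLR V :=
  (matEquiv f).symm.toMonoidHom.comp (inverseTranspose.comp (matEquiv f).toMonoidHom)

theorem matEquiv_cartanGL (h : GLR V) :
    matEquiv f (cartanGL f h) = inverseTranspose (matEquiv f h) :=
  (matEquiv f).apply_symm_apply _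

theorem cartanGL_cartanGL (h : GLR V) : cartanGL f (cartanGL f h) = h := by
  apply (matEquiv f).injective
  rw [matEquiv_cartanGL, matEquiv_cartanGL, inverseTranspose_inverseTranspose]

/-- The Cartan involution of `PGL_V(ℝ)` for the Euclidean norm with orthonormal basis `f`. -/
def cartan : PGLR V →* PGLR V :=
  QuotientGroup.map _ _ (cartanGL f) fun z hz => by
    rw [Subgroup.mem_comap, Subgroup.mem_center_iff]
    intro g
    rw [← cartanGL_cartanGL f g, ← map_mul, ← map_mul, Subgroup.mem_center_iff.1 hz]

theorem cartan_toPGL (h : GLR V) : cartan f (toPGL h) = toPGL (cartanGL f h) := rfl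

theorem cartan_matPGL (A : GL ι ℝ) : cartan f (matPGL f A) = matPGL f (inverseTranspose A) := by
  obtain ⟨h, rfl⟩ := (matEquiv f).surjective A
  rw [matPGL_matEquiv, cartan_toPGL, ← matPGL_matEquiv f, matEquiv_cartanGL]

theorem continuous_inverseTranspose : Continuous (inverseTranspose : GL ι ℝ →* GL ι ℝ) := by
  refine Units.continuous_iff.2 ⟨?_, ?_⟩
  · exact (Units.continuous_val.comp continuous_inv).matrix_transpose
  · exact Units.continuous_val.matrix_transpose

theorem isCartanInvolution_cartan [Nontrivial V] :
    IsCartanInvolution (maxK (basisNorm f)) (cartan f) where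
  continuous := by
    refine isOpenQuotientMap_toPGL.isQuotientMap.continuous_iff.2 ?_
    exact continuous_toPGL.comp ((continuous_matEquiv_symm f).comp
      (continuous_inverseTranspose.comp (continuous_matEquiv f)))
  involutive g := by
    obtain ⟨h, rfl⟩ := toPGL_surjective g
    rw [cartan_toPGL, cartan_toPGL, cartanGL_cartanGL]
  mem_iff g := by
    obtain ⟨A, rfl⟩ := matPGL_surjective f g
    change _ ∈ isotropySubgroup _ ↔ _
    rw [matPGL_mem_isotropySubgroup, cartan_matPGL, matPGL_eq_iff]
    refine exists_congr fun c => ⟨fun h => ?_, fun h => ?_⟩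
    · have h1 : A.1.transpose = c • (A⁻¹).1 := by
        rw [← Matrix.mul_one A.1.transpose, ← Units.mul_inv A, ← Matrix.mul_assoc, h]
        simp
      rw [inverseTranspose_val, ← Matrix.transpose_smul, ← h1, Matrix.transpose_transpose]
    · have h1 : A.1.transpose = c • (A⁻¹).1 := by
        conv_lhs => rw [h]
        rw [Matrix.transpose_smul, inverseTranspose_val, Matrix.transpose_transpose]
      rw [h1, smul_mul_assoc, Units.inv_mul]

variable {f}

/-- Diagonal sign matrices lie in K and commute with diagonal matrices, so the image under θ of a
diagonal element commutes with them in PGL. That is commutation up to a scalar only, so diagonality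
is obtained for the image of a square. -/
theorem IsCartanInvolution.matPGL_diag_sq [Nontrivial V] {θ : PGLR V →* PGLR V}
    (hθ : IsCartanInvolution (maxK (basisNorm f)) θ) (q : ι → ℝ) (hq : ∀ i, q i ≠ 0) :
    ∃ (z : ι → ℝ) (hz : ∀ i, z i ≠ 0),
      θ (matPGL f (diagGL q hq * diagGL q hq)) = matPGL f (diagGL z hz) := by
  obtain ⟨y, hy⟩ := matPGL_surjective f (θ (matPGL f (diagGL q hq)))
  have hdiag : ∀ i j, i ≠ j → (y * y).1 i j = 0 := by
    intro i j hij
    -- Conjugation by this sign matrix negates the (i, j) entry for j ≠ i, so an entry it preserves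
    -- must vanish.
    let d : ι → ℝ := fun k => if k = i then -1 else 1
    have hd : ∀ k, d k ≠ 0 := fun k => by simp only [d]; split_ifs <;> norm_num
    have hdd : ∀ k, d k * d k = 1 := fun k => by simp only [d]; split_ifs <;> norm_num
    let ε := diagGL d hd
    have hεε : ε * ε = 1 := Units.ext (by
      rw [Units.val_mul, diagGL_val, Matrix.diagonal_mul_diagonal]
      simp [hdd])
    have hε : θ (matPGL f ε) = matPGL f ε :=
      (hθ.mem_iff _).1 ((matPGL_mem_isotropySubgroup f).2 ⟨1, by
        rw [diagGL_val, Matrix.diagonal_transpose, Matrix.diagonal_mul_diagonal]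
        simp [hdd]⟩)
    have hcomm : ε * diagGL q hq * ε = diagGL q hq := by
      have : ε * diagGL q hq = diagGL q hq * ε := by
        rw [diagGL_mul, diagGL_mul]
        exact Units.ext (congrArg Matrix.diagonal (funext fun k => mul_comm _ _))
      rw [this, mul_assoc, hεε, mul_one]
    have h1 : matPGL f (ε * y * ε) = matPGL f y := by
      rw [map_mul, map_mul, hy, ← hε, ← map_mul, ← map_mul, ← map_mul, ← map_mul, hcomm]
    obtain ⟨c, hc⟩ := (matPGL_eq_iff f).1 h1
    have hc' : (ε * y * ε).1 = c • y.1 := by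
      have : (ε * (ε * y * ε) * ε) = y := by
        calc ε * (ε * y * ε) * ε = (ε * ε) * y * (ε * ε) := by group
          _ = y := by rw [hεε, one_mul, mul_one]
      calc (ε * y * ε).1 = ε.1 * y.1 * ε.1 := by rw [Units.val_mul, Units.val_mul]
        _ = c • (ε * (ε * y * ε) * ε).1 := by
          conv_lhs => rw [hc]
          simp [mul_assoc]
        _ = _ := by rw [this]
    -- The scalar c by which y fails to commute with ε cancels in y².
    have h2 : (ε * (y * y) * ε).1 = (y * y).1 := by
      have : ε * (y * y) * ε = (ε * y * ε) * (ε * y * ε) := by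
        calc ε * (y * y) * ε = ε * y * 1 * y * ε := by group
          _ = _ := by rw [← hεε]; group
      rw [this, Units.val_mul, Units.val_mul]
      calc (ε * y * ε).1 * (ε * y * ε).1 = (c • y.1) * (ε * y * ε).1 := by rw [hc']
        _ = y.1 * (c • (ε * y * ε).1) := by simp
        _ = y.1 * y.1 := by rw [← hc]
    have h3 := congrFun (congrFun h2 i) j
    rw [Units.val_mul, Units.val_mul, diagGL_val, Matrix.mul_diagonal, Matrix.diagonal_mul] at h3
    simp only [d, if_true, hij.symm, if_false] at h3
    linarith
  have hy2 : (y * y).1 = Matrix.diagonal fun i => (y * y).1 i i := by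
    ext i j
    by_cases hij : i = j
    · subst hij; simp
    · rw [hdiag i j hij, Matrix.diagonal_apply_ne _ hij]
  have hz : ∀ i, (y * y).1 i i ≠ 0 := by
    have h1 : IsUnit (Matrix.diagonal fun i => (y * y).1 i i) := hy2 ▸ (y * y).isUnit
    rw [Matrix.isUnit_diagonal, Pi.isUnit_iff] at h1
    exact fun i => (h1 i).ne_zero
  refine ⟨_, hz, ?_⟩
  rw [map_mul, map_mul, ← hy, ← map_mul]
  congr 1
  exact Units.ext hy2

/-- Write p = q⁴ and θ(q²) = z with z diagonal. Then q² z is fixed by θ, so it lies in K and (q² z)²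
is a scalar; hence θ(p) = z² is p⁻¹ up to that scalar. -/
theorem IsCartanInvolution.matPGL_diag [Nontrivial V] {θ : PGLR V →* PGLR V}
    (hθ : IsCartanInvolution (maxK (basisNorm f)) θ) (p : ι → ℝ) (hp : ∀ i, 0 < p i) :
    θ (matPGL f (diagGL p fun i => (hp i).ne')) = (matPGL f (diagGL p fun i => (hp i).ne'))⁻¹ := by
  -- Fourth roots: one squaring makes the image diagonal, the other occurs because membership in K
  -- only controls the square of q² z.
  let q : ι → ℝ := fun i => √(√(p i))
  have hq : ∀ i, q i ≠ 0 := fun i => (Real.sqrt_pos.2 (Real.sqrt_pos.2 (hp i))).ne'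
  let D := diagGL q hq
  obtain ⟨z, hz, hθz⟩ := hθ.matPGL_diag_sq q hq
  have hcomm : D * D * diagGL z hz = diagGL z hz * (D * D) := by
    rw [diagGL_mul, diagGL_mul, diagGL_mul]
    exact Units.ext (congrArg Matrix.diagonal (funext fun k => mul_comm _ _))
  have hfix : matPGL f (D * D * diagGL z hz) ∈ isotropySubgroup (basisNorm f) := by
    refine (hθ.mem_iff _).2 ?_
    rw [map_mul, map_mul, ← hθz, hθ.involutive, hθz, ← map_mul, ← hcomm, map_mul]
  obtain ⟨c, hc⟩ := (matPGL_mem_isotropySubgroup f).1 hfix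
  rw [diagGL_mul, diagGL_mul, diagGL_val, Matrix.diagonal_transpose,
    Matrix.diagonal_mul_diagonal] at hc
  have hpD : diagGL p (fun i => (hp i).ne') = D * D * (D * D) := by
    rw [diagGL_mul, diagGL_mul]
    refine Units.ext (congrArg Matrix.diagonal (funext fun k => ?_))
    simp only [q]
    rw [Real.mul_self_sqrt (Real.sqrt_nonneg _), Real.mul_self_sqrt (hp k).le]
  rw [hpD, map_mul, map_mul θ, hθz, ← map_mul, ← map_mul, ← map_inv, ← hpD]
  refine Eq.symm ((matPGL_eq_iff f).2 ⟨c, ?_⟩)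
  rw [diagGL_inv_val, diagGL_mul, diagGL_val, ← Matrix.diagonal_smul]
  refine congrArg _ (funext fun k => ?_)
  have h1 := congrFun (congrFun hc k) k
  rw [Matrix.diagonal_apply_eq, Matrix.smul_apply, Matrix.one_apply_eq, smul_eq_mul, mul_one] at h1
  have h2 : p k = q k * q k * (q k * q k) := by
    simp only [q]
    rw [Real.mul_self_sqrt (Real.sqrt_nonneg _), Real.mul_self_sqrt (hp k).le]
  rw [Pi.smul_apply, smul_eq_mul, ← h1, h2]
  have := hq k
  field_simp

theorem exists_orthogonal_diagonalization (M : GL ι ℝ) :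
    ∃ (U : GL ι ℝ) (d : ι → ℝ) (hd : ∀ i, 0 < d i), U.1.transpose * U.1 = 1 ∧
      M.1.transpose * M.1 = (U * diagGL d (fun i => (hd i).ne') * U⁻¹).1 := by
  have hS : (M.1.transpose * M.1).PosDef := by
    have := Matrix.PosDef.conjTranspose_mul_self M.1
      (Matrix.mulVec_injective_iff_isUnit.2 M.isUnit)
    rwa [Matrix.conjTranspose_eq_transpose_of_trivial] at this
  refine ⟨Unitary.toUnits hS.1.eigenvectorUnitary, hS.1.eigenvalues, hS.eigenvalues_pos, ?_, ?_⟩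
  · exact (Matrix.mem_orthogonalGroup_iff' _ ℝ).1 hS.1.eigenvectorUnitary.2
  · conv_lhs => rw [hS.1.spectral_theorem]
    rw [Unitary.conjStarAlgAut_apply]
    rfl

/-- Polar decomposition M = k R with R = U D U⁻¹ positive symmetric. Both k and U lie over K and are
fixed by θ, while D is inverted, so θ(M) = k R⁻¹, which is the inverse transpose of M. -/
theorem IsCartanInvolution.eq_cartan [Nontrivial V] {θ : PGLR V →* PGLR V}
    (hθ : IsCartanInvolution (maxK (basisNorm f)) θ) : θ = cartan f := by
  refine MonoidHom.ext fun g => ?_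
  obtain ⟨M, rfl⟩ := matPGL_surjective f g
  obtain ⟨U, d, hd, hU, hM⟩ := exists_orthogonal_diagonalization M
  have hs : ∀ i, 0 < √(d i) := fun i => Real.sqrt_pos.2 (hd i)
  let D := diagGL (fun i => √(d i)) fun i => (hs i).ne'
  let R := U * D * U⁻¹
  have hUinv : (U⁻¹).1 = U.1.transpose := by
    rw [← Matrix.one_mul (U⁻¹).1, ← hU, Matrix.mul_assoc, Units.mul_inv, Matrix.mul_one]
  have hR : R.1.transpose = R.1 := by
    simp only [R, Units.val_mul, hUinv, Matrix.transpose_mul, Matrix.transpose_transpose]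
    rw [diagGL_val, Matrix.diagonal_transpose, Matrix.mul_assoc]
  have hRR : M.1.transpose * M.1 = (R * R).1 := by
    rw [hM]
    congr 1
    have : diagGL d (fun i => (hd i).ne') = D * D := by
      rw [diagGL_mul]
      exact Units.ext (congrArg Matrix.diagonal (funext fun k => (Real.mul_self_sqrt (hd k).le).symm))
    rw [this]
    simp only [R]
    group
  have hθU : θ (matPGL f U) = matPGL f U :=
    (hθ.mem_iff _).1 ((matPGL_mem_isotropySubgroup f).2 ⟨1, by rw [hU, one_smul]⟩)
  have hθR : θ (matPGL f R) = (matPGL f R)⁻¹ := by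
    simp only [R, map_mul, map_inv, hθU]
    rw [hθ.matPGL_diag _ hs, mul_inv_rev, mul_inv_rev, inv_inv, mul_assoc]
  have hk : matPGL f (M * R⁻¹) ∈ isotropySubgroup (basisNorm f) := by
    refine (matPGL_mem_isotropySubgroup f).2 ⟨1, ?_⟩
    have h1 : (R⁻¹).1.transpose = (R⁻¹).1 := by
      rw [← Matrix.mul_one (R⁻¹).1.transpose, ← Units.mul_inv R, ← Matrix.mul_assoc]
      conv_lhs => rw [← hR, ← Matrix.transpose_mul, Units.mul_inv, Matrix.transpose_one,
        Matrix.one_mul]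
    rw [Units.val_mul, Matrix.transpose_mul, h1, Matrix.mul_assoc, ← Matrix.mul_assoc M.1.transpose,
      hRR, ← Units.val_mul, ← Units.val_mul, one_smul]
    simp
  have hθk := (hθ.mem_iff _).1 hk
  rw [cartan_matPGL]
  have h1 : matPGL f M = matPGL f (M * R⁻¹) * matPGL f R := by
    rw [← map_mul]
    simp
  rw [h1, map_mul, hθk, hθR, ← map_inv, ← map_mul]
  congr 1
  have h2 : inverseTranspose M * (R * R) = M := by
    ext1
    rw [Units.val_mul, ← hRR, inverseTranspose_val, ← Matrix.mul_assoc, ← Matrix.transpose_mul,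
      Units.mul_inv, Matrix.transpose_one, Matrix.one_mul]
  conv_lhs => rw [← h2]
  group

end Cartan

/-! ### The geodesic action in bases compatible with the flag -/

section Geodesic

/-- The basis `f` of `V_v` is compatible with the flag of `P`: each `(V_i)_v` is spanned by the
`f_j` with `w j ≤ V_i`. -/
def Compatible {ι : Type*} (f : Module.Basis ι ℝ (VR V)) (P : Parabolic V) (w : ι → P.Index) :
    Prop :=
  ∀ W : P.Index, W.1.baseChange ℝ = Submodule.span ℝ (f '' {j | (w j).1 ≤ W.1})

variable {ι : Type*} {f : Module.Basis ι ℝ (VR V)} {P : Parabolic V} {w : ι → P.Index}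

theorem Parabolic.le_pred_iff {W : P.Index} {U : Submodule ℚ V} (hU : U ∈ P.carrier) :
    U ≤ P.pred W ↔ U < W.1 :=
  ⟨fun h => h.trans_lt (P.pred_isGreatest W).1.2, fun h => (P.pred_isGreatest W).2 ⟨hU, h⟩⟩

theorem Compatible.mem_baseChange (hf : Compatible f P w) {W : Submodule ℚ V} (hW : W ∈ P.carrier)
    (x : VR V) : x ∈ W.baseChange ℝ ↔ ∀ j, ¬ (w j).1 ≤ W → f.repr x j = 0 := by
  by_cases hb : W = ⊥
  · subst hb
    rw [Submodule.baseChange_bot, Submodule.mem_bot]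
    constructor
    · rintro rfl j -
      simp
    · intro h
      refine f.repr.map_eq_zero_iff.1 (Finsupp.ext fun j => h j fun hj => ?_)
      exact (w j).2.2 (le_bot_iff.1 hj)
  · rw [hf ⟨W, hW, hb⟩, Module.Basis.mem_span_image]
    constructor
    · intro h j hj
      by_contra h0
      exact hj (h (Finsupp.mem_support_iff.2 h0))
    · intro h j hj
      by_contra h0
      exact Finsupp.mem_support_iff.1 hj (h j h0)

theorem Compatible.mem_pred (hf : Compatible f P w) {W : P.Index} (x : VR V) :
    x ∈ P.realPred W ↔ ∀ j, ¬ (w j).1 < W.1 → f.repr x j = 0 := by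
  rw [Parabolic.realPred, hf.mem_baseChange (P.pred_mem W)]
  simp only [Parabolic.le_pred_iff (w _).2.1]

variable [Fintype ι]

theorem scaleBasis_compatible (hf : Compatible f P w) (r : ι → ℝ) (hr : ∀ i, r i ≠ 0) :
    Compatible (scaleBasis f r hr) P w := fun W => by
  rw [hf W]
  refine le_antisymm (Submodule.span_le.2 ?_) (Submodule.span_le.2 ?_)
  · rintro _ ⟨j, hj, rfl⟩
    have : f j = (r j)⁻¹ • scaleBasis f r hr j := by
      rw [scaleBasis_apply, smul_smul, inv_mul_cancel₀ (hr j), one_smul]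
    rw [this]
    exact Submodule.smul_mem _ _ (Submodule.subset_span ⟨j, hj, rfl⟩)
  · rintro _ ⟨j, hj, rfl⟩
    rw [scaleBasis_apply]
    exact Submodule.smul_mem _ _ (Submodule.subset_span ⟨j, hj, rfl⟩)

/-- The automorphism `f_j ↦ r_j f_j`. -/
def scaleGL (f : Module.Basis ι ℝ (VR V)) (r : ι → ℝ) (hr : ∀ i, r i ≠ 0) : GLR V :=
  ofEquiv (f.equiv (scaleBasis f r hr) (Equiv.refl ι))

theorem scaleGL_apply_basis (r : ι → ℝ) (hr : ∀ i, r i ≠ 0) (j : ι) :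
    (scaleGL f r hr).1 (f j) = r j • f j := by
  rw [scaleGL, ofEquiv_apply, Module.Basis.equiv_apply, Equiv.refl_apply, scaleBasis_apply]

theorem map_scaleGL (r : ι → ℝ) (hr : ∀ i, r i ≠ 0) :
    f.map (toEquiv (scaleGL f r hr)) = scaleBasis f r hr := by
  refine Module.Basis.eq_of_apply_eq fun j => ?_
  rw [Module.Basis.map_apply, toEquiv_apply, scaleGL_apply_basis, scaleBasis_apply]

theorem scaleGL_repr (r : ι → ℝ) (hr : ∀ i, r i ≠ 0) (x : VR V) (j : ι) :
    f.repr ((scaleGL f r hr).1 x) j = r j * f.repr x j := by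
  classical
  conv_lhs => rw [← f.sum_repr x, map_sum]
  simp only [map_smul, scaleGL_apply_basis, smul_smul]
  rw [Module.Basis.repr_sum_self, mul_comm]

theorem scaleGL_inv_repr (r : ι → ℝ) (hr : ∀ i, r i ≠ 0) (x : VR V) (j : ι) :
    f.repr (((scaleGL f r hr)⁻¹).1 x) j = (r j)⁻¹ * f.repr x j := by
  have h := scaleGL_repr (f := f) r hr (((scaleGL f r hr)⁻¹).1 x) j
  rw [← Module.End.mul_apply, Units.mul_inv, Module.End.one_apply] at h
  rw [h, ← mul_assoc, inv_mul_cancel₀ (hr j), one_mul]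

theorem Compatible.scaleGL_mem (hf : Compatible f P w) (r : ι → ℝ) (hr : ∀ i, r i ≠ 0) :
    scaleGL f r hr ∈ P.stabGL := by
  intro W hW x hx
  rw [hf.mem_baseChange hW] at hx
  constructor
  · rw [hf.mem_baseChange hW]
    intro j hj
    rw [scaleGL_repr, hx j hj, mul_zero]
  · rw [hf.mem_baseChange hW]
    intro j hj
    rw [scaleGL_inv_repr, hx j hj, mul_zero]

theorem Parabolic.grMap_eq_smul_iff (h : P.stabGL) (W : P.Index) (a : ℝ) :
    P.grMap h W = a • LinearMap.id ↔ ∀ x ∈ P.real W, h.1.1 x - a • x ∈ P.realPred W := by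
  have key : ∀ x : P.real W, P.grMap h W (Submodule.Quotient.mk x) = a • Submodule.Quotient.mk x ↔
      h.1.1 x - a • x.1 ∈ P.realPred W := by
    intro x
    change Submodule.Quotient.mk (P.resMap h W x) = _ ↔ _
    rw [← Submodule.Quotient.mk_smul, Submodule.Quotient.eq]
    rfl
  constructor
  · intro H x hx
    rw [← key ⟨x, hx⟩, H]
    rfl
  · intro H
    refine LinearMap.ext fun y => ?_
    obtain ⟨x, rfl⟩ := Submodule.Quotient.mk_surjective _ y
    exact (key x).2 (H x.1 x.2)

theorem Compatible.apply_mem (hf : Compatible f P w) (j : ι) : f j ∈ P.real (w j) := by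
  rw [Parabolic.real, hf (w j)]
  exact Submodule.subset_span ⟨j, le_refl (w j).1, rfl⟩

theorem Parabolic.Index.ext {U W : P.Index} (h : U.1 = W.1) : U = W := Subtype.ext h

theorem Parabolic.Index.total (U W : P.Index) : U.1 ≤ W.1 ∨ W.1 ≤ U.1 := P.chain.total U.2.1 W.2.1

/-- The action of `A_P` on the maximal compact subgroup of a Euclidean norm with an orthonormal basis
compatible with the flag. -/
theorem Compatible.geodesicAct [Nontrivial V] (hf : Compatible f P w) {a : P.Index → ℝ}
    (ha : a ∈ P.Torus) :
    P.geodesicAct a (maxK (basisNorm f)) =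
      maxK (basisNorm (scaleBasis f (fun j => a (w j)) fun j => (ha (w j)).ne')) := by
  classical
  set r : ι → ℝ := fun j => a (w j) with hr_def
  have hr : ∀ j, r j ≠ 0 := fun j => (ha (w j)).ne'
  -- The diagonal matrix acts by a_i on the i-th block and equals its own transpose, so it is a
  -- lift.
  have hex : P.IsGeodesicLift a (maxK (basisNorm f)) (toPGL (scaleGL f r hr)) := by
    refine ⟨⟨⟨_, hf.scaleGL_mem r hr⟩, rfl, fun W => ?_⟩, cartan f, isCartanInvolution_cartan f, ?_⟩
    · rw [Parabolic.grMap_eq_smul_iff]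
      intro x hx
      rw [Parabolic.real, hf.mem_baseChange W.2.1] at hx
      rw [hf.mem_pred]
      intro j hj
      rw [map_sub, map_smul, Finsupp.sub_apply, Finsupp.smul_apply, scaleGL_repr, smul_eq_mul]
      by_cases hjW : (w j).1 ≤ W.1
      · have : w j = W := Parabolic.Index.ext (eq_of_le_of_not_lt hjW hj)
        simp only [hr_def, this, sub_self]
      · rw [hx j hjW, mul_zero, mul_zero, sub_zero]
    · rw [cartan_toPGL, ← map_inv]
      congr 1
      apply (matEquiv f).injective
      rw [matEquiv_cartanGL, map_inv]
      ext i j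
      rw [inverseTranspose_val, ← map_inv, Matrix.transpose_apply, matEquiv_apply, matEquiv_apply,
        scaleGL_inv_repr, scaleGL_inv_repr, f.repr_self, f.repr_self]
      by_cases hij : i = j
      · subst hij; rfl
      · rw [Finsupp.single_eq_of_ne hij, Finsupp.single_eq_of_ne (Ne.symm hij), mul_zero, mul_zero]
  -- Uniqueness pins down the element selected by `Classical.epsilon`. The action on graded pieces
  -- makes the matrix block triangular with prescribed diagonal blocks; being inverted by θ makes it
  -- symmetric up to a scalar, and together these force it to be diagonal.
  have huniq : ∀ g, P.IsGeodesicLift a (maxK (basisNorm f)) g → g = toPGL (scaleGL f r hr) := by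
    rintro _ ⟨⟨h, rfl, hgr⟩, θ, hθ, hθg⟩
    rw [hθ.eq_cartan, cartan_toPGL, ← map_inv, toPGL_eq_iff] at hθg
    obtain ⟨c, hc⟩ := hθg
    set M := matEquiv f h.1 with hM
    have hc' : (M⁻¹).1 = c • (M⁻¹).1.transpose := by
      have h1 : (h.1⁻¹).1 = c • (cartanGL f h.1).1 := hc
      have := congrArg (LinearMap.toMatrixAlgEquiv f) h1
      rwa [map_smul, ← matEquiv_val, ← matEquiv_val, matEquiv_cartanGL, map_inv] at this
    have hMt : M.1.transpose = c • M.1 := by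
      have h1 : (M⁻¹).1.transpose * M.1.transpose = 1 := by
        rw [← Matrix.transpose_mul, Units.mul_inv, Matrix.transpose_one]
      calc M.1.transpose = M.1 * (M⁻¹).1 * M.1.transpose := by
            rw [Units.mul_inv, Matrix.one_mul]
        _ = M.1 * (c • (M⁻¹).1.transpose) * M.1.transpose := by rw [← hc']
        _ = c • M.1 := by
          rw [Matrix.mul_smul, Matrix.smul_mul, Matrix.mul_assoc, h1, Matrix.mul_one]
    have hent : ∀ i j, ¬ (w i).1 < (w j).1 → M.1 i j = a (w j) * (if i = j then 1 else 0) := by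
      intro i j hij
      have h1 := (Parabolic.grMap_eq_smul_iff h (w j) (a (w j))).1 (hgr (w j)) _ (hf.apply_mem j)
      rw [hf.mem_pred] at h1
      have h2 := h1 i hij
      rw [map_sub, map_smul, Finsupp.sub_apply, Finsupp.smul_apply, f.repr_self,
        Finsupp.single_apply, smul_eq_mul] at h2
      rw [hM, matEquiv_apply]
      simp only [@eq_comm _ i j]
      linarith
    have hdiag : ∀ i j, M.1 i j = r j * (if i = j then 1 else 0) := by
      intro i j
      by_cases hij : (w i).1 < (w j).1
      · have hne : i ≠ j := by rintro rfl; exact lt_irrefl _ hij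
        have h1 := hent j i hij.asymm
        rw [if_neg hne.symm, mul_zero] at h1
        have h2 := congrFun (congrFun hMt j) i
        rw [Matrix.transpose_apply, Matrix.smul_apply, h1, smul_zero] at h2
        rw [h2, if_neg hne, mul_zero]
      · exact hent i j hij
    congr 1
    apply (matEquiv f).injective
    ext i j
    rw [← hM, hdiag, matEquiv_apply, scaleGL_apply_basis, map_smul, f.repr_self, Finsupp.smul_apply,
      Finsupp.single_apply, smul_eq_mul]
    simp only [@eq_comm _ i j]
  rw [Parabolic.geodesicAct, huniq _ (Classical.epsilon_spec ⟨_, hex⟩), conj_maxK, ← basisNorm_map,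
    map_scaleGL]

theorem Compatible.map (hf : Compatible f P w) {h : GLR V} (hh : h ∈ P.stabGL) :
    Compatible (f.map (toEquiv h)) P w := fun W => by
  have h1 : (f.map (toEquiv h) : ι → VR V) '' {j | (w j).1 ≤ W.1} =
      h.1 '' (f '' {j | (w j).1 ≤ W.1}) := by
    rw [Set.image_image]
    rfl
  rw [h1, ← Submodule.map_span, ← hf W]
  refine le_antisymm (fun x hx => ⟨(h⁻¹).1 x, (hh W.1 W.2.1 x hx).2, ?_⟩)
    (Submodule.map_le_iff_le_comap.2 fun x hx => (hh W.1 W.2.1 x hx).1)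
  exact (toEquiv h).apply_symm_apply x

end Geodesic

/-! ### Splittings are isomorphisms and assemble compatible bases -/

section Splittings

variable {P : Parabolic V}

/-- The sum `⨁ (V_i / V_{i-1})_v → V_v` of the components of a splitting, as a linear map. -/
def Splitting.totalMap (s : Splitting P) : (∀ W : P.Index, P.gr W) →ₗ[ℝ] VR V :=
  ∑ W, (P.real W).subtype ∘ₗ s.map W ∘ₗ LinearMap.proj W

theorem Splitting.totalMap_apply (s : Splitting P) (y : ∀ W : P.Index, P.gr W) :
    s.totalMap y = s.total y := by
  simp [Splitting.totalMap, Splitting.total, LinearMap.sum_apply]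

theorem Splitting.sub_mem (s : Splitting P) {W : P.Index} (z : P.real W) :
    z.1 - (s.map W (Submodule.Quotient.mk z) : VR V) ∈ P.realPred W :=
  (Submodule.Quotient.eq ((P.realPred W).submoduleOf (P.real W))).1 (s.section_map W (Submodule.Quotient.mk z)).symm

theorem Splitting.total_single [DecidableEq P.Index] (s : Splitting P) (W : P.Index) (y : P.gr W) :
    s.total (Pi.single W y) = s.map W y := by
  rw [Splitting.total, Finset.sum_eq_single W]
  · rw [Pi.single_eq_same]
  · intro U _ hU
    rw [Pi.single_eq_of_ne hU, map_zero]
    rfl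
  · simp

/-- Induction along the flag: subtracting from z the section of its class leaves a vector of the
preceding step. The support condition records that only pieces inside W are needed. -/
theorem Splitting.exists_total_eq (s : Splitting P) (W : Submodule ℚ V) (hW : W ∈ P.carrier) :
    ∀ z ∈ W.baseChange ℝ, ∃ y, s.total y = z ∧ ∀ U : P.Index, ¬ U.1 ≤ W → y U = 0 := by
  classical
  induction W using WellFoundedLT.induction with
  | ind W ih =>
    intro z hz
    by_cases hb : W = ⊥
    · subst hb
      rw [Submodule.baseChange_bot, Submodule.mem_bot] at hz
      subst hz
      exact ⟨0, by rw [← s.totalMap_apply, map_zero], fun _ _ => rfl⟩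
    · let W' : P.Index := ⟨W, hW, hb⟩
      obtain ⟨y, hy, hy0⟩ := ih (P.pred W') (P.pred_isGreatest W').1.2 (P.pred_mem W') _
        (s.sub_mem (W := W') ⟨z, hz⟩)
      refine ⟨y + Pi.single W' (Submodule.Quotient.mk ⟨z, hz⟩), ?_, fun U hU => ?_⟩
      · rw [← s.totalMap_apply, map_add, s.totalMap_apply, s.totalMap_apply, hy, s.total_single]
        exact sub_add_cancel _ _
      · have h1 : U ≠ W' := by
          rintro rfl
          exact hU le_rfl
        rw [Pi.add_apply, Pi.single_eq_of_ne h1, add_zero]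
        exact hy0 U fun h => hU (h.trans (P.pred_isGreatest W').1.2.le)

theorem Parabolic.real_mono {U W : P.Index} (h : U.1 ≤ W.1) : P.real U ≤ P.real W :=
  Submodule.baseChange_mono (A := ℝ) h

theorem Parabolic.real_le_realPred {U W : P.Index} (h : U.1 < W.1) : P.real U ≤ P.realPred W :=
  Submodule.baseChange_mono (A := ℝ) ((P.pred_isGreatest W).2 ⟨U.2.1, h⟩)

/-- In a vanishing sum, the term of the largest piece with nonzero component equals minus the
others, so it lies in the preceding step and its class is zero. -/
theorem Splitting.total_injective (s : Splitting P) : Function.Injective s.totalMap := by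
  classical
  refine (injective_iff_map_eq_zero _).2 fun y hy => ?_
  by_contra hne
  obtain ⟨W₀, hW₀⟩ := Function.ne_iff.1 hne
  obtain ⟨_, ⟨W, hW, rfl⟩, hmax⟩ := WellFounded.has_min
    (wellFounded_gt : WellFounded ((· > ·) : Submodule ℚ V → Submodule ℚ V → Prop))
    {U | ∃ W : P.Index, y W ≠ 0 ∧ W.1 = U} ⟨W₀.1, W₀, hW₀, rfl⟩
  apply hW
  have h1 : (s.map W (y W) : VR V) ∈ P.realPred W := by
    rw [s.totalMap_apply, Splitting.total, ← Finset.add_sum_erase _ _ (Finset.mem_univ W)] at hy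
    rw [eq_neg_of_add_eq_zero_left hy]
    refine Submodule.neg_mem _ (Submodule.sum_mem _ fun U hU => ?_)
    by_cases hU0 : y U = 0
    · rw [hU0, map_zero]
      exact Submodule.zero_mem _
    · have hne := Finset.ne_of_mem_erase hU
      have hlt : U.1 < W.1 := by
        rcases Parabolic.Index.total U W with h | h
        · exact lt_of_le_of_ne h fun h' => hne (Parabolic.Index.ext h')
        · exact absurd (lt_of_le_of_ne h fun h' => hne (Parabolic.Index.ext h'.symm))
            (hmax _ ⟨U, hU0, rfl⟩)
      exact Parabolic.real_le_realPred hlt (s.map U (y U)).2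
  rw [← s.section_map W (y W), Submodule.Quotient.mk_eq_zero]
  exact h1

/-- The isomorphism `⨁ (V_i / V_{i-1})_v ≃ V_v` of a splitting. -/
def Splitting.totalEquiv (s : Splitting P) : (∀ W : P.Index, P.gr W) ≃ₗ[ℝ] VR V :=
  LinearEquiv.ofBijective s.totalMap ⟨s.total_injective, fun z => by
    obtain ⟨y, hy, -⟩ := s.exists_total_eq ⊤ P.top_mem z (by
      rw [Submodule.baseChange_top]
      trivial)
    exact ⟨y, by rw [s.totalMap_apply, hy]⟩⟩

theorem Splitting.totalEquiv_apply (s : Splitting P) (y : ∀ W : P.Index, P.gr W) :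
    s.totalEquiv y = s.total y := s.totalMap_apply y

theorem Splitting.exists_total (s : Splitting P) (z : VR V) : ∃ y, s.total y = z :=
  ⟨s.totalEquiv.symm z, by rw [← s.totalEquiv_apply, LinearEquiv.apply_symm_apply]⟩

open Classical in
/-- The basis of `V_v` obtained, through a splitting, from bases of the graded pieces. -/
def Splitting.basis (s : Splitting P) {κ : P.Index → Type*} [∀ W, Fintype (κ W)]
    (b : ∀ W, Module.Basis (κ W) ℝ (P.gr W)) : Module.Basis (Σ W, κ W) ℝ (VR V) :=
  (Pi.basis b).map s.totalEquiv

variable {κ : P.Index → Type*} [∀ W, Fintype (κ W)]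

theorem Splitting.basis_repr_total (s : Splitting P) (b : ∀ W, Module.Basis (κ W) ℝ (P.gr W))
    (y : ∀ W : P.Index, P.gr W) (p : Σ W, κ W) :
    (s.basis b).repr (s.total y) p = (b p.1).repr (y p.1) p.2 := by
  rw [← s.totalEquiv_apply, Splitting.basis, Module.Basis.map_repr, LinearEquiv.trans_apply,
    LinearEquiv.symm_apply_apply, Pi.basis_repr]

theorem Splitting.basis_apply (s : Splitting P) (b : ∀ W, Module.Basis (κ W) ℝ (P.gr W))
    (p : Σ W, κ W) : s.basis b p = s.map p.1 (b p.1 p.2) := by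
  classical
  rw [Splitting.basis, Module.Basis.map_apply, ← s.total_single, s.totalEquiv_apply]
  congr 1
  convert Pi.basis_apply b p

theorem Splitting.basis_compatible (s : Splitting P) (b : ∀ W, Module.Basis (κ W) ℝ (P.gr W)) :
    Compatible (s.basis b) P Sigma.fst := by
  intro W
  refine le_antisymm (fun z hz => ?_) (Submodule.span_le.2 ?_)
  · obtain ⟨y, rfl, hy⟩ := s.exists_total_eq W.1 W.2.1 z hz
    rw [Module.Basis.mem_span_image]
    intro p hp
    by_contra h
    refine Finsupp.mem_support_iff.1 hp ?_
    rw [s.basis_repr_total, hy p.1 h, map_zero]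
    rfl
  · rintro _ ⟨p, hp, rfl⟩
    rw [s.basis_apply]
    exact Parabolic.real_mono hp (s.map p.1 _).2

/-- Stretching an orthonormal basis by a divides the norm by a; this matches the geodesic action
with rescaling on the graded pieces. -/
theorem Splitting.scaleBasis_norm (s : Splitting P) (b : ∀ W, Module.Basis (κ W) ℝ (P.gr W))
    {a : P.Index → ℝ} (ha : a ∈ P.Torus) (y : ∀ W : P.Index, P.gr W) :
    (basisNorm (scaleBasis (s.basis b) (fun p => a p.1) fun p => (ha p.1).ne')).1 (s.total y) =
      √(∑ W, ((a W)⁻¹ * (basisNorm (b W)).1 (y W)) ^ 2) := by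
  rw [basisNorm_apply, Fintype.sum_sigma]
  refine congrArg Real.sqrt (Finset.sum_congr rfl fun W _ => ?_)
  rw [mul_pow, basisNorm_sq, Finset.mul_sum]
  refine Finset.sum_congr rfl fun i _ => ?_
  rw [scaleBasis_repr, s.basis_repr_total, mul_pow]

end Splittings

/-! ### Norms on the whole space representing a triple -/

/-- The norm `ν` on `V_v` is the orthogonal sum, through the splitting of `x`, of norms `m_i` on the
graded pieces which represent the classes of `x`. -/
def XSharp.Rep (x : XSharp V) (m : ∀ W : x.P.Index, NormOn (x.P.gr W)) (ν : NormOn (VR V)) : Prop :=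
  (∀ W, (m W).cls = x.μ W) ∧
    ∀ y : ∀ W : x.P.Index, x.P.gr W, ν.1 (x.s.total y) = √(∑ W, (m W).1 (y W) ^ 2)

theorem XSharp.exists_orthonormal_bases {P : Parabolic V} (m : ∀ W : P.Index, NormOn (P.gr W)) :
    ∃ b : ∀ W : P.Index, Module.Basis (Fin (Module.finrank ℝ (P.gr W))) ℝ (P.gr W),
      ∀ W, m W = basisNorm (b W) :=
  Classical.axiomOfChoice fun W => (m W).exists_basis

theorem XSharp.rep_scaleBasis (x : XSharp V)
    {b : ∀ W : x.P.Index, Module.Basis (Fin (Module.finrank ℝ (x.P.gr W))) ℝ (x.P.gr W)}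
    (hb : ∀ W, (basisNorm (b W)).cls = x.μ W) {a : x.P.Index → ℝ} (ha : a ∈ x.P.Torus) :
    x.Rep (fun W => (basisNorm (b W)).scale (a W)⁻¹ (inv_pos.2 (ha W)))
      (basisNorm (scaleBasis (x.s.basis b) (fun p => a p.1) fun p => (ha p.1).ne')) :=
  ⟨fun W => by
    rw [← hb]
    exact (NormOn.cls_eq_iff.2 ⟨(a W)⁻¹, inv_pos.2 (ha W), fun y => rfl⟩).symm,
    fun y => x.s.scaleBasis_norm b ha y⟩

theorem XSharp.exists_rep (x : XSharp V) : ∃ m ν, x.Rep m ν := by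
  choose m hm using fun W => (x.μ W).exists_rep
  obtain ⟨b, hb⟩ := XSharp.exists_orthonormal_bases m
  exact ⟨_, _, x.rep_scaleBasis (b := b) (fun W => by rw [← hb, hm]) (a := fun _ => 1)
    fun _ => one_pos⟩

/-- Pythagoras: the section and the preceding step involve disjoint sets of summands. This
characterizes the splitting by orthogonality. -/
theorem XSharp.Rep.orthogonal {x : XSharp V} {m : ∀ W : x.P.Index, NormOn (x.P.gr W)}
    {ν : NormOn (VR V)} (h : x.Rep m ν) {W : x.P.Index} (y : x.P.gr W) {z : VR V}
    (hz : z ∈ x.P.realPred W) :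
    ν.1 ((x.s.map W y : VR V) + z) ^ 2 = ν.1 (x.s.map W y) ^ 2 + ν.1 z ^ 2 := by
  classical
  obtain ⟨y', rfl, hy'⟩ := x.s.exists_total_eq _ (x.P.pred_mem W) z hz
  have hW : y' W = 0 := hy' W fun h => (x.P.pred_isGreatest W).1.2.not_ge h
  have hsq : ∀ y, ν.1 (x.s.total y) ^ 2 = ∑ W, (m W).1 (y W) ^ 2 := fun y => by
    rw [h.2, Real.sq_sqrt (Finset.sum_nonneg fun W _ => sq_nonneg _)]
  rw [← x.s.total_single, ← x.s.totalMap_apply, ← x.s.totalMap_apply, ← map_add,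
    x.s.totalMap_apply, x.s.totalMap_apply, x.s.totalMap_apply, hsq, hsq, hsq,
    ← Finset.sum_add_distrib]
  refine Finset.sum_congr rfl fun U _ => ?_
  rw [Pi.add_apply]
  by_cases hU : U = W
  · subst hU
    rw [hW, NormOn.zero, add_zero]
    ring
  · rw [Pi.single_eq_of_ne hU, NormOn.zero, zero_add]
    ring

theorem XSharp.Rep.apply_section {x : XSharp V} {m : ∀ W : x.P.Index, NormOn (x.P.gr W)}
    {ν : NormOn (VR V)} (h : x.Rep m ν) (W : x.P.Index) (y : x.P.gr W) :
    ν.1 (x.s.map W y) = (m W).1 y := by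
  classical
  rw [← x.s.total_single, h.2, Finset.sum_eq_single W]
  · rw [Pi.single_eq_same, Real.sqrt_sq (NormOn.nonneg _ _)]
  · intro U _ hU
    rw [Pi.single_eq_of_ne hU, NormOn.zero, zero_pow two_ne_zero]
  · simp

theorem Splitting.ext {P : Parabolic V} {s s' : Splitting P}
    (h : ∀ W y, s.map W y = s'.map W y) : s = s' := by
  obtain ⟨f, hf⟩ := s
  obtain ⟨f', hf'⟩ := s'
  have : f = f' := funext fun W => LinearMap.ext (h W)
  subst this
  rfl

/-- A point of `X̄^♯_{ℚ,v}` is determined by its parabolic subgroup and by any of its norms on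
`V_v`. -/
theorem XSharp.Rep.eq {x x' : XSharp V} {m : ∀ W : x.P.Index, NormOn (x.P.gr W)}
    {m' : ∀ W : x'.P.Index, NormOn (x'.P.gr W)} {ν : NormOn (VR V)} (h : x.Rep m ν)
    (h' : x'.Rep m' ν) (hP : x.P = x'.P) : x = x' := by
  obtain ⟨⟨P, μ⟩, s⟩ := x
  obtain ⟨⟨P', μ'⟩, s'⟩ := x'
  change P = P' at hP
  subst hP
  have hs : s = s' := by
    refine Splitting.ext fun W y => ?_
    -- Two lifts of the same class differ by a vector of the preceding step, orthogonal to both.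
    -- Pythagoras in both directions makes each lift at least as long as the other by the squared
    -- length of the difference, which therefore vanishes.
    have hz : (s'.map W y : VR V) - (s.map W y : VR V) ∈ P.realPred W :=
      (Submodule.Quotient.eq ((P.realPred W).submoduleOf (P.real W))).1 ((s'.section_map W y).trans (s.section_map W y).symm)
    have h1 := h.orthogonal (W := W) y hz
    have h2 := h'.orthogonal (W := W) y (Submodule.neg_mem _ hz)
    change ν.1 ((s.map W y : VR V) + _) ^ 2 = ν.1 (s.map W y) ^ 2 + _ at h1
    change ν.1 ((s'.map W y : VR V) + _) ^ 2 = ν.1 (s'.map W y) ^ 2 + _ at h2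
    rw [add_sub_cancel] at h1
    rw [neg_sub, add_sub_cancel] at h2
    have h3 : ν.1 ((s'.map W y : VR V) - s.map W y) = 0 := by
      have := sq_nonneg (ν.1 ((s.map W y : VR V) - s'.map W y))
      have := sq_nonneg (ν.1 ((s'.map W y : VR V) - s.map W y))
      refine pow_eq_zero_iff two_ne_zero |>.1 ?_
      linarith
    exact Subtype.ext (sub_eq_zero.1 (NormOn.eq_zero h3)).symm
  subst hs
  have hμ : μ = μ' := by
    funext W
    have h1 : m W = m' W := NormOn.ext fun y =>
      (h.apply_section W y).symm.trans (h'.apply_section W y)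
    rw [← show (m W).cls = μ W from h.1 W, h1]
    exact h'.1 W
  subst hμ
  rfl

theorem XSharp.Rep.scale {x : XSharp V} {m : ∀ W : x.P.Index, NormOn (x.P.gr W)}
    {ν : NormOn (VR V)} (h : x.Rep m ν) {c : ℝ} (hc : 0 < c) :
    x.Rep (fun W => (m W).scale c hc) (ν.scale c hc) := by
  refine ⟨fun W => ?_, fun y => ?_⟩
  · rw [← h.1]
    exact (NormOn.cls_eq_iff.2 ⟨c, hc, fun y => rfl⟩).symm
  · change c * ν.1 _ = √(∑ W, (c * (m W).1 (y W)) ^ 2)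
    rw [h.2]
    conv_lhs => rw [← Real.sqrt_sq hc.le, ← Real.sqrt_mul (sq_nonneg c), Finset.mul_sum]
    simp only [mul_pow]

theorem XSharp.total_act (x : XSharp V) (h : x.P.stabGL) (y : ∀ W : x.P.Index, x.P.gr W) :
    (x.act h).s.total y = h.1.1 (x.s.total fun W => x.P.grMap h⁻¹ W (y W)) := by
  refine Eq.trans ?_ (map_sum h.1.1 _ _).symm
  rfl

theorem XSharp.Rep.act {x : XSharp V} {m : ∀ W : x.P.Index, NormOn (x.P.gr W)}
    {ν : NormOn (VR V)} (hx : x.Rep m ν) (h : x.P.stabGL) :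
    (x.act h).Rep (fun W => (m W).push (x.P.grEquiv h W)) (ν.push (toEquiv h.1)) := by
  refine ⟨fun W => ?_, fun y => ?_⟩
  · exact congrArg (NormClass.act (x.P.grEquiv h W)) (hx.1 W)
  · refine Eq.trans (congrArg _ (x.total_act h y)) ?_
    change ν.1 ((toEquiv h.1).symm (toEquiv h.1 _)) = _
    rw [LinearEquiv.symm_apply_apply]
    exact hx.2 _

/-! ### The map to the Borel–Serre space: orbits, equivariance, injectivity -/

section Orbits

variable [Nontrivial V]

theorem XSharp.mem_isotropySet {x : XSharp V} {K : MaxCompact V} :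
    K ∈ x.isotropySet ↔ ∃ m ν, x.Rep m ν ∧ K = maxK ν := by
  constructor
  · rintro ⟨m, ν, h1, h2, h3⟩
    exact ⟨m, ν, ⟨h1, h2⟩, isIsotropy_iff.1 h3⟩
  · rintro ⟨m, ν, h, h3⟩
    exact ⟨m, ν, h.1, h.2, isIsotropy_iff.2 h3⟩

theorem Compatible.geodesicOrbit {ι : Type*} [Fintype ι] {f : Module.Basis ι ℝ (VR V)}
    {P : Parabolic V} {w : ι → P.Index} (hf : Compatible f P w) :
    P.geodesicOrbit (maxK (basisNorm f)) = {K | ∃ (a : P.Index → ℝ) (ha : a ∈ P.Torus),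
      K = maxK (basisNorm (scaleBasis f (fun j => a (w j)) fun j => (ha (w j)).ne'))} := by
  ext K
  constructor
  · rintro ⟨a, ha, rfl⟩
    exact ⟨a, ha, hf.geodesicAct ha⟩
  · rintro ⟨a, ha, rfl⟩
    exact ⟨a, ha, (hf.geodesicAct ha).symm⟩

/-- The set of isotropy groups attached to a point of `X̄^♯_{ℚ,v}` is an orbit of the geodesic
action. -/
theorem XSharp.Rep.isotropySet_eq {x : XSharp V} {m : ∀ W : x.P.Index, NormOn (x.P.gr W)}
    {ν : NormOn (VR V)} (hx : x.Rep m ν) : x.isotropySet = x.P.geodesicOrbit (maxK ν) := by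
  obtain ⟨b, hb⟩ := XSharp.exists_orthonormal_bases m
  have hν : ν = basisNorm (x.s.basis b) := NormOn.ext fun z => by
    obtain ⟨y, rfl⟩ := x.s.exists_total z
    rw [hx.2, basisNorm_apply, Fintype.sum_sigma]
    refine congrArg Real.sqrt (Finset.sum_congr rfl fun W _ => ?_)
    rw [hb, basisNorm_sq]
    exact Finset.sum_congr rfl fun i _ => by rw [x.s.basis_repr_total]
  have hcls : ∀ W, (basisNorm (b W)).cls = x.μ W := fun W => by rw [← hb, hx.1]
  rw [hν, (x.s.basis_compatible b).geodesicOrbit]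
  ext K
  rw [XSharp.mem_isotropySet]
  constructor
  · rintro ⟨m', ν', hx', rfl⟩
    have : ∀ W, ∃ c : ℝ, 0 < c ∧ ∀ y, (m' W).1 y = c * (m W).1 y := fun W =>
      NormOn.cls_eq_iff.1 ((hx.1 W).trans (hx'.1 W).symm)
    choose c hc hm' using this
    -- The inverse appears because scaling the basis divides the norm.
    refine ⟨fun W => (c W)⁻¹, fun W => inv_pos.2 (hc W), ?_⟩
    congr 1
    refine NormOn.ext fun z => ?_
    obtain ⟨y, rfl⟩ := x.s.exists_total z
    rw [hx'.2, x.s.scaleBasis_norm b (a := fun W => (c W)⁻¹) fun W => inv_pos.2 (hc W)]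
    refine congrArg Real.sqrt (Finset.sum_congr rfl fun W _ => ?_)
    rw [hm', hb, inv_inv]
  · rintro ⟨a, ha, rfl⟩
    exact ⟨_, _, x.rep_scaleBasis hcls ha, rfl⟩

theorem XSharp.isotropySet_isOrbit (x : XSharp V) :
    ∃ K, x.isotropySet = x.P.geodesicOrbit K := by
  obtain ⟨m, ν, h⟩ := x.exists_rep
  exact ⟨_, h.isotropySet_eq⟩

theorem scaleBasis_map {ι : Type*} [Fintype ι] (f : Module.Basis ι ℝ (VR V)) (r : ι → ℝ)
    (hr : ∀ i, r i ≠ 0) (g : VR V ≃ₗ[ℝ] VR V) :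
    (scaleBasis f r hr).map g = scaleBasis (f.map g) r hr :=
  Module.Basis.eq_of_apply_eq fun j => by
    rw [Module.Basis.map_apply, scaleBasis_apply, scaleBasis_apply, map_smul, Module.Basis.map_apply]

/-- An h respecting the flag carries compatible bases to compatible bases and commutes with
blockwise rescaling, so it conjugates whole orbits. -/
theorem XSharp.isotropySet_act (x : XSharp V) (h : x.P.stabGL) :
    (x.act h).isotropySet = MaxCompact.conj (toPGL h.1) '' x.isotropySet := by
  obtain ⟨m, hm⟩ : ∃ m : ∀ W : x.P.Index, NormOn (x.P.gr W), ∀ W, (m W).cls = x.μ W :=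
    Classical.axiomOfChoice fun W => (x.μ W).exists_rep
  obtain ⟨b, hb⟩ := XSharp.exists_orthonormal_bases m
  have hx := x.rep_scaleBasis (b := b) (fun W => by rw [← hb, hm]) (a := fun _ => 1)
    fun _ => one_pos
  have hcompat := scaleBasis_compatible (x.s.basis_compatible b) (fun p => 1) fun _ => one_ne_zero
  rw [hx.isotropySet_eq, (hx.act h).isotropySet_eq, ← basisNorm_map]
  change x.P.geodesicOrbit _ = _
  rw [(hcompat.map h.2).geodesicOrbit, hcompat.geodesicOrbit]
  ext K
  constructor
  · rintro ⟨a, ha, rfl⟩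
    refine ⟨_, ⟨a, ha, rfl⟩, ?_⟩
    rw [conj_maxK, ← basisNorm_map, scaleBasis_map]
  · rintro ⟨_, ⟨a, ha, rfl⟩, rfl⟩
    refine ⟨a, ha, ?_⟩
    rw [conj_maxK, ← basisNorm_map, scaleBasis_map]

/-- The canonical map from `X̄^♯_{ℚ,v}` to the Borel–Serre space. -/
def XSharp.toBorelSerre (x : XSharp V) : BorelSerre V :=
  ⟨x.P, x.isotropySet, x.isotropySet_isOrbit⟩

theorem BorelSerre.ext {x y : BorelSerre V} (hP : x.P = y.P) (hZ : x.Z = y.Z) : x = y := by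
  obtain ⟨P, Z, h⟩ := x
  obtain ⟨P', Z', h'⟩ := y
  change P = P' at hP
  change Z = Z' at hZ
  subst hP hZ
  rfl

/-- A common member of the two orbits yields one norm, up to scaling, representing both triples, and
`XSharp.Rep.eq` applies. -/
theorem XSharp.toBorelSerre_injective :
    Function.Injective (XSharp.toBorelSerre : XSharp V → BorelSerre V) := by
  intro x x' h
  obtain ⟨m, ν, hx⟩ := x.exists_rep
  have hP : x.P = x'.P := congrArg BorelSerre.P h
  have hZ : x.isotropySet = x'.isotropySet := congrArg BorelSerre.Z h
  have h1 : maxK ν ∈ x'.isotropySet := hZ ▸ XSharp.mem_isotropySet.2 ⟨m, ν, hx, rfl⟩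
  obtain ⟨m', ν', hx', hK⟩ := XSharp.mem_isotropySet.1 h1
  obtain ⟨c, hc, hν⟩ := maxK_eq_iff.1 hK
  have : ν' = ν.scale c hc := NormOn.ext hν
  subst this
  exact (hx.scale hc).eq hx' hP

end Orbits

/-! ### Rational bases adapted to a flag -/

section AdaptedBases

theorem Parabolic.exists_linearIndependent (P : Parabolic V) (k : ℕ)
    (hk : k ≤ Module.finrank ℚ V) : ∃ v : Fin k → V, LinearIndependent ℚ v ∧
      ∀ U ∈ P.carrier, ∀ j : Fin k, (j : ℕ) < Module.finrank ℚ U → v j ∈ U := by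
  induction k with
  | zero => exact ⟨Fin.elim0, linearIndependent_empty_type, fun _ _ j => j.elim0⟩
  | succ k ih =>
    obtain ⟨v, hv, hvU⟩ := ih (by omega)
    -- The next vector is taken in the smallest member of dimension greater than k; k vectors cannot
    -- span it, and every member required to contain the new vector contains this one.
    obtain ⟨U₁, ⟨hU₁, hkU⟩, hmin⟩ := WellFounded.has_min
      (wellFounded_lt : WellFounded ((· < ·) : Submodule ℚ V → Submodule ℚ V → Prop))
      {U | U ∈ P.carrier ∧ k < Module.finrank ℚ U} ⟨⊤, P.top_mem, by rw [finrank_top]; omega⟩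
    have hnot : ¬ U₁ ≤ Submodule.span ℚ (Set.range v) := fun h => by
      have h1 := Submodule.finrank_mono h
      have h2 := finrank_range_le_card (R := ℚ) v
      rw [Fintype.card_fin] at h2
      change Module.finrank ℚ (Submodule.span ℚ (Set.range v)) ≤ k at h2
      omega
    obtain ⟨x, hx, hxv⟩ := SetLike.not_le_iff_exists.1 hnot
    refine ⟨Fin.snoc v x, linearIndependent_finSnoc.2 ⟨hv, hxv⟩, fun U hU j => ?_⟩
    refine Fin.lastCases (fun hj => ?_) (fun j hj => ?_) j
    · rw [Fin.snoc_last]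
      rw [Fin.val_last] at hj
      rcases P.chain.total hU hU₁ with h | h
      · rcases h.lt_or_eq with h' | h'
        · exact absurd h' (hmin U ⟨hU, hj⟩)
        · exact h' ▸ hx
      · exact h hx
    · rw [Fin.snoc_castSucc]
      exact hvU U hU j hj

theorem finrank_coordSub {n : ℕ} (e : Module.Basis (Fin (n + 1)) ℚ V) {c : ℕ} (hc : c ≤ n + 1) :
    Module.finrank ℚ (coordSub e c) = c := by
  have h1 : coordSub e c = Submodule.span ℚ (Set.range (e ∘ Fin.castLE hc)) := by
    rw [coordSub, Set.range_comp]
    congr 2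
    ext j
    constructor
    · intro hj
      exact ⟨⟨j, hj⟩, rfl⟩
    · rintro ⟨i, rfl⟩
      exact i.2
  rw [h1, finrank_span_eq_card (e.linearIndependent.comp _ (Fin.castLE_injective hc)),
    Fintype.card_fin]

theorem Parabolic.exists_adapted [Nontrivial V] (P : Parabolic V) :
    ∃ (n : ℕ) (e : Module.Basis (Fin (n + 1)) ℚ V), Adapted e P := by
  obtain ⟨n, hn⟩ : ∃ n, Module.finrank ℚ V = n + 1 :=
    Nat.exists_eq_succ_of_ne_zero (Module.finrank_pos (R := ℚ) (M := V)).ne'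
  obtain ⟨v, hv, hvU⟩ := P.exists_linearIndependent (n + 1) hn.ge
  let e := basisOfLinearIndependentOfCardEqFinrank hv (by rw [Fintype.card_fin, hn])
  have he : ∀ j, e j = v j := fun j => by simp [e]
  refine ⟨n, e, fun U hU => ?_⟩
  have hle : Module.finrank ℚ U ≤ n + 1 := hn ▸ Submodule.finrank_le U
  refine (Submodule.eq_of_le_of_finrank_eq (Submodule.span_le.2 ?_) (finrank_coordSub e hle)).symm
  rintro _ ⟨j, hj, rfl⟩
  rw [he]
  exact hvU U hU j hj

end AdaptedBases

/-! ### The points attached to a basis and parameters -/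

section StandardPoints

variable {n : ℕ} (e : Module.Basis (Fin (n + 1)) ℚ V) (t : Fin n → ℝ) (ht : ∀ k, 0 ≤ t k)

/-- The splitting given by `e`. -/
def stdSplitting : Splitting (stdParabolic e t) := (stdPoint e t ht).s

theorem stdSplitting_map (W : (stdParabolic e t).Index)
    (j : {j : Fin (n + 1) // e j ∈ W.1 ∧ e j ∉ (stdParabolic e t).pred W}) :
    ((stdSplitting e t ht).map W (stdBasis e t W j) : VR V) = e.baseChange ℝ j.1 := by
  exact congrArg Subtype.val ((stdBasis e t W).constr_basis ℝ _ j)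

-- The blocks partition the index set. Injectivity comes from that of the assembled basis,
-- bijectivity from counting dimensions.
open Classical in
theorem exists_blockEquiv : ∃ σ : (Σ W : (stdParabolic e t).Index,
    {j : Fin (n + 1) // e j ∈ W.1 ∧ e j ∉ (stdParabolic e t).pred W}) ≃ Fin (n + 1),
    (∀ p, σ p = p.2.1) ∧
      (stdSplitting e t ht).basis (stdBasis e t) = (e.baseChange ℝ).reindex σ.symm := by
  let φ : (Σ W : (stdParabolic e t).Index,
    {j : Fin (n + 1) // e j ∈ W.1 ∧ e j ∉ (stdParabolic e t).pred W}) → Fin (n + 1) := fun p => p.2.1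
  have happ : ∀ p, (stdSplitting e t ht).basis (stdBasis e t) p = e.baseChange ℝ (φ p) := fun p => by
    rw [Splitting.basis_apply, stdSplitting_map]
  have hinj : Function.Injective φ := by
    intro p q hpq
    apply ((stdSplitting e t ht).basis (stdBasis e t)).injective
    rw [happ, happ, hpq]
  have hbij : Function.Bijective φ := by
    refine (Fintype.bijective_iff_injective_and_card φ).2 ⟨hinj, ?_⟩
    rw [← Module.finrank_eq_card_basis (e.baseChange ℝ),
      ← Module.finrank_eq_card_basis ((stdSplitting e t ht).basis (stdBasis e t))]
  refine ⟨Equiv.ofBijective φ hbij, fun p => rfl, ?_⟩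
  refine Module.Basis.eq_of_apply_eq fun p => ?_
  rw [happ, Module.Basis.reindex_apply, Equiv.symm_symm]
  rfl

theorem exists_compatible_stdParabolic :
    ∃ w, Compatible (e.baseChange ℝ) (stdParabolic e t) w := by
  classical
  -- The flag depends only on the zero set of t, so absolute values may be used to supply the
  -- nonnegativity needed for the splitting.
  obtain ⟨σ, -, hσ⟩ := exists_blockEquiv e (fun k => |t k|) fun k => abs_nonneg _
  have hP : stdParabolic e (fun k => |t k|) = stdParabolic e t := by
    apply Parabolic.ext
    ext W
    simp [stdParabolic]
  rw [← hP]
  refine ⟨fun j => (σ.symm j).1, fun W => ?_⟩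
  have h := Splitting.basis_compatible (stdSplitting e (fun k => |t k|) fun k => abs_nonneg _)
    (stdBasis e fun k => |t k|)
  have h1 : W.1.baseChange ℝ = _ := h W
  rw [h1, hσ]
  congr 1
  ext x
  constructor
  · rintro ⟨p, hp, rfl⟩
    refine ⟨σ p, ?_, by rw [Module.Basis.reindex_apply, Equiv.symm_symm]⟩
    change (σ.symm (σ p)).1.1 ≤ W.1
    rw [Equiv.symm_apply_apply]
    exact hp
  · rintro ⟨j, hj, rfl⟩
    exact ⟨σ.symm j, hj, by
      rw [Module.Basis.reindex_apply, Equiv.symm_symm, Equiv.apply_symm_apply]⟩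

/-- The point attached to `e` and `t` is represented by the norm on `V_v` with orthonormal basis
`r_j⁻¹ e_j`. -/
theorem stdPoint_rep : ∃ m, (stdPoint e t ht).Rep m (basisNorm (scaleBasis (e.baseChange ℝ)
    (fun j => (stdCoeff t j)⁻¹) fun j => (inv_pos.2 (stdCoeff_pos ht j)).ne')) := by
  classical
  obtain ⟨σ, hσ, hb⟩ := exists_blockEquiv e t ht
  refine ⟨fun W => ⟨_, IsNorm.of_basis (stdBasis e t W) (fun j => stdCoeff t j.1)
    fun j => stdCoeff_pos ht j.1⟩, fun W => ?_, fun y => ?_⟩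
  · exact congrArg NormOn.cls (NormOn.ext fun x => by congr!)
  · change ∀ W : (stdParabolic e t).Index, (stdParabolic e t).gr W at y
    change (basisNorm _).1 ((stdSplitting e t ht).total y) = _
    rw [basisNorm_apply, ← σ.sum_comp, Fintype.sum_sigma]
    refine congrArg Real.sqrt (Finset.sum_congr rfl fun W _ => ?_)
    have h1 : ∀ p, (e.baseChange ℝ).repr ((stdSplitting e t ht).total y) (σ p) =
        (stdBasis e t p.1).repr (y p.1) p.2 := fun p => by
      have h2 := Splitting.basis_repr_total (stdSplitting e t ht) (stdBasis e t) y p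
      rw [hb, Module.Basis.repr_reindex_apply, Equiv.symm_symm] at h2
      exact h2
    rw [Real.sq_sqrt (Finset.sum_nonneg fun i _ => by positivity)]
    refine Finset.sum_congr rfl fun j _ => ?_
    rw [scaleBasis_repr, inv_inv, h1, hσ, mul_pow, sq_abs]

end StandardPoints

/-! ### Comparison of chart coordinates with corner coordinates -/

section Corners

variable {n : ℕ} {e : Module.Basis (Fin (n + 1)) ℚ V} {P : Parabolic V}

theorem finrank_eq_of_basis (e : Module.Basis (Fin (n + 1)) ℚ V) : Module.finrank ℚ V = n + 1 := by
  rw [Module.finrank_eq_card_basis e, Fintype.card_fin]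

/-- The index `k` with `dim V_i = k` (written `k + 1` here) of a member of the flag. -/
def dimIndex (e : Module.Basis (Fin (n + 1)) ℚ V) (U : P.Proper) : Fin n :=
  ⟨Module.finrank ℚ U.1 - 1, by
    have h1 := Submodule.finrank_lt U.2.2.2
    have h2 := finrank_eq_of_basis e
    have h3 : 0 < Module.finrank ℚ U.1 := Nat.pos_of_ne_zero fun h =>
      U.2.2.1 (Submodule.finrank_eq_zero.1 h)
    omega⟩

theorem dimIndex_add_one (e : Module.Basis (Fin (n + 1)) ℚ V) (U : P.Proper) :
    (dimIndex e U : ℕ) + 1 = Module.finrank ℚ U.1 := by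
  have h3 : 0 < Module.finrank ℚ U.1 := Nat.pos_of_ne_zero fun h =>
    U.2.2.1 (Submodule.finrank_eq_zero.1 h)
  simp only [dimIndex]
  omega

theorem dimIndex_injective (hP : Adapted e P) :
    Function.Injective (dimIndex e : P.Proper → Fin n) := by
  intro U U' h
  have h1 := dimIndex_add_one e U
  rw [h, dimIndex_add_one] at h1
  refine Subtype.ext ?_
  rw [hP U.1 U.2.1, hP U'.1 U'.2.1, h1]

theorem mem_orthant_iff {t : Fin n → ℝ} : t ∈ orthant n P ↔
    (∀ k, 0 ≤ t k) ∧ ∀ k, k ∉ Set.range (dimIndex e : P.Proper → Fin n) → 0 < t k := by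
  refine and_congr_right fun _ => forall_congr' fun k => imp_congr_left ?_
  constructor
  · rintro h ⟨U, rfl⟩
    exact h U (dimIndex_add_one e U).symm
  · intro h U hU
    refine h ⟨U, Fin.ext ?_⟩
    have := dimIndex_add_one e U
    omega

theorem faceOf_eq_stdParabolic (hP : Adapted e P) {t : Fin n → ℝ} (ht : t ∈ orthant n P) :
    P.faceOf (fun U => t (dimIndex e U)) = stdParabolic e t := by
  apply Parabolic.ext
  ext W
  refine or_congr_right (or_congr_right ⟨?_, ?_⟩)
  · rintro ⟨U, hU, rfl⟩
    exact ⟨dimIndex e U, hU, by rw [dimIndex_add_one]; exact hP U.1 U.2.1⟩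
  · rintro ⟨k, hk, rfl⟩
    by_cases h : k ∈ Set.range (dimIndex e : P.Proper → Fin n)
    · obtain ⟨U, rfl⟩ := h
      exact ⟨U, hk, by rw [dimIndex_add_one]; exact (hP U.1 U.2.1).symm⟩
    · exact absurd hk ((mem_orthant_iff (e := e)).1 ht |>.2 k h).ne'

theorem faceOf_zero : P.faceOf (fun _ => 0) = P := by
  apply Parabolic.ext
  ext W
  constructor
  · rintro (rfl | rfl | ⟨U, -, rfl⟩)
    exacts [P.bot_mem, P.top_mem, U.2.1]
  · intro hW
    by_cases h1 : W = ⊥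
    · exact Or.inl h1
    by_cases h2 : W = ⊤
    · exact Or.inr (Or.inl h2)
    exact Or.inr (Or.inr ⟨⟨W, hW, h1, h2⟩, rfl, rfl⟩)

open Classical in
/-- The element of the orthant whose coordinates are those of `τ` at the dimensions of the members of
the flag, and those of `t` elsewhere. -/
def extendCoord (e : Module.Basis (Fin (n + 1)) ℚ V) (τ : P.Proper → ℝ) (t : Fin n → ℝ)
    (k : Fin n) : ℝ :=
  if h : ∃ U : P.Proper, dimIndex e U = k then τ h.choose else t k

theorem extendCoord_dimIndex (hP : Adapted e P) (τ : P.Proper → ℝ) (t : Fin n → ℝ)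
    (U : P.Proper) : extendCoord e τ t (dimIndex e U) = τ U := by
  have h : ∃ U' : P.Proper, dimIndex e U' = dimIndex e U := ⟨U, rfl⟩
  rw [extendCoord, dif_pos h]
  exact congrArg τ (dimIndex_injective hP h.choose_spec)

theorem extendCoord_of_notMem {τ : P.Proper → ℝ} {t : Fin n → ℝ} {k : Fin n}
    (hk : k ∉ Set.range (dimIndex e : P.Proper → Fin n)) : extendCoord e τ t k = t k :=
  dif_neg hk

theorem extendCoord_mem_orthant (hP : Adapted e P) {τ : P.Proper → ℝ} (hτ : τ ∈ P.TorusBar)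
    {t : Fin n → ℝ} (ht : t ∈ orthant n P) : extendCoord e τ t ∈ orthant n P := by
  rw [mem_orthant_iff (e := e)] at ht ⊢
  refine ⟨fun k => ?_, fun k hk => ?_⟩
  · by_cases hk : k ∈ Set.range (dimIndex e : P.Proper → Fin n)
    · obtain ⟨U, rfl⟩ := hk
      rw [extendCoord_dimIndex hP]
      exact hτ U
    · rw [extendCoord_of_notMem hk]
      exact ht.1 k
  · rw [extendCoord_of_notMem hk]
    exact ht.2 k hk

theorem extendCoord_one_pos (hP : Adapted e P) {t : Fin n → ℝ} (ht : t ∈ orthant n P) (k : Fin n) :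
    0 < extendCoord e (fun _ : P.Proper => (1 : ℝ)) t k := by
  by_cases hk : k ∈ Set.range (dimIndex e : P.Proper → Fin n)
  · obtain ⟨U, rfl⟩ := hk
    rw [extendCoord_dimIndex hP]
    exact one_pos
  · rw [extendCoord_of_notMem hk]
    exact (mem_orthant_iff (e := e)).1 ht |>.2 k hk

theorem exists_compatible (hP : Adapted e P) :
    ∃ w : Fin (n + 1) → P.Index, Compatible (e.baseChange ℝ) P w ∧
      ∀ (U : P.Proper) (j : Fin (n + 1)), U.1 < (w j).1 ↔ (dimIndex e U : ℕ) < j := by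
  -- With 0 at the dimensions of the flag and 1 elsewhere, the standard parabolic is P itself, so
  -- the results on standard points apply to P.
  have h0 : extendCoord e (fun _ : P.Proper => (0 : ℝ)) (fun _ => 1) ∈ orthant n P :=
    extendCoord_mem_orthant hP (fun _ => le_rfl) ⟨fun _ => zero_le_one, fun _ _ => one_pos⟩
  have h1 := faceOf_eq_stdParabolic hP h0
  simp only [extendCoord_dimIndex hP] at h1
  rw [faceOf_zero] at h1
  have h2 := exists_compatible_stdParabolic e
    (extendCoord e (fun _ : P.Proper => (0 : ℝ)) (fun _ => 1))
  rw [← h1] at h2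
  obtain ⟨w, hw⟩ := h2
  refine ⟨w, hw, fun U j => ?_⟩
  have h3 : e.baseChange ℝ j ∈ U.1.baseChange ℝ ↔ (w j).1 ≤ U.1 := by
    rw [hw.mem_baseChange U.2.1]
    constructor
    · intro h
      by_contra h4
      simpa using h j h4
    · intro h i hi
      have : i ≠ j := by rintro rfl; exact hi h
      rw [Module.Basis.repr_self, Finsupp.single_eq_of_ne this]
  have h5 : e.baseChange ℝ j ∈ U.1.baseChange ℝ ↔ (j : ℕ) < Module.finrank ℚ U.1 := by
    have h6 : U.1.baseChange ℝ =
        Submodule.span ℝ (e.baseChange ℝ '' {j | (j : ℕ) < Module.finrank ℚ U.1}) := by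
      conv_lhs => rw [hP U.1 U.2.1, coordSub, Submodule.baseChange_span]
      congr 1
      ext x
      simp [Set.mem_image]
    rw [h6, Module.Basis.mem_span_image, Module.Basis.repr_self,
      Finsupp.support_single j one_ne_zero]
    simp
  have h7 : U.1 < (w j).1 ↔ ¬ (w j).1 ≤ U.1 := by
    constructor
    · exact fun h => h.not_ge
    · intro h
      rcases P.chain.total U.2.1 (w j).2.1 with h' | h'
      · exact lt_of_le_not_ge h' h
      · exact absurd h' h
  rw [h7, ← h3, h5, ← dimIndex_add_one e U]
  omega

theorem torusOf_mem {τ : P.Proper → ℝ} (hτ : τ ∈ P.TorusBar) : P.torusOf τ ∈ P.Torus := by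
  classical
  intro W
  refine Finset.prod_pos fun U hU => ?_
  exact lt_of_le_of_ne (hτ U) (Ne.symm (Finset.mem_filter.1 hU).2.2)

/-- The product of the nonzero t_k with k < j splits into the k that are dimensions of members of
the flag, which give the torus element, and the others, which remain after the former are replaced
by 1. -/
theorem torusOf_mul_stdCoeff (hP : Adapted e P) (t : Fin n → ℝ)
    {W : P.Index} {j : Fin (n + 1)} (hj : ∀ U : P.Proper, U.1 < W.1 ↔ (dimIndex e U : ℕ) < j) :
    P.torusOf (fun U => t (dimIndex e U)) W *
      (stdCoeff (extendCoord e (fun _ : P.Proper => (1 : ℝ)) t) j)⁻¹ = (stdCoeff t j)⁻¹ := by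
  classical
  rw [stdCoeff, stdCoeff, ← Finset.prod_inv_distrib, ← Finset.prod_inv_distrib,
    Parabolic.torusOf, Finset.prod_filter, Finset.prod_filter, Finset.prod_filter]
  simp only [inv_inv]
  let c : Fin n → ℝ := fun k => if k.val < j.val ∧ t k ≠ 0 then t k else 1
  let b : Fin n → ℝ := fun k => if k ∈ Set.range (dimIndex e : P.Proper → Fin n) then c k else 1
  have h1 : (∏ U : P.Proper, if U.1 < W.1 ∧ t (dimIndex e U) ≠ 0 then t (dimIndex e U) else 1) =
      ∏ k, b k := by
    refine Fintype.prod_of_injective (dimIndex e) (dimIndex_injective hP) _ _ ?_ ?_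
    · intro k hk
      exact if_neg hk
    · intro U
      simp only [b, c, Set.mem_range_self, if_true, hj]
  have h2 : (∏ U : P.Proper, if U.1 < W.1 ∧ t (dimIndex e U) ≠ 0 then t (dimIndex e U) else 1) *
      (∏ k : Fin n, if k.val < j.val ∧ extendCoord e (fun _ : P.Proper => (1 : ℝ)) t k ≠ 0 then
        extendCoord e (fun _ : P.Proper => (1 : ℝ)) t k else 1) = ∏ k, c k := by
    rw [h1, ← Finset.prod_mul_distrib]
    refine Finset.prod_congr rfl fun k _ => ?_
    by_cases hk : k ∈ Set.range (dimIndex e : P.Proper → Fin n)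
    · simp only [b, if_pos hk]
      obtain ⟨U, rfl⟩ := hk
      simp [extendCoord_dimIndex hP]
    · simp only [b, if_neg hk, one_mul, extendCoord_of_notMem hk]
      rfl
  convert h2

variable [Nontrivial V]

/-- The maximal compact subgroup in the corner which corresponds to a point of the chart. -/
theorem corner_eq (hP : Adapted e P) (x : P.realPoints × orthant n P)
    (hτ : (fun U => x.2.1 (dimIndex e U)) ∈ P.TorusBar) :
    P.corner (⟨fun U => x.2.1 (dimIndex e U), hτ⟩, maxK ((basisNorm (scaleBasis (e.baseChange ℝ)
      (fun j => (stdCoeff (extendCoord e (fun _ : P.Proper => (1 : ℝ)) x.2.1) j)⁻¹) fun j =>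
        (inv_pos.2 (stdCoeff_pos (fun k => (extendCoord_one_pos hP x.2.2 k).le) j)).ne')).push
          (toEquiv (P.lift x.1).1))) = (chartSharp e P hP x).toBorelSerre := by
  obtain ⟨w, hw, hwj⟩ := exists_compatible hP
  obtain ⟨m, hm⟩ := stdPoint_rep e x.2.1 x.2.2.1
  have hface := faceOf_eq_stdParabolic hP x.2.2
  have hrep := hm.act ⟨(P.lift x.1).1, fun W hW =>
    (P.lift x.1).2 W (stdParabolic_subset e hP x.2.2 hW)⟩
  have hZ : (chartSharp e P hP x).isotropySet = (stdParabolic e x.2.1).geodesicOrbit _ :=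
    hrep.isotropySet_eq
  refine BorelSerre.ext hface ?_
  refine Eq.trans ?_ hZ.symm
  change (P.faceOf fun U => x.2.1 (dimIndex e U)).geodesicOrbit _ = _
  rw [hface]
  congr 1
  -- The translate by P(ℝ) of a rescaled adapted basis is still compatible with P, so the torus
  -- element just rescales it.
  have hcompat := (scaleBasis_compatible hw _ fun j => (inv_pos.2 (stdCoeff_pos
    (fun k => (extendCoord_one_pos hP x.2.2 k).le) j)).ne').map (P.lift x.1).2
  rw [← basisNorm_map]
  refine (hcompat.geodesicAct (torusOf_mem hτ)).trans ?_
  rw [← basisNorm_map]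
  congr 2
  refine Module.Basis.eq_of_apply_eq fun j => ?_
  rw [scaleBasis_apply, Module.Basis.map_apply, Module.Basis.map_apply, scaleBasis_apply,
    scaleBasis_apply, ← torusOf_mul_stdCoeff hP x.2.1 fun U => hwj U j, mul_smul,
    map_smul (toEquiv (P.lift x.1).1) (P.torusOf _ _)]

end Corners

/-! ### Maximal compact subgroups as a homogeneous space -/

section HomogeneousSpace

theorem MaxCompact.conj_mul (g g' : PGLR V) (K : MaxCompact V) :
    MaxCompact.conj (g * g') K = MaxCompact.conj g (MaxCompact.conj g' K) := by
  refine Subtype.ext ?_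
  change K.1.map _ = (K.1.map _).map _
  rw [Subgroup.map_map]
  congr 1
  ext x
  simp [mul_assoc]

variable [Nontrivial V]

theorem NormOn.exists_push {ι : Type*} [Fintype ι] (f : Module.Basis ι ℝ (VR V))
    (ν : NormOn (VR V)) : ∃ h : GLR V, ν = basisNorm (f.map (toEquiv h)) := by
  obtain ⟨f', rfl⟩ := ν.exists_basis
  let σ : Fin (Module.finrank ℝ (VR V)) ≃ ι := Fintype.equivOfCardEq (by
    rw [Fintype.card_fin, Module.finrank_eq_card_basis f])
  refine ⟨ofEquiv (f.equiv (f'.reindex σ) (Equiv.refl ι)), ?_⟩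
  have : f.map (toEquiv (ofEquiv (f.equiv (f'.reindex σ) (Equiv.refl ι)))) = f'.reindex σ :=
    Module.Basis.eq_of_apply_eq fun j => by
      rw [Module.Basis.map_apply, toEquiv_apply, ofEquiv_apply, Module.Basis.equiv_apply,
        Equiv.refl_apply]
  rw [this, basisNorm_reindex]

theorem MaxCompact.exists_conj (K₀ K : MaxCompact V) : ∃ g, K = MaxCompact.conj g K₀ := by
  obtain ⟨ν₀, rfl⟩ := exists_maxK K₀
  obtain ⟨ν, rfl⟩ := exists_maxK K
  obtain ⟨f, rfl⟩ := ν₀.exists_basis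
  obtain ⟨h, rfl⟩ := ν.exists_push f
  exact ⟨toPGL h, by rw [conj_maxK, basisNorm_map]⟩

/-- By transitivity the orbit maps for different base points differ by right translations, so one
base point already defines the topology. -/
theorem MaxCompact.isOpenQuotientMap_conj (K₀ : MaxCompact V) :
    IsOpenQuotientMap fun g : PGLR V => MaxCompact.conj g K₀ := by
  have hopen : ∀ U : Set (MaxCompact V),
      IsOpen ((fun g : PGLR V => MaxCompact.conj g K₀) ⁻¹' U) → IsOpen U := by
    intro U hU
    refine isOpen_iSup_iff.2 fun K => isOpen_coinduced.2 ?_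
    obtain ⟨g₁, rfl⟩ := MaxCompact.exists_conj K₀ K
    have : (fun g : PGLR V => MaxCompact.conj g (MaxCompact.conj g₁ K₀)) ⁻¹' U =
        (fun g => g * g₁) ⁻¹' ((fun g : PGLR V => MaxCompact.conj g K₀) ⁻¹' U) := by
      ext g
      simp only [Set.mem_preimage, MaxCompact.conj_mul]
    rw [this]
    exact hU.preimage (continuous_mul_const g₁)
  refine ⟨fun K => ?_, ?_, fun S hS => hopen _ ?_⟩
  · obtain ⟨g, rfl⟩ := MaxCompact.exists_conj K₀ K
    exact ⟨g, rfl⟩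
  · exact continuous_iff_coinduced_le.2 (le_iSup (fun K : MaxCompact V =>
      TopologicalSpace.coinduced (fun g : PGLR V => MaxCompact.conj g K) inferInstance) K₀)
  -- The saturation of an open set is the union of its right translates by the stabilizer, hence
  -- open.
  · have : (fun g : PGLR V => MaxCompact.conj g K₀) ⁻¹'
        ((fun g : PGLR V => MaxCompact.conj g K₀) '' S) =
        ⋃ k ∈ {k : PGLR V | MaxCompact.conj k K₀ = K₀}, (fun g => g * k) ⁻¹' S := by
      ext g
      simp only [Set.mem_preimage, Set.mem_image, Set.mem_iUnion]
      constructor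
      · rintro ⟨s, hs, hsg⟩
        refine ⟨g⁻¹ * s, ?_, by simpa using hs⟩
        change MaxCompact.conj (g⁻¹ * s) K₀ = K₀
        rw [MaxCompact.conj_mul, hsg, ← MaxCompact.conj_mul, inv_mul_cancel]
        refine Subtype.ext (Subgroup.ext fun x => ?_)
        change x ∈ K₀.1.map _ ↔ _
        simp
      · rintro ⟨k, hk, hgk⟩
        exact ⟨g * k, hgk, by rw [MaxCompact.conj_mul, show MaxCompact.conj k K₀ = K₀ from hk]⟩
    rw [this]
    exact isOpen_biUnion fun k _ => hS.preimage (continuous_mul_const k)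

end HomogeneousSpace

/-! ### Continuous Iwasawa decomposition by Gram–Schmidt -/

section GramSchmidt

open InnerProductSpace

/-- Induction on the recursive formula; linear independence keeps the denominators nonzero. -/
theorem continuous_gramSchmidt {X : Type*} [TopologicalSpace X] {F : Type*} [NormedAddCommGroup F]
    [InnerProductSpace ℝ F] {n : ℕ} {u : X → Fin n → F} (hu : ∀ j, Continuous fun x => u x j)
    (hli : ∀ x, LinearIndependent ℝ (u x)) (j : Fin n) :
    Continuous fun x => gramSchmidt ℝ (u x) j := by
  induction j using WellFoundedLT.induction with
  | ind j ih =>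
    have h : (fun x => gramSchmidt ℝ (u x) j) = fun x => u x j - ∑ i ∈ Finset.Iio j,
        (inner ℝ (gramSchmidt ℝ (u x) i) (u x j) / ‖gramSchmidt ℝ (u x) i‖ ^ 2) •
          gramSchmidt ℝ (u x) i := by
      funext x
      have := gramSchmidt_def'' ℝ (u x) j
      exact eq_sub_of_add_eq this.symm
    rw [h]
    refine (hu j).sub (continuous_finsetSum _ fun i hi => ?_)
    have hi' := ih i (Finset.mem_Iio.1 hi)
    refine (((hi'.inner (hu j)).div (hi'.norm.pow 2) fun x => ?_)).smul hi'
    exact pow_ne_zero 2 (norm_ne_zero_iff.2 (gramSchmidt_ne_zero i (hli x)))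

theorem continuous_gramSchmidtNormed {X : Type*} [TopologicalSpace X] {F : Type*}
    [NormedAddCommGroup F] [InnerProductSpace ℝ F] {n : ℕ} {u : X → Fin n → F}
    (hu : ∀ j, Continuous fun x => u x j) (hli : ∀ x, LinearIndependent ℝ (u x)) (j : Fin n) :
    Continuous fun x => gramSchmidtNormed ℝ (u x) j := by
  have h := continuous_gramSchmidt hu hli j
  exact (h.norm.inv₀ fun x => norm_ne_zero_iff.2 (gramSchmidt_ne_zero j (hli x))).smul h

variable {n : ℕ} (E : Module.Basis (Fin (n + 1)) ℝ (VR V))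

/-- Coordinates in the basis `E`. -/
def euclideanCoord : VR V ≃ₗ[ℝ] EuclideanSpace ℝ (Fin (n + 1)) :=
  E.equivFun.trans (WithLp.linearEquiv 2 ℝ _).symm

theorem euclideanCoord_apply (x : VR V) (i : Fin (n + 1)) :
    euclideanCoord E x i = E.repr x i := rfl

/-- The coordinate vectors of `h⁻¹ E_j`. -/
def inverseColumns (h : GLR V) (j : Fin (n + 1)) : EuclideanSpace ℝ (Fin (n + 1)) :=
  euclideanCoord E ((h⁻¹).1 (E j))

theorem continuous_inverseColumns (j : Fin (n + 1)) :
    Continuous fun h => inverseColumns E h j := by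
  refine (PiLp.continuous_toLp 2 _).comp (continuous_pi fun i => ?_)
  exact (continuous_repr_apply E (E j) i).comp (Units.continuous_val.comp continuous_inv)

theorem linearIndependent_inverseColumns (h : GLR V) :
    LinearIndependent ℝ (inverseColumns E h) :=
  E.linearIndependent.map' ((toEquiv h).symm.trans (euclideanCoord E)).toLinearMap
    (LinearEquiv.ker _)

/-- The orthogonal matrix whose columns are obtained by orthonormalization from the coordinate
vectors of the `h⁻¹ E_j`. -/
def gramSchmidtGL (h : GLR V) : GL (Fin (n + 1)) ℝ :=
  let A : Matrix (Fin (n + 1)) (Fin (n + 1)) ℝ :=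
    Matrix.of fun i j => gramSchmidtNormed ℝ (inverseColumns E h) j i
  have hA : A.transpose * A = 1 := by
    have ho := gramSchmidtNormed_orthonormal (𝕜 := ℝ) (linearIndependent_inverseColumns E h)
    rw [orthonormal_iff_ite] at ho
    ext i j
    rw [Matrix.one_apply, ← ho i j, Matrix.mul_apply, PiLp.inner_apply]
    refine Finset.sum_congr rfl fun k _ => ?_
    simp [A, mul_comm]
  ⟨A, A.transpose, mul_eq_one_comm.1 hA, hA⟩

theorem gramSchmidtGL_apply (h : GLR V) (i j : Fin (n + 1)) :
    (gramSchmidtGL E h).1 i j = gramSchmidtNormed ℝ (inverseColumns E h) j i := rfl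

theorem gramSchmidtGL_orthogonal (h : GLR V) :
    (gramSchmidtGL E h).1.transpose * (gramSchmidtGL E h).1 = 1 :=
  (gramSchmidtGL E h).inv_mul

theorem continuous_gramSchmidtGL : Continuous (gramSchmidtGL E) := by
  have h1 : Continuous fun h => (gramSchmidtGL E h).1 := by
    refine continuous_matrix fun i j => ?_
    exact (EuclideanSpace.proj (𝕜 := ℝ) i).continuous.comp (continuous_gramSchmidtNormed
      (continuous_inverseColumns E) (linearIndependent_inverseColumns E) j)
  exact Units.continuous_iff.2 ⟨h1, h1.matrix_transpose⟩

/-- The triangular part of `h` in the Iwasawa decomposition for the basis `E`. -/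
def iwasawa (h : GLR V) : GLR V := h * (matEquiv E).symm (gramSchmidtGL E h)

theorem continuous_iwasawa : Continuous (iwasawa E) :=
  continuous_id.mul ((continuous_matEquiv_symm E).comp (continuous_gramSchmidtGL E))

theorem iwasawa_apply_basis (h : GLR V) (j : Fin (n + 1)) : (iwasawa E h).1 (E j) =
    ((euclideanCoord E).symm.trans (toEquiv h)) (gramSchmidtNormed ℝ (inverseColumns E h) j) := by
  rw [iwasawa, Units.val_mul, Module.End.mul_apply, LinearEquiv.trans_apply, toEquiv_apply]
  congr 1
  apply (euclideanCoord E).injective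
  rw [LinearEquiv.apply_symm_apply]
  ext i
  rw [euclideanCoord_apply, ← matEquiv_apply, MulEquiv.apply_symm_apply, gramSchmidtGL_apply]

theorem apply_inverseColumns (h : GLR V) (j : Fin (n + 1)) :
    ((euclideanCoord E).symm.trans (toEquiv h)) (inverseColumns E h j) = E j := by
  rw [inverseColumns, LinearEquiv.trans_apply, LinearEquiv.symm_apply_apply]
  exact (toEquiv h).apply_symm_apply _

/-- The coordinate vectors of h⁻¹ E_j are sent by h to E_j, and their orthonormalizations to the
images of the E_j under the triangular part. Gram–Schmidt preserves initial spans, which is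
triangularity; this is why h⁻¹, not h, is orthonormalized. -/
theorem span_iwasawa (h : GLR V) (j : Fin (n + 1)) :
    Submodule.span ℝ ((fun i => (iwasawa E h).1 (E i)) '' Set.Iic j) =
      Submodule.span ℝ (E '' Set.Iic j) := by
  let Λ := (euclideanCoord E).symm.trans (toEquiv h)
  have h1 : (fun i => (iwasawa E h).1 (E i)) '' Set.Iic j =
      Λ.toLinearMap '' (gramSchmidtNormed ℝ (inverseColumns E h) '' Set.Iic j) := by
    rw [Set.image_image]
    exact Set.image_congr fun i _ => iwasawa_apply_basis E h i
  have h2 : E '' Set.Iic j = Λ.toLinearMap '' (inverseColumns E h '' Set.Iic j) := by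
    rw [Set.image_image]
    exact Set.image_congr fun i _ => (apply_inverseColumns E h i).symm
  rw [h1, h2, ← Submodule.map_span, ← Submodule.map_span, span_gramSchmidtNormed,
    span_gramSchmidt_Iic]

theorem iwasawa_apply_mem (h : GLR V) {c : ℕ} {x : VR V}
    (hx : x ∈ Submodule.span ℝ (E '' {j | (j : ℕ) < c})) :
    (iwasawa E h).1 x ∈ Submodule.span ℝ (E '' {j | (j : ℕ) < c}) ∧
      ((iwasawa E h)⁻¹).1 x ∈ Submodule.span ℝ (E '' {j | (j : ℕ) < c}) := by
  have hsub : ∀ j : Fin (n + 1), (j : ℕ) < c → Set.Iic j ⊆ {j : Fin (n + 1) | (j : ℕ) < c} :=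
    fun j hj i hi => lt_of_le_of_lt (Fin.le_def.1 hi) hj
  constructor
  · revert x
    change Submodule.span ℝ (E '' {j | (j : ℕ) < c}) ≤
      (Submodule.span ℝ (E '' {j | (j : ℕ) < c})).comap (iwasawa E h).1
    refine Submodule.span_le.2 ?_
    rintro _ ⟨j, hj, rfl⟩
    refine Submodule.span_mono (Set.image_mono (hsub j hj)) ?_
    rw [← span_iwasawa E h j]
    exact Submodule.subset_span ⟨j, Set.mem_Iic.2 le_rfl, rfl⟩
  · revert x
    change Submodule.span ℝ (E '' {j | (j : ℕ) < c}) ≤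
      (Submodule.span ℝ (E '' {j | (j : ℕ) < c})).comap ((iwasawa E h)⁻¹).1
    refine Submodule.span_le.2 ?_
    rintro _ ⟨j, hj, rfl⟩
    have h1 : E j ∈ Submodule.span ℝ (E '' Set.Iic j) :=
      Submodule.subset_span ⟨j, Set.mem_Iic.2 le_rfl, rfl⟩
    rw [← span_iwasawa E h j] at h1
    have h2 : (fun i => (iwasawa E h).1 (E i)) '' Set.Iic j =
        (iwasawa E h).1 '' (E '' Set.Iic j) := by rw [Set.image_image]
    rw [h2, ← Submodule.map_span] at h1
    obtain ⟨y, hy, hyj⟩ := h1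
    have h3 : ((iwasawa E h)⁻¹).1 (E j) = y := by
      rw [← hyj]
      exact (toEquiv (iwasawa E h)).symm_apply_apply y
    rw [SetLike.mem_coe, Submodule.mem_comap, h3]
    exact Submodule.span_mono (Set.image_mono (hsub j hj)) hy

theorem iwasawa_mem_stabGL {e : Module.Basis (Fin (n + 1)) ℚ V} {P : Parabolic V}
    (hP : Adapted e P) (h : GLR V) : iwasawa (e.baseChange ℝ) h ∈ P.stabGL := by
  intro W hW x hx
  have h6 : W.baseChange ℝ =
      Submodule.span ℝ (e.baseChange ℝ '' {j | (j : ℕ) < Module.finrank ℚ W}) := by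
    conv_lhs => rw [hP W hW, coordSub, Submodule.baseChange_span]
    congr 1
    ext x
    simp [Set.mem_image]
  rw [h6] at hx ⊢
  exact iwasawa_apply_mem _ h hx

variable [Nontrivial V]

/-- The two elements differ on the right by an orthogonal matrix, which stabilizes the base point.
Hence P(ℝ) acts transitively, with a continuous choice of translating element. -/
theorem conj_iwasawa (h : GLR V) : MaxCompact.conj (toPGL (iwasawa E h)) (maxK (basisNorm E)) =
    MaxCompact.conj (toPGL h) (maxK (basisNorm E)) := by
  rw [iwasawa, map_mul, MaxCompact.conj_mul]
  congr 1
  have hk : toPGL ((matEquiv E).symm (gramSchmidtGL E h)) ∈ isotropySubgroup (basisNorm E) :=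
    (matPGL_mem_isotropySubgroup E).2 ⟨1, by rw [gramSchmidtGL_orthogonal, one_smul]⟩
  obtain ⟨c, hc, hk⟩ := toPGL_mem_isotropySubgroup.1 hk
  rw [conj_maxK]
  exact (maxK_eq_iff.2 ⟨c, hc, hk⟩).symm

/-- The triangular part in the Iwasawa decomposition, as an element of `P(ℝ)`. -/
def iwasawaPoint {e : Module.Basis (Fin (n + 1)) ℚ V} {P : Parabolic V} (hP : Adapted e P)
    (h : GLR V) : P.realPoints :=
  ⟨toPGL (iwasawa (e.baseChange ℝ) h), ⟨_, iwasawa_mem_stabGL hP h, rfl⟩⟩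

theorem continuous_iwasawaPoint {e : Module.Basis (Fin (n + 1)) ℚ V} {P : Parabolic V}
    (hP : Adapted e P) : Continuous (iwasawaPoint hP) :=
  (continuous_toPGL.comp (continuous_iwasawa _)).subtype_mk _

end GramSchmidt

/-! ### The homeomorphism onto the Borel–Serre space -/

section Charts

theorem continuous_chartSharp {n : ℕ} (e : Module.Basis (Fin (n + 1)) ℚ V) (P : Parabolic V)
    (hP : Adapted e P) : Continuous (chartSharp e P hP) := by
  refine continuous_iff_coinduced_le.2 ?_
  exact le_iSup_of_le n (le_iSup_of_le e (le_iSup_of_le P (le_iSup_of_le hP le_rfl)))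

theorem continuous_chartBar {n : ℕ} (e : Module.Basis (Fin (n + 1)) ℚ V) (P : Parabolic V)
    (hP : Adapted e P) : Continuous (chartBar e P hP) := by
  refine continuous_iff_coinduced_le.2 ?_
  exact le_iSup_of_le n (le_iSup_of_le e (le_iSup_of_le P (le_iSup_of_le hP le_rfl)))

theorem XSharp.continuous_iff {X : Type*} [TopologicalSpace X] {φ : XSharp V → X} :
    Continuous φ ↔ ∀ (n : ℕ) (e : Module.Basis (Fin (n + 1)) ℚ V) (P : Parabolic V)
      (hP : Adapted e P), Continuous (φ ∘ chartSharp e P hP) := by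
  refine ⟨fun h n e P hP => h.comp (continuous_chartSharp e P hP), fun h => ?_⟩
  refine continuous_iSup_dom.2 fun n => continuous_iSup_dom.2 fun e => continuous_iSup_dom.2
    fun P => continuous_iSup_dom.2 fun hP => continuous_coinduced_dom.2 (h n e P hP)

theorem XBar.continuous_iff {X : Type*} [TopologicalSpace X] {φ : XBar V → X} :
    Continuous φ ↔ ∀ (n : ℕ) (e : Module.Basis (Fin (n + 1)) ℚ V) (P : Parabolic V)
      (hP : Adapted e P), Continuous (φ ∘ chartBar e P hP) := by
  refine ⟨fun h n e P hP => h.comp (continuous_chartBar e P hP), fun h => ?_⟩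
  refine continuous_iSup_dom.2 fun n => continuous_iSup_dom.2 fun e => continuous_iSup_dom.2
    fun P => continuous_iSup_dom.2 fun hP => continuous_coinduced_dom.2 (h n e P hP)

theorem XSharp.continuous_toXBar : Continuous (XSharp.toXBar : XSharp V → XBar V) :=
  XSharp.continuous_iff.2 fun _ e P hP => continuous_chartBar e P hP

theorem Parabolic.continuous_corner (P : Parabolic V) : Continuous P.corner := by
  refine continuous_iff_coinduced_le.2 ?_
  exact le_iSup (fun P : Parabolic V => TopologicalSpace.coinduced P.corner inferInstance) P

variable {n : ℕ} {e : Module.Basis (Fin (n + 1)) ℚ V} {P : Parabolic V}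

theorem continuous_extendCoord (k : Fin n) : Continuous fun x : (P.Proper → ℝ) × (Fin n → ℝ) =>
    extendCoord e x.1 x.2 k := by
  unfold extendCoord
  split_ifs with h
  · exact (continuous_apply _).comp continuous_fst
  · exact (continuous_apply _).comp continuous_snd

theorem stdCoeff_eq_prod {t : Fin n → ℝ} (ht : ∀ k, t k ≠ 0) (j : Fin (n + 1)) :
    stdCoeff t j = ∏ k : Fin n with k.val < j.val, (t k)⁻¹ := by
  classical
  rw [stdCoeff]
  refine Finset.prod_congr ?_ fun _ _ => rfl
  ext k
  simp [ht k]

variable [Nontrivial V]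

theorem maxK_push_lift (g : P.realPoints) (ν : NormOn (VR V)) :
    maxK (ν.push (toEquiv (P.lift g).1)) = MaxCompact.conj g.1 (maxK ν) := by
  rw [← conj_maxK, P.toPGL_lift]

theorem scaleGL_eq {ι : Type*} [Fintype ι] [DecidableEq ι] (f : Module.Basis ι ℝ (VR V))
    (r : ι → ℝ) (hr : ∀ i, r i ≠ 0) : scaleGL f r hr = (matEquiv f).symm (diagGL r hr) := by
  apply (matEquiv f).injective
  rw [MulEquiv.apply_symm_apply]
  ext i j
  rw [matEquiv_apply, scaleGL_repr, f.repr_self, diagGL_val, Matrix.diagonal_apply,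
    Finsupp.single_apply]
  by_cases h : i = j
  · subst h; simp
  · simp [h, Ne.symm h]

theorem continuous_scaleGL {ι X : Type*} [Fintype ι] [TopologicalSpace X]
    (f : Module.Basis ι ℝ (VR V)) (r : X → ι → ℝ) (hr : ∀ x i, r x i ≠ 0)
    (hc : ∀ i, Continuous fun x => r x i) : Continuous fun x => scaleGL f (r x) (hr x) := by
  classical
  simp only [scaleGL_eq]
  refine (continuous_matEquiv_symm f).comp (Units.continuous_iff.2 ⟨?_, ?_⟩)
  · exact (continuous_pi hc).matrix_diagonal
  · exact (continuous_pi fun i => (hc i).inv₀ fun x => hr x i).matrix_diagonal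

theorem XSharp.continuous_toBorelSerre :
    Continuous (XSharp.toBorelSerre : XSharp V → BorelSerre V) := by
  refine XSharp.continuous_iff.2 fun n e P hP => ?_
  have hτ : ∀ x : P.realPoints × orthant n P,
      (fun U => x.2.1 (dimIndex e U)) ∈ P.TorusBar := fun x U => x.2.2.1 _
  have h1 : XSharp.toBorelSerre ∘ chartSharp e P hP = P.corner ∘ fun x =>
      (⟨fun U => x.2.1 (dimIndex e U), hτ x⟩, _) := funext fun x => (corner_eq hP x (hτ x)).symm
  rw [h1]
  refine P.continuous_corner.comp (Continuous.prodMk ?_ ?_)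
  · refine Continuous.subtype_mk (continuous_pi fun U => ?_) _
    exact (continuous_apply _).comp (continuous_subtype_val.comp continuous_snd)
  -- `P.lift` is an arbitrary choice without continuity, but conjugation sees only its image in PGL,
  -- which is the given g.
  · simp only [maxK_push_lift, ← map_scaleGL, basisNorm_map]
    simp only [← conj_maxK, ← MaxCompact.conj_mul]
    refine (MaxCompact.isOpenQuotientMap_conj _).continuous.comp ?_
    refine (continuous_subtype_val.comp continuous_fst).mul (continuous_toPGL.comp ?_)
    refine continuous_scaleGL _ _ _ fun j => ?_
    -- Once the coordinates that may vanish are replaced by 1, the condition t_k ≠ 0 in the product,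
    -- which would spoil continuity, is vacuous.
    simp only [stdCoeff_eq_prod fun k => (extendCoord_one_pos hP (Subtype.property _) k).ne',
      ← Finset.prod_inv_distrib, inv_inv]
    refine continuous_finsetProd _ fun k _ => ?_
    have h2 : Continuous fun x : P.realPoints × orthant n P =>
        ((fun _ => 1 : P.Proper → ℝ), x.2.1) :=
      continuous_const.prodMk (continuous_subtype_val.comp continuous_snd)
    exact (continuous_extendCoord (e := e) (P := P) k).comp h2

theorem one_mem_orthant : (fun _ => 1 : Fin n → ℝ) ∈ orthant n P :=
  ⟨fun _ => zero_le_one, fun _ _ => one_pos⟩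

/-- The lift, to the domain of a chart of `X̄^♯_{ℚ,v}`, of a point of the corner. -/
def chartLift (hP : Adapted e P) (x : P.TorusBar × GLR V) : P.realPoints × orthant n P :=
  (iwasawaPoint hP x.2, ⟨extendCoord e x.1.1 fun _ => 1,
    extendCoord_mem_orthant hP x.1.2 one_mem_orthant⟩)

theorem continuous_chartLift (hP : Adapted e P) : Continuous (chartLift hP) := by
  refine ((continuous_iwasawaPoint hP).comp continuous_snd).prodMk
    (Continuous.subtype_mk (continuous_pi fun k => ?_) _)
  have h : Continuous fun x : P.TorusBar × GLR V => (x.1.1, (fun _ => 1 : Fin n → ℝ)) :=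
    (continuous_subtype_val.comp continuous_fst).prodMk continuous_const
  exact (continuous_extendCoord (e := e) (P := P) k).comp h

theorem chartLift_snd (hP : Adapted e P) (x : P.TorusBar × GLR V) :
    (chartLift hP x).2.1 = extendCoord e x.1.1 fun _ => 1 := rfl

theorem scaleBasis_one {ι : Type*} [Fintype ι] (f : Module.Basis ι ℝ (VR V)) {r : ι → ℝ}
    (hr : ∀ i, r i ≠ 0) (h1 : ∀ i, r i = 1) : scaleBasis f r hr = f :=
  Module.Basis.eq_of_apply_eq fun j => by rw [scaleBasis_apply, h1, one_smul]

/-- Setting the coordinates outside the flag to 1 makes every coefficient in `corner_eq` trivial,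
and the Iwasawa part moves the base point as x.2 does. -/
theorem toBorelSerre_chartLift (hP : Adapted e P) (x : P.TorusBar × GLR V) :
    (chartSharp e P hP (chartLift hP x)).toBorelSerre = P.corner (x.1,
      MaxCompact.conj (toPGL x.2) (maxK (basisNorm (e.baseChange ℝ)))) := by
  have hτ : (fun U => (chartLift hP x).2.1 (dimIndex e U)) = x.1.1 :=
    funext fun U => by
      rw [chartLift_snd, extendCoord_dimIndex hP]
  have hmem : (fun U => (chartLift hP x).2.1 (dimIndex e U)) ∈ P.TorusBar := hτ ▸ x.1.2
  rw [← corner_eq hP _ hmem, maxK_push_lift, scaleBasis_one]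
  · congr 1
    refine Prod.ext (Subtype.ext hτ) ?_
    exact conj_iwasawa _ x.2
  · intro j
    have h1 : ∀ k, extendCoord e (fun _ : P.Proper => (1 : ℝ)) (chartLift hP x).2.1 k = 1 := by
      intro k
      by_cases hk : k ∈ Set.range (dimIndex e : P.Proper → Fin n)
      · obtain ⟨U, rfl⟩ := hk
        rw [extendCoord_dimIndex hP]
      · rw [extendCoord_of_notMem hk, chartLift_snd, extendCoord_of_notMem hk]
    rw [stdCoeff_eq_prod fun k => by rw [h1]; exact one_ne_zero]
    simp [h1]

/-- At the deepest point of the corner the torus element is an empty product. That it acts trivially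
is checked in a compatible orthonormal basis, available because K is a P(ℝ)-translate of a standard
group. -/
theorem corner_zero (P : Parabolic V) (K : MaxCompact V)
    (h0 : (fun _ => 0 : P.Proper → ℝ) ∈ P.TorusBar) :
    (P.corner (⟨_, h0⟩, K)).P = P ∧ (P.corner (⟨_, h0⟩, K)).Z = P.geodesicOrbit K := by
  refine ⟨faceOf_zero, ?_⟩
  change (P.faceOf fun _ => 0).geodesicOrbit (P.geodesicAct (P.torusOf fun _ => 0) K) = _
  rw [faceOf_zero]
  congr 1
  obtain ⟨n, e, hP⟩ := P.exists_adapted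
  obtain ⟨g, rfl⟩ := MaxCompact.exists_conj (maxK (basisNorm (e.baseChange ℝ))) K
  obtain ⟨h, rfl⟩ := toPGL_surjective g
  obtain ⟨w, hw, -⟩ := exists_compatible hP
  rw [← conj_iwasawa, conj_maxK, ← basisNorm_map,
    (hw.map (iwasawa_mem_stabGL hP h)).geodesicAct (torusOf_mem h0), scaleBasis_one]
  intro j
  simp [Parabolic.torusOf]

theorem XSharp.toBorelSerre_surjective :
    Function.Surjective (XSharp.toBorelSerre : XSharp V → BorelSerre V) := by
  intro y
  obtain ⟨K, hK⟩ := y.isOrbit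
  obtain ⟨n, e, hP⟩ := y.P.exists_adapted
  obtain ⟨g, rfl⟩ := MaxCompact.exists_conj (maxK (basisNorm (e.baseChange ℝ))) K
  obtain ⟨h, rfl⟩ := toPGL_surjective g
  have h0 : (fun _ => 0 : y.P.Proper → ℝ) ∈ y.P.TorusBar := fun _ => le_rfl
  refine ⟨chartSharp e y.P hP (chartLift hP (⟨_, h0⟩, h)), ?_⟩
  rw [toBorelSerre_chartLift]
  exact BorelSerre.ext (corner_zero _ _ h0).1 ((corner_zero _ _ h0).2.trans hK.symm)

variable (V) in
/-- The canonical bijection from `X̄^♯_{ℚ,v}` to the Borel–Serre space. -/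
def borelSerreEquiv : XSharp V ≃ BorelSerre V :=
  Equiv.ofBijective XSharp.toBorelSerre
    ⟨XSharp.toBorelSerre_injective, XSharp.toBorelSerre_surjective⟩

/-- Continuity is tested after the open quotient map Ā_P × GL_V(ℝ) → Ā_P × 𝒴; openness is what lets
the quotient map survive the product. There the inverse becomes the chart composed with the
continuous lift. -/
theorem continuous_borelSerreEquiv_symm : Continuous (borelSerreEquiv V).symm := by
  refine continuous_iSup_dom.2 fun P => continuous_coinduced_dom.2 ?_
  obtain ⟨n, e, hP⟩ := P.exists_adapted
  have hq : IsOpenQuotientMap (Prod.map (id : P.TorusBar → P.TorusBar)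
      ((fun g : PGLR V => MaxCompact.conj g (maxK (basisNorm (e.baseChange ℝ)))) ∘ toPGL)) :=
    IsOpenQuotientMap.id.prodMap
      ((MaxCompact.isOpenQuotientMap_conj _).comp isOpenQuotientMap_toPGL)
  refine hq.isQuotientMap.continuous_iff.2 ?_
  have : ((borelSerreEquiv V).symm ∘ P.corner) ∘ Prod.map (id : P.TorusBar → P.TorusBar)
      ((fun g : PGLR V => MaxCompact.conj g (maxK (basisNorm (e.baseChange ℝ)))) ∘ toPGL) =
      chartSharp e P hP ∘ chartLift hP := by
    funext x
    refine (borelSerreEquiv V).symm_apply_eq.2 ?_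
    exact (toBorelSerre_chartLift hP x).symm
  rw [this]
  exact (continuous_chartSharp e P hP).comp (continuous_chartLift hP)

variable (V) in
/-- The canonical homeomorphism from `X̄^♯_{ℚ,v}` to the Borel–Serre space. -/
def borelSerreHomeomorph : XSharp V ≃ₜ BorelSerre V where
  toEquiv := borelSerreEquiv V
  continuous_toFun := XSharp.continuous_toBorelSerre
  continuous_invFun := continuous_borelSerreEquiv_symm

end Charts

/-! ### Forgetting the splitting: the reductive Borel–Serre space -/

section Reductive

variable {P : Parabolic V}

theorem Parabolic.grMap_inv_eq_id {h : P.stabGL} {W : P.Index} (hh : P.grMap h W = LinearMap.id) :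
    P.grMap h⁻¹ W = LinearMap.id := by
  have := P.grMap_comp_inv h W
  rwa [hh, LinearMap.id_comp] at this

theorem XSharp.act_toXBar_of_unipotent (x : XSharp V) (h : x.P.stabGL)
    (hh : ∀ W, x.P.grMap h W = LinearMap.id) : (x.act h).toXBar = x.toXBar := by
  change XBar.mk x.P (fun W => (x.μ W).act (x.P.grEquiv h W)) = XBar.mk x.P x.μ
  congr 1
  funext W
  have : x.P.grEquiv h W = LinearEquiv.refl ℝ _ :=
    LinearEquiv.ext fun y => LinearMap.congr_fun (hh W) y
  rw [this, NormClass.act_refl]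

/-- The automorphism which carries a splitting to another one. -/
def Splitting.transition (s s' : Splitting P) : GLR V :=
  ofEquiv (s.totalEquiv.symm.trans s'.totalEquiv)

theorem Splitting.transition_total (s s' : Splitting P) (y : ∀ W : P.Index, P.gr W) :
    (s.transition s').1 (s.total y) = s'.total y := by
  rw [Splitting.transition, ofEquiv_apply, LinearEquiv.trans_apply, ← s.totalEquiv_apply,
    LinearEquiv.symm_apply_apply, s'.totalEquiv_apply]

theorem Splitting.transition_inv (s s' : Splitting P) :
    (s.transition s')⁻¹ = s'.transition s := by
  rw [inv_eq_iff_mul_eq_one]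
  ext1
  refine LinearMap.ext fun z => ?_
  obtain ⟨y, rfl⟩ := s'.exists_total z
  rw [Units.val_mul, Module.End.mul_apply, s'.transition_total, s.transition_total]
  rfl

theorem Splitting.transition_apply_mem (s s' : Splitting P) {W : Submodule ℚ V}
    (hW : W ∈ P.carrier) {z : VR V} (hz : z ∈ W.baseChange ℝ) :
    (s.transition s').1 z ∈ W.baseChange ℝ := by
  obtain ⟨y, rfl, hy⟩ := s.exists_total_eq W hW z hz
  rw [s.transition_total]
  refine Submodule.sum_mem _ fun U _ => ?_
  by_cases hU : U.1 ≤ W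
  · exact Submodule.baseChange_mono (A := ℝ) hU (s'.map U (y U)).2
  · rw [hy U hU, map_zero]
    exact Submodule.zero_mem _

theorem Splitting.transition_mem (s s' : Splitting P) : s.transition s' ∈ P.stabGL :=
  fun W hW z hz => ⟨s.transition_apply_mem s' hW hz, by
    rw [s.transition_inv s']
    exact s'.transition_apply_mem s hW hz⟩

theorem Splitting.transition_map (s s' : Splitting P) (W : P.Index) (y : P.gr W) :
    (s.transition s').1 (s.map W y) = s'.map W y := by
  classical
  rw [← s.total_single, s.transition_total, s'.total_single]

theorem Splitting.resMap_transition (s s' : Splitting P) (W : P.Index) (y : P.gr W) :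
    P.resMap ⟨_, s.transition_mem s'⟩ W (s.map W y) = s'.map W y :=
  Subtype.ext (s.transition_map s' W y)

theorem Splitting.grMap_transition (s s' : Splitting P) (W : P.Index) :
    P.grMap ⟨_, s.transition_mem s'⟩ W = LinearMap.id := by
  refine LinearMap.ext fun y => ?_
  conv_lhs => rw [← s.section_map W y]
  refine Eq.trans ?_ (s'.section_map W y)
  exact congrArg Submodule.Quotient.mk (s.resMap_transition s' W y)

variable [Nontrivial V]

/-- Elements of P_u(ℝ) act trivially on the graded pieces and so fix μ; conversely the transition
between two splittings is unipotent and carries one triple to the other. -/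
theorem rel_toBorelSerre_iff {x x' : XSharp V} :
    BorelSerre.Rel x.toBorelSerre x'.toBorelSerre ↔ x.toXBar = x'.toXBar := by
  constructor
  · rintro ⟨hP, _, ⟨h, rfl, hh⟩, hZ⟩
    have h1 : x'.toBorelSerre = (x.act h).toBorelSerre :=
      BorelSerre.ext hP (hZ.trans (x.isotropySet_act h).symm)
    rw [XSharp.toBorelSerre_injective h1]
    exact (x.act_toXBar_of_unipotent h hh).symm
  · intro hx
    obtain ⟨⟨P, μ⟩, s⟩ := x
    obtain ⟨⟨P', μ'⟩, s'⟩ := x'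
    obtain ⟨rfl, hμ⟩ := XBar.mk.inj hx
    obtain rfl := eq_of_heq hμ
    let h : P.stabGL := ⟨_, s.transition_mem s'⟩
    have hh := s.grMap_transition s'
    refine ⟨rfl, _, ⟨h, rfl, hh⟩, ?_⟩
    refine Eq.trans ?_ (XSharp.isotropySet_act ⟨⟨P, μ⟩, s⟩ h)
    refine congrArg XSharp.isotropySet ?_
    have h1 := XSharp.act_toXBar_of_unipotent ⟨⟨P, μ⟩, s⟩ h hh
    have h2 : (fun W => (μ W).act (P.grEquiv h W)) = μ := eq_of_heq (XBar.mk.inj h1).2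
    change XSharp.mk (XBar.mk P μ) s' = XSharp.mk (XBar.mk P fun W => (μ W).act (P.grEquiv h W)) _
    rw [h2]
    congr 1
    refine Splitting.ext fun W y => ?_
    change _ = P.resMap h W (s.map W (P.grMap h⁻¹ W y))
    rw [Parabolic.grMap_inv_eq_id (hh W)]
    exact (s.resMap_transition s' W y).symm

theorem XSharp.toXBar_surjective : Function.Surjective (XSharp.toXBar : XSharp V → XBar V) := by
  rintro ⟨P, μ⟩
  have : ∀ W : P.Index, ∃ f : P.gr W →ₗ[ℝ] P.real W,
      ((P.realPred W).submoduleOf (P.real W)).mkQ ∘ₗ f = LinearMap.id := fun W =>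
    LinearMap.exists_rightInverse_of_surjective _ (Submodule.range_mkQ _)
  choose f hf using this
  exact ⟨⟨⟨P, μ⟩, ⟨f, fun W y => LinearMap.congr_fun (hf W) y⟩⟩, rfl⟩

theorem toReductive_eq_iff {x x' : XSharp V} :
    x.toBorelSerre.toReductive = x'.toBorelSerre.toReductive ↔ x.toXBar = x'.toXBar := by
  refine ⟨fun h => ?_, fun h => Quot.sound (rel_toBorelSerre_iff.2 h)⟩
  -- Equality in `Quot` only gives the generated equivalence relation, so the classes are separated
  -- by a function on the quotient.
  let q : ReductiveBorelSerre V → XBar V :=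
    Quot.lift (fun y => ((borelSerreEquiv V).symm y).toXBar) fun y y' hy => by
      obtain ⟨x, rfl⟩ := (borelSerreEquiv V).surjective y
      obtain ⟨x', rfl⟩ := (borelSerreEquiv V).surjective y'
      simp only [Equiv.symm_apply_apply]
      exact rel_toBorelSerre_iff.1 hy
  have hq : ∀ x, q (borelSerreEquiv V x).toReductive = x.toXBar := fun x =>
    congrArg XSharp.toXBar ((borelSerreEquiv V).symm_apply_apply x)
  rw [← hq, ← hq]
  exact congrArg q h

variable (V) in
/-- The canonical homeomorphism from `X̄_{ℚ,v}` to the reductive Borel–Serre space. -/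
def reductiveHomeomorph : XBar V ≃ₜ ReductiveBorelSerre V where
  toFun z := (Function.surjInv XSharp.toXBar_surjective z).toBorelSerre.toReductive
  invFun := Quot.lift (fun y => ((borelSerreEquiv V).symm y).toXBar) fun y y' hy => by
    obtain ⟨x, rfl⟩ := (borelSerreEquiv V).surjective y
    obtain ⟨x', rfl⟩ := (borelSerreEquiv V).surjective y'
    simp only [Equiv.symm_apply_apply]
    exact rel_toBorelSerre_iff.1 hy
  left_inv z := by
    refine Eq.trans ?_ (Function.surjInv_eq XSharp.toXBar_surjective z)
    exact congrArg XSharp.toXBar ((borelSerreEquiv V).symm_apply_apply _)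
  right_inv y := by
    induction y using Quot.ind with
    | mk y =>
      obtain ⟨x, rfl⟩ := (borelSerreEquiv V).surjective y
      refine toReductive_eq_iff.2 ?_
      refine (Function.surjInv_eq XSharp.toXBar_surjective _).trans ?_
      exact congrArg XSharp.toXBar ((borelSerreEquiv V).symm_apply_apply _)
  continuous_toFun := by
    refine XBar.continuous_iff.2 fun n e P hP => ?_
    -- The chosen preimage under the forgetful map need not vary continuously, but along a chart it
    -- may be replaced by the chart with splitting, without changing the class.
    have : (fun z : XBar V =>
        (Function.surjInv XSharp.toXBar_surjective z).toBorelSerre.toReductive) ∘ chartBar e P hP =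
        BorelSerre.toReductive ∘ XSharp.toBorelSerre ∘ chartSharp e P hP := by
      funext x
      refine toReductive_eq_iff.2 ?_
      exact Function.surjInv_eq XSharp.toXBar_surjective _
    rw [this]
    exact continuous_quot_mk.comp
      (XSharp.continuous_toBorelSerre.comp (continuous_chartSharp e P hP))
  continuous_invFun :=
    continuous_quot_lift _ (XSharp.continuous_toXBar.comp continuous_borelSerreEquiv_symm)

theorem reductiveHomeomorph_toXBar (x : XSharp V) :
    reductiveHomeomorph V x.toXBar = (borelSerreHomeomorph V x).toReductive :=
  toReductive_eq_iff.2 (Function.surjInv_eq XSharp.toXBar_surjective x.toXBar)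

end Reductive

end BSpace

end

theorem proposition3p6p4 (V : Type*) [AddCommGroup V] [Module ℚ V] [FiniteDimensional ℚ V]
    [Nontrivial V] :
    ∃ (Φ : BSpace.XSharp V ≃ₜ BSpace.BorelSerre V)
      (Ψ : BSpace.XBar V ≃ₜ BSpace.ReductiveBorelSerre V),
      (∀ x : BSpace.XSharp V, (Φ x).P = x.P ∧ (Φ x).Z = x.isotropySet) ∧
      ∀ x : BSpace.XSharp V, Ψ x.toXBar = (Φ x).toReductive :=
  ⟨BSpace.borelSerreHomeomorph V, BSpace.reductiveHomeomorph V, fun _ => ⟨rfl, rfl⟩,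
    BSpace.reductiveHomeomorph_toXBar⟩
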